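/- Fix $H\in(0,1/2]$, let $M$ be the smallest integer with $(M+1)H-1/2>0$, and let $\kappa>0$ satisfy $(M+1)(H-\kappa)-1/2-\kappa>0$. Let $\mathrm H$ be the Cameron–Martin space of paths $\mathrm h=(h,\bar h):[0,1]\to\mathbb R^2$ with $\mathrm h(0)=0$ and $\dot{\mathrm h}\in L^2$, $\|\mathrm h\|_{\mathrm H}=\|\dot{\mathrm h}\|_{L^2}$. Let $K^H(s,t)=\sqrt{2H}\,|t-s|^{H-1/2}1_{0<s<t}$, $\hat h=K^H*\dot h$, and write $f_{s,t}=f_t-f_s$. A (deterministic rough volatility) *model* is a family $\mathbf W=(W^1,W^2,\hat W,(\mathbb W^{i,m})_{i=1,2;\,0\le m\le M})$, with $(W^1,W^2)=(W,\bar W)$, of functions on $[0,1]$, respectively on $\{0\le s\le t\le 1\}$, such that $W_0=\bar W_0=0$; $\hat W=K^H*\dot W$ in the sense of distributions; $\mathbb W^{i,0}_{s,t}=W^i_{s,t}$; Chen's relation $$\mathbb W^{i,m}_{s,t}=\mathbb W^{i,m}_{s,u}+\sum_{j=0}^m\binom mj(\hat W_{s,u})^{m-j}\,\mathbb W^{i,j}_{u,t}\qquad(s\le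 u\le t)$$ holds; and $\|\mathbf W\|<\infty$. ($\mathbb W^{i,m}_{s,t}$ stands for $\int_s^t\hat W_{s,r}^m\,dW^i_r$ and is supplied a priori.) Here, for any such family of functions, with $\|A\|_\alpha=\sup_{0\le s<t\le1}|A_{s,t}|/|t-s|^\alpha$ and $\alpha_m=m(H-\kappa)+1/2-\kappa$, $$\|\mathbf W\|=\|\hat W\|_{H-\kappa}+\sum_{i=1}^2\sum_{m=0}^M\|\mathbb W^{i,m}\|_{\alpha_m},\qquad |||\mathbf W|||=\|\hat W\|_{H-\kappa}+\sum_{i=1}^2\sum_{m=0}^M\|\mathbb W^{i,m}\|_{\alpha_m}^{1/(m+1)} .$$ The model distance is $\|\mathbf W;\mathbf V\|=\|\mathbf W-\mathbf V\|$, with the componentwise difference. The canonical lift of $\mathrm h=(h^1,h^2)\in\mathrm H$ is $\mathbf h=(h^1,h^2,\hat h,(\int_s^t\hat h_{s,r}^m\,\dot h^i_r\,dr)_{i,m})$. The translate $T_{\mathrm h}\mathbf W$ has components $W^i+h^i$, $\hat W+\hat h$ and $$\int_s^t(\hat W+\hat h)_{s,r}^m\,d(W^i+h^i)_r:=\sum_{j=0}^m\binom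 mj\int_s^t\hat h_{s,r}^{m-j}\,d_r\mathbb W^{i,j}_{s,r}+\int_s^t(\hat W_{s,r}+\hat h_{s,r})^m\,\dot h^i_r\,dr ,$$ with Young (Riemann–Stieltjes) integrals $\int_s^t\hat h^{m-j}_{s,r}\,d_r\mathbb W^{i,j}_{s,r}$. (i) For every $\mathrm h\in\mathrm H$ and every model $\mathbf W$ the Young integrals above exist and $T_{\mathrm h}\mathbf W$ is again a model. The map $T_{\mathrm h}$ is a homeomorphism of the space of models with respect to the model distance, with inverse $T_{-\mathrm h}$. (ii) There is a constant $C$ depending only on $H$ and $\kappa$ such that for all $\mathrm h\in\mathrm H$ and all models $\mathbf W$ $$|||T_{\mathrm h}\mathbf W|||\le C\,\big(|||\mathbf W|||+\|\mathrm h\|_{\mathrm H}\big).$$ (iii) Let $\mathrm h\in\mathrm H$. For every $R>0$ there is a constant $C=C(H,\kappa,\mathrm h,R)$ such that for all models $\mathbf W$ and all $\delta\in(0,R]$ $$\|T_{-\mathrm h}\mathbf W\|\le\delta\ \Rightarrow\ \|\mathbf W-\mathbf h\|\le C\delta,\qquad \|\mathbf W-\mathbf h\|\le\delta\ \Rightarrow\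 \|T_{-\mathrm h}\mathbf W\|\le C\delta .$$ Moreover, there is a constant $C=C(H,\kappa,\mathrm h)$ such that for all models $\mathbf W$ and all $\delta>0$, with $\omega(\delta)=\max(\delta,\delta^{1/(M+1)})$, $$|||T_{-\mathrm h}\mathbf W|||\le\delta\ \Rightarrow\ |||\mathbf W-\mathbf h|||\le C\,\omega(\delta),\qquad |||\mathbf W-\mathbf h|||\le\delta\ \Rightarrow\ |||T_{-\mathrm h}\mathbf W|||\le C\,\omega(\delta).$$ -/

import Mathlib

open MeasureTheory Set
open scoped ENNReal NNReal

noncomputable section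

namespace RoughVol

/-! ### Cameron-Martin space, Volterra kernel, Riemann-Stieltjes integrals -/

/-- The Cameron-Martin space of paths `(h, h̄) : [0,1] → ℝ²` started at the origin with square
integrable derivative. A path is represented by its derivative in `L²([0,1]; ℝ²)`, so the norm is
`‖h‖² = ‖ḣ‖²_{L²} + ‖h̄'‖²_{L²}`; the path itself is `CMSpace.path`. -/
abbrev CMSpace : Type :=
  PiLp 2 (fun _ : Fin 2 => Lp ℝ 2 (volume.restrict (Icc (0 : ℝ) 1)))

/-- The components `h = h.path 0` and `h̄ = h.path 1` of a Cameron-Martin path. -/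
def CMSpace.path (h : CMSpace) (i : Fin 2) (t : ℝ) : ℝ :=
  ∫ r in (0 : ℝ)..t, h i r

/-- The Volterra kernel `K^H(s,t) = √(2H) (t-s)^(H-1/2)` for `0 < s < t`, and `0` otherwise. -/
def kernel (H s t : ℝ) : ℝ :=
  if 0 < s ∧ s < t then Real.sqrt (2 * H) * (t - s) ^ (H - 1 / 2) else 0

/-- `ĥ = K^H * ḣ`, with `h` the first component of the Cameron-Martin path. -/
def CMSpace.vol (H : ℝ) (h : CMSpace) (t : ℝ) : ℝ :=
  ∫ s in (0 : ℝ)..t, kernel H s t * h 0 s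

/-- `I` is the Riemann-Stieltjes integral `∫_a^b f dg`: the limit, as the mesh tends to `0`, of the
sums over arbitrarily tagged partitions of `[a,b]`. (This is the integral that Young's theorem is
about.) -/
def HasRSIntegral (f g : ℝ → ℝ) (a b I : ℝ) : Prop :=
  ∀ ε > 0, ∃ δ > 0, ∀ (n : ℕ) (t ξ : ℕ → ℝ), t 0 = a → t n = b →
    (∀ k < n, t k ≤ ξ k ∧ ξ k ≤ t (k + 1) ∧ t (k + 1) - t k < δ) →
    |(∑ k ∈ Finset.range n, f (ξ k) * (g (t (k + 1)) - g (t k))) - I| < ε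

open Classical in
/-- The Riemann-Stieltjes integral `∫_a^b f dg` (with value `0` if it does not exist). -/
def rsIntegral (f g : ℝ → ℝ) (a b : ℝ) : ℝ :=
  if h : ∃ I, HasRSIntegral f g a b I then h.choose else 0

/-! ### Models -/

/-- The number `M` of nonlinear levels: the smallest integer with `(M+1) H - 1/2 > 0`. -/
def order (H : ℝ) : ℕ := sInf {M : ℕ | 0 < ((M : ℝ) + 1) * H - 1 / 2}

/-- The list of components `(W, W̄, Ŵ, ∫ Ŵ dW, ∫ Ŵ dW̄, ∫ Ŵ² dW, …)`, without any condition: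
`noise 0 = W`, `noise 1 = W̄`, `vol = Ŵ`, and `iter i m s t` stands for
`∫_s^t (Ŵ_r - Ŵ_s)^m d(noise i)_r`, an object that is supplied a priori. -/
@[ext]
structure ModelData where
  noise : Fin 2 → ℝ → ℝ
  vol : ℝ → ℝ
  iter : Fin 2 → ℕ → ℝ → ℝ → ℝ

/-- The componentwise difference. It is in general not a model, even for models. -/
instance : Sub ModelData where
  sub A B :=
    { noise := fun i t => A.noise i t - B.noise i t
      vol := fun t => A.vol t - B.vol t
      iter := fun i m s t => A.iter i m s t - B.iter i m s t }

/-- The `α`-Hölder seminorm on `[0,1]` of a function of two times `s < t`. -/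
def holderNorm (α : ℝ) (A : ℝ → ℝ → ℝ) : ℝ≥0∞ :=
  ⨆ (s : ℝ) (t : ℝ) (_ : 0 ≤ s ∧ s < t ∧ t ≤ 1), ENNReal.ofReal (|A s t| / (t - s) ^ α)

/-- The model norm `‖W‖_{1/2-κ} + ‖W̄‖_{1/2-κ} + ‖Ŵ‖_{H-κ} + … + ‖∫ Ŵ^M dW̄‖_{M(H-κ)+1/2-κ}`.
The level `m = 0` consists of the increments of `W` and of `W̄`. -/
def modelNorm (H κ : ℝ) (A : ModelData) : ℝ≥0∞ :=
  holderNorm (H - κ) (fun s t => A.vol t - A.vol s) +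
    ∑ i : Fin 2, ∑ m ∈ Finset.range (order H + 1),
      holderNorm (m * (H - κ) + 1 / 2 - κ) (A.iter i m)

/-- The homogeneous model norm: the seminorm of `∫ Ŵ^m dW` enters with the power `1/(m+1)`. -/
def homNorm (H κ : ℝ) (A : ModelData) : ℝ≥0∞ :=
  holderNorm (H - κ) (fun s t => A.vol t - A.vol s) +
    ∑ i : Fin 2, ∑ m ∈ Finset.range (order H + 1),
      holderNorm (m * (H - κ) + 1 / 2 - κ) (A.iter i m) ^ (1 / ((m : ℝ) + 1))

/-- The (deterministic) rough volatility models on `[0,1]`. -/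
structure IsRVModel (H κ : ℝ) (A : ModelData) : Prop where
  /-- The paths start at the origin. -/
  noise_zero : ∀ i, A.noise i 0 = 0
  /-- `Ŵ = K^H * Ẇ`, in the sense of distributions: since `W_0 = 0`, this is the derivative of
  `K^H * W`. -/
  vol_eq : ∀ t, 0 ≤ t → t ≤ 1 →
    ∫ s in (0 : ℝ)..t, A.vol s = ∫ s in (0 : ℝ)..t, kernel H s t * A.noise 0 s
  /-- The level `0` consists of the increments of the two noises. -/
  iter_zero : ∀ i s t, 0 ≤ s → s ≤ t → t ≤ 1 → A.iter i 0 s t = A.noise i t - A.noise i s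
  /-- The algebraic relation `Π_t = Π_s Γ_st`, integrated in time (Chen's relation). -/
  chen : ∀ i m s u t, m ≤ order H → 0 ≤ s → s ≤ u → u ≤ t → t ≤ 1 →
    A.iter i m s t = A.iter i m s u +
      ∑ j ∈ Finset.range (m + 1),
        (m.choose j : ℝ) * (A.vol u - A.vol s) ^ (m - j) * A.iter i j u t
  /-- The analytic bounds: `W, W̄ ∈ C^{1/2-κ}`, `Ŵ ∈ C^{H-κ}`, and
  `|∫_s^t (Ŵ_r - Ŵ_s)^m dW_r| ≲ |t-s|^{m(H-κ)+1/2-κ}`. -/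
  bound : modelNorm H κ A < ∞
  /-- The components are functions of `t ∈ [0,1]`, of `0 ≤ s ≤ t ≤ 1` and of `m ≤ M`. They are
  coded as functions on the full types that vanish elsewhere, so that equality in `ModelData` is
  equality of the components on their domains. -/
  noise_support : ∀ i t, ¬(0 ≤ t ∧ t ≤ 1) → A.noise i t = 0
  vol_support : ∀ t, ¬(0 ≤ t ∧ t ≤ 1) → A.vol t = 0
  iter_support : ∀ i m s t, ¬(m ≤ order H ∧ 0 ≤ s ∧ s ≤ t ∧ t ≤ 1) → A.iter i m s t = 0

/-- The space of rough volatility models. -/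
def RVModel (H κ : ℝ) : Type := {A : ModelData // IsRVModel H κ A}

/-! ### The model distance -/

theorem holderNorm_zero (α : ℝ) : holderNorm α (fun _ _ => 0) = 0 := by
  simp [holderNorm]

theorem holderNorm_congr_neg (α : ℝ) {A B : ℝ → ℝ → ℝ} (h : ∀ s t, A s t = -B s t) :
    holderNorm α A = holderNorm α B := by
  simp [holderNorm, h]

theorem holderNorm_le_add (α : ℝ) {A B C : ℝ → ℝ → ℝ} (h : ∀ s t, A s t = B s t + C s t) :
    holderNorm α A ≤ holderNorm α B + holderNorm α C := by
  unfold holderNorm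
  refine iSup_le fun s => iSup_le fun t => iSup_le fun hst => ?_
  have hpos : 0 < (t - s) ^ α := Real.rpow_pos_of_pos (sub_pos.2 hst.2.1) α
  calc ENNReal.ofReal (|A s t| / (t - s) ^ α)
      ≤ ENNReal.ofReal (|B s t| / (t - s) ^ α + |C s t| / (t - s) ^ α) := by
        refine ENNReal.ofReal_le_ofReal ?_
        rw [h, ← add_div]
        gcongr
        exact abs_add_le _ _
    _ ≤ ENNReal.ofReal (|B s t| / (t - s) ^ α) + ENNReal.ofReal (|C s t| / (t - s) ^ α) :=
        ENNReal.ofReal_add_le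
    _ ≤ _ := by
        gcongr
        · exact le_iSup_of_le s (le_iSup_of_le t (le_iSup_of_le hst le_rfl))
        · exact le_iSup_of_le s (le_iSup_of_le t (le_iSup_of_le hst le_rfl))

/-- The model distance is the model norm of the componentwise difference. -/
instance (H κ : ℝ) : PseudoEMetricSpace (RVModel H κ) where
  edist A B := modelNorm H κ (A.1 - B.1)
  edist_self A := by
    simp [modelNorm, HSub.hSub, Sub.sub]
    simp [holderNorm]
  edist_comm A B := by
    unfold modelNorm
    congr 1
    · exact holderNorm_congr_neg _ fun s t => by
        change (A.1.vol t - B.1.vol t) - (A.1.vol s - B.1.vol s)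
          = -((B.1.vol t - A.1.vol t) - (B.1.vol s - A.1.vol s))
        ring
    · refine Finset.sum_congr rfl fun i _ => Finset.sum_congr rfl fun m _ => ?_
      exact holderNorm_congr_neg _ fun s t => by
        change A.1.iter i m s t - B.1.iter i m s t = -(B.1.iter i m s t - A.1.iter i m s t)
        ring
  edist_triangle A B C := by
    unfold modelNorm
    rw [add_add_add_comm, ← Finset.sum_add_distrib]
    refine add_le_add ?_ (Finset.sum_le_sum fun i _ => ?_)
    · exact holderNorm_le_add _ fun s t => by
        change (A.1.vol t - C.1.vol t) - (A.1.vol s - C.1.vol s)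
          = ((A.1.vol t - B.1.vol t) - (A.1.vol s - B.1.vol s))
            + ((B.1.vol t - C.1.vol t) - (B.1.vol s - C.1.vol s))
        ring
    · rw [← Finset.sum_add_distrib]
      refine Finset.sum_le_sum fun m _ => ?_
      exact holderNorm_le_add _ fun s t => by
        change A.1.iter i m s t - C.1.iter i m s t
          = (A.1.iter i m s t - B.1.iter i m s t) + (B.1.iter i m s t - C.1.iter i m s t)
        ring

/-! ### Canonical lift and translation -/

/-- The canonical model `(h, h̄, ĥ, ∫ ĥ dh, ∫ ĥ dh̄, …)` of a Cameron-Martin path, with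
`∫_s^t (ĥ_r - ĥ_s)^m dh_r = ∫_s^t (ĥ_r - ĥ_s)^m ḣ_r dr`. -/
def lift (H : ℝ) (h : CMSpace) : ModelData where
  noise i t := if 0 ≤ t ∧ t ≤ 1 then h.path i t else 0
  vol t := if 0 ≤ t ∧ t ≤ 1 then h.vol H t else 0
  iter i m s t :=
    if m ≤ order H ∧ 0 ≤ s ∧ s ≤ t ∧ t ≤ 1 then
      ∫ r in s..t, (h.vol H r - h.vol H s) ^ m * h i r
    else 0

/-- The translate `T_h W = (W + h, W̄ + h̄, Ŵ + ĥ, ∫ (Ŵ + ĥ) d(W + h), …)`, where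
`∫_s^t (Ŵ_{s,r} + ĥ_{s,r})^m d(W + h)_r` is, with `A_{s,r} = A_r - A_s`,
`∑_j (m choose j) ∫_s^t ĥ_{s,r}^(m-j) d(∫_s^r Ŵ_{s,v}^j dW_v) + ∫_s^t (Ŵ_{s,r} + ĥ_{s,r})^m ḣ_r dr`;
the integrals in the first sum are Young integrals against the components of the model. -/
def translate (H : ℝ) (h : CMSpace) (A : ModelData) : ModelData where
  noise i t := if 0 ≤ t ∧ t ≤ 1 then A.noise i t + h.path i t else 0
  vol t := if 0 ≤ t ∧ t ≤ 1 then A.vol t + h.vol H t else 0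
  iter i m s t :=
    if m ≤ order H ∧ 0 ≤ s ∧ s ≤ t ∧ t ≤ 1 then
      (∑ j ∈ Finset.range (m + 1), (m.choose j : ℝ) *
        rsIntegral (fun r => (h.vol H r - h.vol H s) ^ (m - j)) (fun r => A.iter i j s r) s t) +
      ∫ r in s..t, ((A.vol r - A.vol s) + (h.vol H r - h.vol H s)) ^ m * h i r
    else 0

end RoughVol

end

open RoughVol

noncomputable section

namespace RoughVol

/-! ### Riemann-Stieltjes integrals -/

/-! Analytic core. The noise is only (1/2-κ)-Hölder and `ĥ` is used as an (H-κ)-Hölder path; these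
exponents add up to less than one, so Young's theorem for two Hölder paths does not apply. The
missing 1/2 comes from `ḣ ∈ L²`: by a weighted Cauchy-Schwarz inequality, `|ĥ_{u,v}| ≤ (v-u)^(H-κ)
(w v - w u)^(1/2)` for a nondecreasing `w` built from `ḣ²` (`CMSpace.abs_vol_sub_le`). The total
exponent is then 1 + H - 2κ, and the minimality of `M` together with the condition on κ forces 2κ <
H (`two_mul_lt_of_order`). A sewing argument for defects of size `(v-u)^η (w v - w u)^(1/2)` with η
> 1/2 yields primitives (`exists_isYoungPrimitive`). From them follow existence, additivity and
associativity of the Young integrals, and bounds proportional to `‖h‖^p` for `∫ ĥ^p dg`.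

Algebraic core. Chen's relation for the translate and `T_{-h} T_h = 1` are binomial identities
between the numbers `∫ ĥ^p d𝕎^l`. A linear functional sends `X₀^p X₁^l` to such a number, and the
identities become the binomial theorem in a polynomial ring (`sum_monomialFunctional_shift`,
`sum_sum_neg_one_pow`).

Estimates. For fixed `s`, Chen's relation makes `r ↦ 𝕎^j_{s,r}` a (1/2-κ)-Hölder path on `[s,t]`
with constant of order `(t-s)^(j(H-κ))`, so the Young bounds have the right order in `t-s`. In the
homogeneous norm each term at level `m` has degree `m+1` in `(|||W|||, ‖h‖)`, which gives (ii).
Applied to the difference of two models, the same estimates show that `T_h` is locally Lipschitz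
(`Admissible.exists_translate_sub_bound`); this gives continuity in (i). For (iii), the lift of `h`
is `T_h 0`, so that `W - h = T_h (T_{-h} W) - T_h 0` and `T_{-h} W = T_{-h} W - T_{-h} h`: both
implications are local Lipschitz bounds at a fixed base point. -/

theorem partition_le {t : ℕ → ℝ} {n : ℕ} (h : ∀ k < n, t k ≤ t (k + 1)) {i j : ℕ} (hij : i ≤ j)
    (hj : j ≤ n) : t i ≤ t j := by
  induction j, hij using Nat.le_induction with
  | base => exact le_rfl
  | succ j hij ih => exact (ih (by omega)).trans (h j (by omega))

theorem exists_partition {a b δ : ℝ} (hab : a ≤ b) (hδ : 0 < δ) :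
    ∃ (n : ℕ) (t : ℕ → ℝ), t 0 = a ∧ t n = b ∧ Monotone t ∧ ∀ k, t (k + 1) - t k < δ := by
  obtain ⟨n, hn⟩ := exists_nat_gt ((b - a) / δ)
  have hn0 : (0 : ℝ) < n := lt_of_le_of_lt (div_nonneg (sub_nonneg.2 hab) hδ.le) hn
  have hd : 0 ≤ (b - a) / n := div_nonneg (sub_nonneg.2 hab) hn0.le
  refine ⟨n, fun k => a + k * ((b - a) / n), by simp, by field_simp; ring, ?_, fun k => ?_⟩
  · intro i j hij
    have : (i : ℝ) ≤ j := by exact_mod_cast hij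
    simp only
    gcongr
  · push_cast
    have : (b - a) / n < δ := by
      rw [div_lt_iff₀ hn0]; rw [div_lt_iff₀ hδ] at hn; linarith
    linarith

/-- For `a ≤ b` there are partitions of arbitrarily small mesh, so the defining condition is not
vacuous and two limits must agree. -/
theorem HasRSIntegral.unique {f g : ℝ → ℝ} {a b I J : ℝ} (hab : a ≤ b)
    (hI : HasRSIntegral f g a b I) (hJ : HasRSIntegral f g a b J) : I = J := by
  by_contra hne
  have hpos : 0 < |I - J| / 2 := by have := abs_pos.2 (sub_ne_zero.2 hne); linarith
  obtain ⟨δ, hδ, h1⟩ := hI _ hpos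
  obtain ⟨δ', hδ', h2⟩ := hJ _ hpos
  obtain ⟨n, t, h0, hn, hm, ht⟩ := exists_partition hab (lt_min hδ hδ')
  have e1 := h1 n t t h0 hn fun k _ =>
    ⟨le_rfl, hm k.le_succ, (ht k).trans_le (min_le_left _ _)⟩
  have e2 := h2 n t t h0 hn fun k _ =>
    ⟨le_rfl, hm k.le_succ, (ht k).trans_le (min_le_right _ _)⟩
  have := abs_sub_le I (∑ k ∈ Finset.range n, f (t k) * (g (t (k + 1)) - g (t k))) J
  rw [abs_sub_comm I (∑ k ∈ Finset.range n, f (t k) * (g (t (k + 1)) - g (t k)))] at this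
  linarith

theorem HasRSIntegral.rsIntegral_eq {f g : ℝ → ℝ} {a b I : ℝ} (hab : a ≤ b)
    (hI : HasRSIntegral f g a b I) : rsIntegral f g a b = I := by
  have h : ∃ I, HasRSIntegral f g a b I := ⟨I, hI⟩
  rw [rsIntegral, dif_pos h]
  exact h.choose_spec.unique hab hI

theorem HasRSIntegral.congr {f f' g g' : ℝ → ℝ} {a b I : ℝ}
    (hI : HasRSIntegral f g a b I) (hf : ∀ x, a ≤ x → x ≤ b → f' x = f x)
    (hg : ∀ x, a ≤ x → x ≤ b → g' x = g x) : HasRSIntegral f' g' a b I := by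
  intro ε hε
  obtain ⟨δ, hδ, h⟩ := hI ε hε
  refine ⟨δ, hδ, fun n t ξ h0 hn hk => ?_⟩
  have hm : ∀ k < n, t k ≤ t (k + 1) := fun k hkn => (hk k hkn).1.trans (hk k hkn).2.1
  have hl : ∀ k ≤ n, a ≤ t k := fun k hkn => h0 ▸ partition_le hm (Nat.zero_le _) hkn
  have hr : ∀ k ≤ n, t k ≤ b := fun k hkn => hn ▸ partition_le hm hkn le_rfl
  rw [Finset.sum_congr rfl (g := fun k => f (ξ k) * (g (t (k + 1)) - g (t k)))]
  · exact h n t ξ h0 hn hk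
  · intro k hkn
    have hkn := Finset.mem_range.1 hkn
    rw [hf (ξ k) ((hl k hkn.le).trans (hk k hkn).1) ((hk k hkn).2.1.trans (hr _ hkn)),
      hg _ (hl _ hkn) (hr _ hkn), hg _ (hl _ hkn.le) (hr _ hkn.le)]

theorem HasRSIntegral.add_left {f f' g : ℝ → ℝ} {a b I I' : ℝ} (h : HasRSIntegral f g a b I)
    (h' : HasRSIntegral f' g a b I') : HasRSIntegral (fun x => f x + f' x) g a b (I + I') := by
  intro ε hε
  obtain ⟨δ, hδ, h1⟩ := h (ε / 2) (half_pos hε)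
  obtain ⟨δ', hδ', h2⟩ := h' (ε / 2) (half_pos hε)
  refine ⟨min δ δ', lt_min hδ hδ', fun n t ξ h0 hn hk => ?_⟩
  have e1 := h1 n t ξ h0 hn fun k hkn =>
    ⟨(hk k hkn).1, (hk k hkn).2.1, (hk k hkn).2.2.trans_le (min_le_left _ _)⟩
  have e2 := h2 n t ξ h0 hn fun k hkn =>
    ⟨(hk k hkn).1, (hk k hkn).2.1, (hk k hkn).2.2.trans_le (min_le_right _ _)⟩
  simp only [add_mul, Finset.sum_add_distrib]
  rw [add_sub_add_comm]
  exact (abs_add_le _ _).trans_lt (by linarith)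

theorem HasRSIntegral.add_right {f g g' : ℝ → ℝ} {a b I I' : ℝ} (h : HasRSIntegral f g a b I)
    (h' : HasRSIntegral f g' a b I') : HasRSIntegral f (fun x => g x + g' x) a b (I + I') := by
  intro ε hε
  obtain ⟨δ, hδ, h1⟩ := h (ε / 2) (half_pos hε)
  obtain ⟨δ', hδ', h2⟩ := h' (ε / 2) (half_pos hε)
  refine ⟨min δ δ', lt_min hδ hδ', fun n t ξ h0 hn hk => ?_⟩
  have e1 := h1 n t ξ h0 hn fun k hkn =>
    ⟨(hk k hkn).1, (hk k hkn).2.1, (hk k hkn).2.2.trans_le (min_le_left _ _)⟩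
  have e2 := h2 n t ξ h0 hn fun k hkn =>
    ⟨(hk k hkn).1, (hk k hkn).2.1, (hk k hkn).2.2.trans_le (min_le_right _ _)⟩
  simp only [add_sub_add_comm, mul_add, Finset.sum_add_distrib]
  exact (abs_add_le _ _).trans_lt (by linarith)

theorem HasRSIntegral.const_mul_left {f g : ℝ → ℝ} {a b I : ℝ} (c : ℝ)
    (h : HasRSIntegral f g a b I) : HasRSIntegral (fun x => c * f x) g a b (c * I) := by
  intro ε hε
  have hc : 0 < |c| + 1 := by positivity
  obtain ⟨δ, hδ, h1⟩ := h (ε / (|c| + 1)) (by positivity)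
  refine ⟨δ, hδ, fun n t ξ h0 hn hk => ?_⟩
  have e1 := h1 n t ξ h0 hn hk
  simp only [mul_assoc]
  rw [← Finset.mul_sum, ← mul_sub, abs_mul]
  rw [lt_div_iff₀ hc] at e1
  nlinarith [abs_nonneg (∑ k ∈ Finset.range n, f (ξ k) * (g (t (k + 1)) - g (t k)) - I)]

theorem HasRSIntegral.const_mul_right {f g : ℝ → ℝ} {a b I : ℝ} (c : ℝ)
    (h : HasRSIntegral f g a b I) : HasRSIntegral f (fun x => c * g x) a b (c * I) := by
  intro ε hε
  obtain ⟨δ, hδ, h1⟩ := h.const_mul_left c ε hε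
  refine ⟨δ, hδ, fun n t ξ h0 hn hk => ?_⟩
  have e1 := h1 n t ξ h0 hn hk
  rwa [Finset.sum_congr rfl fun k _ => show f (ξ k) * (c * g (t (k + 1)) - c * g (t k)) =
    c * f (ξ k) * (g (t (k + 1)) - g (t k)) by ring]

theorem hasRSIntegral_zero_left (g : ℝ → ℝ) (a b : ℝ) : HasRSIntegral (fun _ => 0) g a b 0 :=
  fun ε hε => ⟨1, one_pos, fun n t ξ _ _ _ => by simpa using hε⟩

theorem hasRSIntegral_const_right (f : ℝ → ℝ) (c a b : ℝ) :
    HasRSIntegral f (fun _ => c) a b 0 :=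
  fun ε hε => ⟨1, one_pos, fun n t ξ _ _ _ => by simpa using hε⟩

theorem hasRSIntegral_one (g : ℝ → ℝ) (a b : ℝ) :
    HasRSIntegral (fun _ => 1) g a b (g b - g a) :=
  fun ε hε => ⟨1, one_pos, fun n t ξ h0 hn _ => by
    simp only [one_mul, Finset.sum_range_sub (fun k => g (t k)), h0, hn, sub_self, abs_zero]
    exact hε⟩

theorem HasRSIntegral.sum_left {ι : Type*} (S : Finset ι) {f : ι → ℝ → ℝ} {g : ℝ → ℝ} {a b : ℝ}
    {I : ι → ℝ} (h : ∀ i ∈ S, HasRSIntegral (f i) g a b (I i)) :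
    HasRSIntegral (fun x => ∑ i ∈ S, f i x) g a b (∑ i ∈ S, I i) := by
  classical
  induction S using Finset.induction_on with
  | empty => simpa using hasRSIntegral_zero_left g a b
  | insert i S hi ih =>
    simp only [Finset.sum_insert hi]
    exact (h i (by simp)).add_left (ih fun k hk => h k (by simp [hk]))

theorem HasRSIntegral.sum_right {ι : Type*} (S : Finset ι) {f : ℝ → ℝ} {g : ι → ℝ → ℝ} {a b : ℝ}
    {I : ι → ℝ} (h : ∀ i ∈ S, HasRSIntegral f (g i) a b (I i)) :
    HasRSIntegral f (fun x => ∑ i ∈ S, g i x) a b (∑ i ∈ S, I i) := by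
  classical
  induction S using Finset.induction_on with
  | empty => simpa using hasRSIntegral_const_right f 0 a b
  | insert i S hi ih =>
    simp only [Finset.sum_insert hi]
    exact (h i (by simp)).add_right (ih fun k hk => h k (by simp [hk]))

/-! ### Young integration against a Hölder path -/

/-- `J` is a primitive of `f dg` on `[a,b]`: its increments are approximated by `f(ξ) (g v - g u)`
up to `C (v-u)^η (w v - w u)^(1/2)`. -/
def IsYoungPrimitive (η : ℝ) (w : ℝ → ℝ) (a b C : ℝ) (f g J : ℝ → ℝ) : Prop :=
  ∀ u ξ v, a ≤ u → u ≤ ξ → ξ ≤ v → v ≤ b →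
    |f ξ * (g v - g u) - (J v - J u)| ≤ C * (v - u) ^ η * √(w v - w u)

/-- Write `x^η √y = x^(η-1/2) √x √y ≤ δ^(η-1/2) (x + y)` and telescope. The excess of η over 1/2 is
what makes errors of this form vanish with the mesh. -/
theorem sum_rpow_mul_sqrt_le {η δ : ℝ} (hη : 1 / 2 < η) {w : ℝ → ℝ} {t : ℕ → ℝ}
    {n : ℕ} (ht : ∀ k < n, t k ≤ t (k + 1)) (hw : ∀ k < n, w (t k) ≤ w (t (k + 1)))
    (hδ : ∀ k < n, t (k + 1) - t k ≤ δ) :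
    ∑ k ∈ Finset.range n, (t (k + 1) - t k) ^ η * √(w (t (k + 1)) - w (t k)) ≤
      δ ^ (η - 1 / 2) * ((t n - t 0) + (w (t n) - w (t 0))) := by
  calc _ ≤ ∑ k ∈ Finset.range n, δ ^ (η - 1 / 2) *
        ((t (k + 1) - t k) + (w (t (k + 1)) - w (t k))) := by
        refine Finset.sum_le_sum fun k hk => ?_
        have hk := Finset.mem_range.1 hk
        have hx := sub_nonneg.2 (ht k hk)
        have hy := sub_nonneg.2 (hw k hk)
        have hd := hδ k hk
        set x := t (k + 1) - t k
        set y := w (t (k + 1)) - w (t k)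
        have e : x ^ η = x ^ (η - 1 / 2) * √x := by
          rw [Real.sqrt_eq_rpow, ← Real.rpow_add_of_nonneg hx (by linarith) (by norm_num)]
          congr 1; ring
        rw [e, mul_assoc]
        have h1 : x ^ (η - 1 / 2) ≤ δ ^ (η - 1 / 2) :=
          Real.rpow_le_rpow hx hd (by linarith)
        have h2 : √x * √y ≤ x + y := by
          nlinarith [Real.sq_sqrt hx, Real.sq_sqrt hy, sq_nonneg (√x - √y), Real.sqrt_nonneg x,
            Real.sqrt_nonneg y]
        have : 0 ≤ δ ^ (η - 1 / 2) := Real.rpow_nonneg (hx.trans hd) _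
        gcongr
    _ = _ := by
        rw [← Finset.mul_sum, Finset.sum_add_distrib, Finset.sum_range_sub,
          Finset.sum_range_sub (fun k => w (t k))]

theorem exists_pos_rpow_mul_lt {p : ℝ} (hp : 0 < p) (K : ℝ) {ε : ℝ} (hε : 0 < ε) :
    ∃ δ > 0, δ ^ p * K < ε := by
  have h : Filter.Tendsto (fun x : ℝ => x ^ p * K) (nhdsWithin 0 (Ioi 0)) (nhds 0) := by
    have : Filter.Tendsto (fun x : ℝ => x ^ p * K) (nhds 0) (nhds ((0 : ℝ) ^ p * K)) :=
      ((Real.continuousAt_rpow_const 0 p (Or.inr hp.le)).mul continuousAt_const)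
    rw [Real.zero_rpow hp.ne', zero_mul] at this
    exact this.mono_left nhdsWithin_le_nhds
  obtain ⟨δ, h1, h2⟩ := ((h.eventually (gt_mem_nhds hε)).and self_mem_nhdsWithin).exists
  exact ⟨δ, h2, h1⟩

theorem IsYoungPrimitive.hasRSIntegral {η : ℝ} (hη : 1 / 2 < η) {w : ℝ → ℝ} {a b C : ℝ}
    (hw : ∀ u v, a ≤ u → u ≤ v → v ≤ b → w u ≤ w v) {f g J : ℝ → ℝ}
    (h : IsYoungPrimitive η w a b C f g J) {u v : ℝ} (hu : a ≤ u) (hv : v ≤ b) :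
    HasRSIntegral f g u v (J v - J u) := by
  intro ε hε
  obtain ⟨δ, hδ, hlt⟩ := exists_pos_rpow_mul_lt (sub_pos.2 hη)
    (|C| * ((v - u) + (w v - w u))) hε
  refine ⟨δ, hδ, fun n t ξ h0 hn hk => ?_⟩
  have hm : ∀ k < n, t k ≤ t (k + 1) := fun k hkn => (hk k hkn).1.trans (hk k hkn).2.1
  have hl : ∀ k ≤ n, a ≤ t k := fun k hkn =>
    hu.trans (h0 ▸ partition_le hm (Nat.zero_le _) hkn)
  have hr : ∀ k ≤ n, t k ≤ b := fun k hkn => (hn ▸ partition_le hm hkn le_rfl : t k ≤ v).trans hv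
  rw [← hn, ← h0, ← Finset.sum_range_sub (fun k => J (t k)), ← Finset.sum_sub_distrib]
  refine lt_of_le_of_lt ?_ hlt
  refine (Finset.abs_sum_le_sum_abs _ _).trans ?_
  have := sum_rpow_mul_sqrt_le hη hm
    (fun k hkn => hw _ _ (hl k hkn.le) (hm k hkn) (hr _ hkn)) (fun k hkn => (hk k hkn).2.2.le)
  rw [hn, h0] at this
  calc _ ≤ ∑ k ∈ Finset.range n,
        |C| * ((t (k + 1) - t k) ^ η * √(w (t (k + 1)) - w (t k))) := by
        refine Finset.sum_le_sum fun k hkn => ?_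
        have hkn := Finset.mem_range.1 hkn
        refine (h _ _ _ (hl k hkn.le) (hk k hkn).1 (hk k hkn).2.1 (hr _ hkn)).trans ?_
        rw [mul_assoc]
        have : 0 ≤ (t (k + 1) - t k) ^ η := Real.rpow_nonneg (sub_nonneg.2 (hm k hkn)) _
        gcongr
        exact le_abs_self C
    _ ≤ _ := by
        rw [← Finset.mul_sum, mul_left_comm]
        gcongr

theorem sqrt_add_sqrt_le {x y z : ℝ} (hx : 0 ≤ x) (hy : 0 ≤ y) (h : x + y ≤ z) :
    √x + √y ≤ √2 * √z := by
  rw [← Real.sqrt_mul (by norm_num)]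
  refine Real.le_sqrt_of_sq_le ?_
  nlinarith [Real.sq_sqrt hx, Real.sq_sqrt hy, sq_nonneg (√x - √y)]

/-- The constant in the Young estimate. -/
def youngConst (η : ℝ) : ℝ := 2 / (1 - (2 : ℝ) ^ (1 / 2 - η))

theorem two_rpow_lt_one {η : ℝ} (hη : 1 / 2 < η) : (2 : ℝ) ^ (1 / 2 - η) < 1 :=
  Real.rpow_lt_one_of_one_lt_of_neg (by norm_num) (by linarith)

theorem youngConst_pos {η : ℝ} (hη : 1 / 2 < η) : 0 < youngConst η :=
  div_pos two_pos (sub_pos.2 (two_rpow_lt_one hη))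

theorem abs_sub_sum_le_of_almost_additive {η : ℝ} (hη : 1 / 2 < η) {Ξ : ℝ → ℝ → ℝ} {w : ℝ → ℝ}
    {a b Q : ℝ} (hQ : 0 ≤ Q) (hw : ∀ u v, a ≤ u → u ≤ v → v ≤ b → w u ≤ w v)
    (h0 : ∀ u, Ξ u u = 0)
    (hΞ : ∀ u m v, a ≤ u → u ≤ m → m ≤ v → v ≤ b →
      |Ξ u v - Ξ u m - Ξ m v| ≤ Q * (v - u) ^ η * √(w v - w u))
    {t : ℕ → ℝ} (ht : Monotone t) (hta : ∀ k, a ≤ t k) (htb : ∀ k, t k ≤ b) (n : ℕ) :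
    ∀ i j, i ≤ j → j - i = n → |Ξ (t i) (t j) - ∑ k ∈ Finset.Ico i j, Ξ (t k) (t (k + 1))| ≤
      youngConst η * Q * (t j - t i) ^ η * √(w (t j) - w (t i)) := by
  have hC := youngConst_pos hη
  induction n using Nat.strong_induction_on with
  | _ n ih =>
  intro i j hij hn
  rcases hij.eq_or_lt with rfl | hlt
  · have : (0 : ℝ) ^ η = 0 := Real.zero_rpow (by linarith)
    simp [h0, this]
  -- Bisection: let `k+1` be the first index after `i` whose point is at or beyond the midpoint.
  -- Then `[t i, t k]` and `[t (k+1), t j]` both have at most half the length, and removing the cell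
  -- in between costs two additivity defects.
  have hex : ∃ k, i < k ∧ (t i + t j) / 2 ≤ t k := ⟨j, hlt, by linarith [ht hij]⟩
  classical
  obtain ⟨hk1, hk2⟩ := Nat.find_spec hex
  have hkj : Nat.find hex ≤ j := Nat.find_min' hex ⟨hlt, by linarith [ht hij]⟩
  have hmin : ∀ m < Nat.find hex, i < m → t m < (t i + t j) / 2 := fun m hm him => by
    have := Nat.find_min hex hm
    push Not at this
    exact this him
  obtain ⟨k, hk⟩ : ∃ k, Nat.find hex = k + 1 := ⟨Nat.find hex - 1, by omega⟩
  rw [hk] at hk1 hk2 hkj hmin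
  have hik : i ≤ k := by omega
  have hk3 : t k ≤ (t i + t j) / 2 := by
    rcases hik.eq_or_lt with rfl | h
    · linarith [ht hij]
    · exact (hmin k (by omega) h).le
  have e1 := ih (k - i) (by omega) i k hik rfl
  have e2 := ih (j - (k + 1)) (by omega) (k + 1) j hkj rfl
  have e3 := hΞ (t i) (t k) (t j) (hta _) (ht hik) (ht (by omega)) (htb _)
  have e4 := hΞ (t k) (t (k + 1)) (t j) (hta _) (ht (by omega)) (ht hkj) (htb _)
  rw [← Finset.sum_Ico_consecutive _ (hik.trans k.le_succ) hkj, Finset.sum_Ico_succ_top hik]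
  set x := t j - t i
  have hx : 0 ≤ x := sub_nonneg.2 (ht hij)
  have w1 := hw _ _ (hta i) (ht hik) (htb k)
  have w2 := hw _ _ (hta k) (ht k.le_succ) (htb (k + 1))
  have w3 := hw _ _ (hta (k + 1)) (ht hkj) (htb j)
  have hs := sqrt_add_sqrt_le (x := w (t k) - w (t i)) (y := w (t j) - w (t (k + 1)))
    (z := w (t j) - w (t i)) (by linarith) (by linarith) (by linarith)
  set y := w (t j) - w (t i)
  have hη0 : 0 ≤ η := by linarith
  have p1 : (t k - t i) ^ η ≤ (x / 2) ^ η :=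
    Real.rpow_le_rpow (sub_nonneg.2 (ht hik)) (by simp only [x]; linarith) hη0
  have p2 : (t j - t (k + 1)) ^ η ≤ (x / 2) ^ η :=
    Real.rpow_le_rpow (sub_nonneg.2 (ht hkj)) (by simp only [x]; linarith) hη0
  have p4 : (t j - t k) ^ η ≤ x ^ η :=
    Real.rpow_le_rpow (sub_nonneg.2 (ht (by omega))) (by simp only [x]; linarith [ht hik]) hη0
  have q4 : √(w (t j) - w (t k)) ≤ √y := Real.sqrt_le_sqrt (by simp only [y]; linarith)
  set q : ℝ := (2 : ℝ) ^ (1 / 2 - η) with hq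
  -- Halving the length gains `2^(-η)`, and splitting the control between the two pieces loses at
  -- most `√2`. The net factor is `q < 1`.
  have hqx : (x / 2) ^ η * √2 = x ^ η * q := by
    rw [Real.div_rpow hx (by norm_num), hq, Real.rpow_sub (by norm_num), Real.sqrt_eq_rpow]
    ring
  have hxη : 0 ≤ (x / 2) ^ η := by positivity
  have E1 : youngConst η * Q * (t k - t i) ^ η * √(w (t k) - w (t i)) ≤
      youngConst η * Q * (x / 2) ^ η * √(w (t k) - w (t i)) := by gcongr
  have E2 : youngConst η * Q * (t j - t (k + 1)) ^ η * √(w (t j) - w (t (k + 1))) ≤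
      youngConst η * Q * (x / 2) ^ η * √(w (t j) - w (t (k + 1))) := by gcongr
  have E4 : Q * (t j - t k) ^ η * √(w (t j) - w (t k)) ≤ Q * x ^ η * √y := by gcongr
  have E5 : youngConst η * Q * (x / 2) ^ η * (√(w (t k) - w (t i)) + √(w (t j) - w (t (k + 1))))
      ≤ youngConst η * Q * (x / 2) ^ η * (√2 * √y) := by gcongr
  have hCq : youngConst η * (1 - q) = 2 := by
    rw [youngConst, div_mul_cancel₀]; exact (sub_pos.2 (two_rpow_lt_one hη)).ne'
  -- The induction closes because `youngConst η` solves `C q + 2 = C`.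
  have key : youngConst η * Q * (x / 2) ^ η * (√2 * √y) + 2 * (Q * x ^ η * √y) =
      youngConst η * Q * x ^ η * √y := by
    have : youngConst η * Q * (x / 2) ^ η * (√2 * √y) =
      youngConst η * Q * ((x / 2) ^ η * √2) * √y := by ring
    rw [this, hqx, ← hCq]; ring
  rw [← key]
  rw [abs_le] at *
  constructor <;> nlinarith

/-- Clipping `[u,v]` to `[p,q]` or `[p,q]` to `[u,v]` gives their intersection; if they do not meet,
or meet in one point, both clipped intervals are degenerate and both values are 0. -/
theorem clip_eq_of_zero {Ξ : ℝ → ℝ → ℝ} (h0 : ∀ u, Ξ u u = 0) {u v p q : ℝ} (huv : u ≤ v)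
    (hpq : p ≤ q) :
    Ξ (max p (min u q)) (max p (min v q)) = Ξ (max u (min p v)) (max u (min q v)) := by
  rcases le_total q u with h | h
  · rw [min_eq_right h, min_eq_right (h.trans huv), min_eq_left (hpq.trans (h.trans huv)),
      min_eq_left (h.trans huv), max_eq_left h, max_eq_left (hpq.trans h), h0, h0]
  rcases le_total v p with h' | h'
  · rw [min_eq_left h, min_eq_left (h'.trans hpq), min_eq_right h', min_eq_right (h'.trans hpq),
      max_eq_left h', max_eq_left (huv.trans h'), h0, h0]
  · rw [min_eq_left h, min_eq_left h', max_comm, min_comm q v,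
      max_eq_right (le_min h' hpq), max_eq_right (le_min huv h)]

/-- A sewing lemma. -/
theorem exists_additive_of_almost_additive {η : ℝ} (hη : 1 / 2 < η) {Ξ : ℝ → ℝ → ℝ} {w : ℝ → ℝ}
    {a b Q : ℝ} (hab : a ≤ b) (hQ : 0 ≤ Q) (hw : ∀ u v, a ≤ u → u ≤ v → v ≤ b → w u ≤ w v)
    (h0 : ∀ u, Ξ u u = 0)
    (hΞ : ∀ u m v, a ≤ u → u ≤ m → m ≤ v → v ≤ b →
      |Ξ u v - Ξ u m - Ξ m v| ≤ Q * (v - u) ^ η * √(w v - w u)) :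
    ∃ J : ℝ → ℝ, ∀ u v, a ≤ u → u ≤ v → v ≤ b →
      |Ξ u v - (J v - J u)| ≤ youngConst η * Q * (v - u) ^ η * √(w v - w u) := by
  choose N s hs0 hsN hsm hs using fun n : ℕ =>
    exists_partition hab (Nat.one_div_pos_of_nat (n := n) : (0 : ℝ) < 1 / ((n : ℝ) + 1))
  have hsa : ∀ n l, a ≤ s n l := fun n l => (hs0 n).symm.trans_le (hsm n (Nat.zero_le _))
  have hsb : ∀ n l, l ≤ N n → s n l ≤ b := fun n l hl => (hsm n hl).trans_eq (hsN n)
  -- `d n l` clips to the `l`-th cell of the `n`-th partition, so `I n u v` is the Riemann sum of Ξ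
  -- over the trace of that partition on `[u,v]`.
  set d : ℕ → ℕ → ℝ → ℝ := fun n l x => max (s n l) (min x (s n (l + 1))) with hd
  set I : ℕ → ℝ → ℝ → ℝ := fun n u v => ∑ l ∈ Finset.range (N n), Ξ (d n l u) (d n l v) with hI
  have hbd : ∀ n u v, a ≤ u → u ≤ v → v ≤ b →
      |Ξ u v - I n u v| ≤ youngConst η * Q * (v - u) ^ η * √(w v - w u) := by
    intro n u v hu huv hv
    have hcm : Monotone fun l => max u (min (s n l) v) := fun i j hij =>
      max_le_max le_rfl (min_le_min (hsm n hij) le_rfl)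
    have := abs_sub_sum_le_of_almost_additive hη hQ hw h0 hΞ hcm
      (fun k => hu.trans (le_max_left _ _)) (fun k => max_le (huv.trans hv)
        ((min_le_right _ _).trans hv)) (N n) 0 (N n) (Nat.zero_le _) rfl
    simp only [hs0, hsN, min_eq_left (hu.trans huv), min_eq_right hv, max_eq_left hu,
      max_eq_right huv, ← Finset.range_eq_Ico] at this
    simp only [hI, hd, clip_eq_of_zero h0 huv (hsm n (Nat.le_succ _))]
    exact this
  -- With one partition of `[a,b]` serving all subintervals, additivity of `I n` fails only by
  -- defects inside cells, whose sum tends to 0 with the mesh.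
  have hadd : ∀ n u m v, a ≤ u → u ≤ m → m ≤ v → v ≤ b →
      |I n u v - I n u m - I n m v| ≤
        (1 / ((n : ℝ) + 1)) ^ (η - 1 / 2) * (Q * ((b - a) + (w b - w a))) := by
    intro n u m v hu hum hmv hv
    have := sum_rpow_mul_sqrt_le hη (fun k (_ : k < N n) => hsm n k.le_succ)
      (fun k hk => hw _ _ (hsa n k) (hsm n k.le_succ) (hsb n _ hk)) (fun k _ => (hs n k).le)
    rw [hs0, hsN] at this
    rw [hI]
    simp only [← Finset.sum_sub_distrib]
    refine (Finset.abs_sum_le_sum_abs _ _).trans ?_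
    calc _ ≤ ∑ l ∈ Finset.range (N n),
          Q * ((s n (l + 1) - s n l) ^ η * √(w (s n (l + 1)) - w (s n l))) := by
          refine Finset.sum_le_sum fun l hl => ?_
          have hl := Finset.mem_range.1 hl
          have hss := hsm n l.le_succ
          have d1 : ∀ x, s n l ≤ d n l x := fun x => le_max_left _ _
          have d2 : ∀ x, d n l x ≤ s n (l + 1) := fun x => max_le hss (min_le_right _ _)
          have d3 : ∀ x y, x ≤ y → d n l x ≤ d n l y := fun x y h =>
            max_le_max le_rfl (min_le_min h le_rfl)
          have hb := hsb n _ hl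
          refine (hΞ _ _ _ ((hsa n l).trans (d1 u)) (d3 _ _ hum) (d3 _ _ hmv)
            ((d2 v).trans hb)).trans ?_
          have w1 := hw _ _ (hsa n l) (d1 u) ((d2 u).trans hb)
          have w2 := hw _ _ ((hsa n l).trans (d1 v)) (d2 v) hb
          have d4 := d3 _ _ (hum.trans hmv)
          have := Real.rpow_le_rpow (sub_nonneg.2 d4) (sub_le_sub (d2 v) (d1 u))
            (by linarith : 0 ≤ η)
          rw [mul_assoc]
          have h3 : 0 ≤ (s n (l + 1) - s n l) ^ η := Real.rpow_nonneg (sub_nonneg.2 hss) _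
          gcongr
      _ ≤ _ := by
          rw [← Finset.mul_sum, mul_left_comm]
          gcongr
  -- A limit along an ultrafilter exists by compactness, since `hbd` keeps the sums in a bounded
  -- interval. No Cauchy property is needed: `hbd` and the vanishing defect in `hadd` pass to the
  -- limit.
  have hlim : ∀ u v, ∃ x, a ≤ u → u ≤ v → v ≤ b →
      Filter.Tendsto (fun n => I n u v) (Filter.hyperfilter ℕ) (nhds x) := by
    intro u v
    by_cases h : a ≤ u ∧ u ≤ v ∧ v ≤ b
    · obtain ⟨h1, h2, h3⟩ := h
      have hK := isCompact_Icc (a := Ξ u v - youngConst η * Q * (v - u) ^ η * √(w v - w u))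
        (b := Ξ u v + youngConst η * Q * (v - u) ^ η * √(w v - w u))
      obtain ⟨x, -, hx⟩ := hK.ultrafilter_le_nhds ((Filter.hyperfilter ℕ).map fun n => I n u v) (by
        rw [Ultrafilter.coe_map, Filter.le_principal_iff, Filter.mem_map]
        refine Filter.Eventually.of_forall fun n => ?_
        have := abs_le.1 (hbd n u v h1 h2 h3)
        exact ⟨by linarith, by linarith⟩)
      exact ⟨x, fun _ _ _ => hx⟩
    · exact ⟨0, fun h1 h2 h3 => (h ⟨h1, h2, h3⟩).elim⟩
  choose L hL using hlim
  have hLadd : ∀ u v, a ≤ u → u ≤ v → v ≤ b → L a v - L a u = L u v := by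
    intro u v hu huv hv
    have h1 := ((hL a v le_rfl (hu.trans huv) hv).sub (hL a u le_rfl hu (huv.trans hv))).sub
      (hL u v hu huv hv)
    have h2 : Filter.Tendsto (fun n : ℕ => (1 / ((n : ℝ) + 1)) ^ (η - 1 / 2) *
        (Q * ((b - a) + (w b - w a)))) Filter.atTop (nhds 0) := by
      have := (tendsto_one_div_add_atTop_nhds_zero_nat (𝕜 := ℝ)).rpow_const
        (p := η - 1 / 2) (Or.inr (by linarith))
      rw [Real.zero_rpow (by linarith)] at this
      simpa using this.mul_const (Q * ((b - a) + (w b - w a)))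
    have h3 := squeeze_zero_norm (fun n => by
      rw [Real.norm_eq_abs]; exact hadd n a u v le_rfl hu huv hv)
      (h2.mono_left (Nat.hyperfilter_le_atTop))
    have := tendsto_nhds_unique h1 h3
    linarith
  refine ⟨fun x => L a x, fun u v hu huv hv => ?_⟩
  rw [hLadd u v hu huv hv]
  refine le_of_tendsto ((tendsto_const_nhds.sub (hL u v hu huv hv)).abs)
    (Filter.Eventually.of_forall fun n => hbd n u v hu huv hv)

/-- Young's theorem: existence of the primitive of `f dg`, where `g` is `β`-Hölder and the
increments of `f` are bounded by `A (v-u)^γ (w v - w u)^(1/2)`. -/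
theorem exists_isYoungPrimitive {γ β : ℝ} (hγ : 0 ≤ γ) (hβ : 0 ≤ β) (hη : 1 / 2 < γ + β)
    {w : ℝ → ℝ} {a b A B : ℝ} (hab : a ≤ b) (hA : 0 ≤ A) (hB : 0 ≤ B)
    (hw : ∀ u v, a ≤ u → u ≤ v → v ≤ b → w u ≤ w v) {f g : ℝ → ℝ}
    (hf : ∀ u v, a ≤ u → u ≤ v → v ≤ b → |f v - f u| ≤ A * (v - u) ^ γ * √(w v - w u))
    (hg : ∀ u v, a ≤ u → u ≤ v → v ≤ b → |g v - g u| ≤ B * (v - u) ^ β) :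
    ∃ J, IsYoungPrimitive (γ + β) w a b ((youngConst (γ + β) + 1) * (A * B)) f g J := by
  have key : ∀ u m p v, a ≤ u → u ≤ m → m ≤ v → u ≤ p → p ≤ v → v ≤ b →
      |(f m - f u) * (g v - g p)| ≤ A * B * (v - u) ^ (γ + β) * √(w v - w u) := by
    intro u m p v hu hum hmv hup hpv hv
    rw [abs_mul]
    have h1 := hf u m hu hum (hmv.trans hv)
    have h2 := hg p v (hu.trans hup) hpv hv
    have h3 := Real.rpow_le_rpow (sub_nonneg.2 hum) (sub_le_sub_right hmv u) hγ
    have h4 := Real.rpow_le_rpow (sub_nonneg.2 hpv) (sub_le_sub_left hup v) hβ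
    have h5 : √(w m - w u) ≤ √(w v - w u) :=
      Real.sqrt_le_sqrt (sub_le_sub_right (hw _ _ (hu.trans hum) hmv hv) _)
    have huv : 0 ≤ v - u := by linarith
    calc _ ≤ (A * (m - u) ^ γ * √(w m - w u)) * (B * (v - p) ^ β) :=
          mul_le_mul h1 h2 (abs_nonneg _) ((abs_nonneg _).trans h1)
      _ ≤ (A * (v - u) ^ γ * √(w v - w u)) * (B * (v - u) ^ β) := by
          have := Real.rpow_nonneg huv γ
          have := Real.rpow_nonneg (sub_nonneg.2 hpv) β
          gcongr
      _ = _ := by rw [Real.rpow_add_of_nonneg huv hγ hβ]; ring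
  obtain ⟨J, hJ⟩ := exists_additive_of_almost_additive hη (Ξ := fun u v => f u * (g v - g u))
    (w := w) hab (mul_nonneg hA hB) hw (fun u => by simp) (by
      intro u m v hu hum hmv hv
      have : f u * (g v - g u) - f u * (g m - g u) - f m * (g v - g m) =
        -((f m - f u) * (g v - g m)) := by ring
      rw [this, abs_neg]
      exact key u m m v hu hum hmv hum hmv hv)
  -- Sewing uses the left endpoint as tag; moving the tag to ξ costs one more `A B`, whence the `+
  -- 1` in the constant.
  refine ⟨J, fun u ξ v hu huξ hξv hv => ?_⟩
  have h1 := hJ u v hu (huξ.trans hξv) hv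
  have h2 := key u ξ u v hu huξ hξv le_rfl (huξ.trans hξv) hv
  have : f ξ * (g v - g u) - (J v - J u) =
    (f u * (g v - g u) - (J v - J u)) + (f ξ - f u) * (g v - g u) := by ring
  rw [this]
  refine (abs_add_le _ _).trans ((add_le_add h1 h2).trans_eq ?_)
  ring

/-- Associativity: `f d(∫ k dg) = f k dg`. -/
theorem IsYoungPrimitive.assoc {γ β : ℝ} (hγ : 0 ≤ γ) (hβ : 0 ≤ β)
    {w : ℝ → ℝ} {a b A B C C' F K : ℝ} (hA : 0 ≤ A) (hB : 0 ≤ B)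
    (hw : ∀ u v, a ≤ u → u ≤ v → v ≤ b → w u ≤ w v) {f k g G J : ℝ → ℝ}
    (hf : ∀ u v, a ≤ u → u ≤ v → v ≤ b → |f v - f u| ≤ A * (v - u) ^ γ * √(w v - w u))
    (hg : ∀ u v, a ≤ u → u ≤ v → v ≤ b → |g v - g u| ≤ B * (v - u) ^ β)
    (hF : ∀ u, a ≤ u → u ≤ b → |f u| ≤ F) (hK : ∀ u, a ≤ u → u ≤ b → |k u| ≤ K)
    (hG : IsYoungPrimitive (γ + β) w a b C k g G)
    (hJ : IsYoungPrimitive (γ + β) w a b C' (fun x => f x * k x) g J) :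
    IsYoungPrimitive (γ + β) w a b (A * B * K + F * C + C') f G J := by
  intro u ξ v hu huξ hξv hv
  have huv := huξ.trans hξv
  have hd : 0 ≤ v - u := sub_nonneg.2 huv
  have h1 := hG u u v hu le_rfl huv hv
  have h2 := hJ u u v hu le_rfl huv hv
  have h3 := hf u ξ hu huξ (hξv.trans hv)
  have h4 := hg u v hu huv hv
  have h5 := hF ξ (hu.trans huξ) (hξv.trans hv)
  have h6 := hK u hu (huv.trans hv)
  have h7 := Real.rpow_le_rpow (sub_nonneg.2 huξ) (sub_le_sub_right hξv u) hγ
  have h8 : √(w ξ - w u) ≤ √(w v - w u) :=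
    Real.sqrt_le_sqrt (sub_le_sub_right (hw _ _ (hu.trans huξ) hξv hv) _)
  have hK0 := (abs_nonneg _).trans h6
  have hF0 := (abs_nonneg _).trans h5
  -- Three errors: replacing `f ξ` by `f u` against `k u dg`, replacing `dG` by `k u dg`, and
  -- replacing `dJ` by `f u k u dg`.
  have e : f ξ * (G v - G u) - (J v - J u) = (f ξ - f u) * (g v - g u) * k u
      + f ξ * -(k u * (g v - g u) - (G v - G u)) + (f u * k u * (g v - g u) - (J v - J u)) := by
    ring
  rw [e]
  refine (abs_add_le _ _).trans ?_
  have g1 : |(f ξ - f u) * (g v - g u) * k u| ≤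
      A * B * K * (v - u) ^ (γ + β) * √(w v - w u) := by
    rw [abs_mul, abs_mul]
    calc _ ≤ (A * (ξ - u) ^ γ * √(w ξ - w u)) * (B * (v - u) ^ β) * K := by
          have := (abs_nonneg _).trans h3
          gcongr
      _ ≤ (A * (v - u) ^ γ * √(w v - w u)) * (B * (v - u) ^ β) * K := by
          have := Real.rpow_nonneg hd γ
          gcongr
      _ = _ := by rw [Real.rpow_add_of_nonneg hd hγ hβ]; ring
  have g2 : |f ξ * -(k u * (g v - g u) - (G v - G u))| ≤
      F * (C * (v - u) ^ (γ + β) * √(w v - w u)) := by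
    rw [abs_mul, abs_neg]
    gcongr
  refine (add_le_add ((abs_add_le _ _).trans (add_le_add g1 g2)) h2).trans_eq ?_
  ring

/-! ### The Volterra kernel and Cameron-Martin paths -/

/-- For `z ≥ 1` the right side is at least 1. For `z ≤ 1` the worst exponent is `p = -1`, where the
left side is at most `z ≤ z^l`. -/
theorem one_sub_rpow_le_rpow {p z l : ℝ} (hp : -1 ≤ p) (hz : 0 ≤ z) (hl : 0 ≤ l)
    (hl' : l ≤ 1) : 1 - (1 + z) ^ p ≤ z ^ l := by
  have h1 : 0 < (1 + z) ^ p := by positivity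
  rcases le_total 1 z with h | h
  · linarith [Real.one_le_rpow h hl]
  · have h2 : (1 + z) ^ (-1 : ℝ) ≤ (1 + z) ^ p := Real.rpow_le_rpow_of_exponent_le (by linarith) hp
    have h3 : 1 - z ≤ (1 + z) ^ (-1 : ℝ) := by
      rw [Real.rpow_neg_one, ← one_div, le_div_iff₀ (by linarith)]; nlinarith
    have h4 : z ≤ z ^ l := Real.self_le_rpow_of_le_one hz h hl'
    linarith

/-- Both sides are compared with `log q` by means of `1 + x ≤ exp x`. -/
theorem one_sub_rpow_le_rpow_sub_one {p κ q : ℝ} (hp : -1 ≤ p) (hq : 1 ≤ q) (hκ : 0 < κ) :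
    1 - q ^ p ≤ 1 / κ * (q ^ κ - 1) := by
  have hq0 : 0 < q := by linarith
  have hl := Real.log_nonneg hq
  have h1 := Real.add_one_le_exp (Real.log q * p)
  have h2 := Real.add_one_le_exp (Real.log q * κ)
  rw [← Real.rpow_def_of_pos hq0] at h1 h2
  have h3 : Real.log q ≤ 1 / κ * (q ^ κ - 1) := by
    rw [div_mul_eq_mul_div, one_mul, le_div_iff₀ hκ]; linarith
  nlinarith

/-- After factoring out `y^p`, the two factors of the square are bounded differently: one yields the
power of `d` that becomes the Hölder factor, the other yields `(y+d)^κ - y^κ`, an increment in time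
that can be put into the control. -/
theorem rpow_sub_rpow_sq_le {p κ l y d : ℝ} (hp : -1 ≤ p) (hp' : p ≤ 0) (hκ : 0 < κ)
    (hl : 0 ≤ l) (hl' : l ≤ 1) (hy : 0 < y) (hd : 0 ≤ d) :
    (y ^ p - (y + d) ^ p) ^ 2 ≤
      1 / κ * d ^ l * y ^ (2 * p - κ - l) * ((y + d) ^ κ - y ^ κ) := by
  have hz : 0 ≤ d / y := div_nonneg hd hy.le
  have e : y + d = y * (1 + d / y) := by field_simp
  have h1 := one_sub_rpow_le_rpow hp hz hl hl'
  have h2 := one_sub_rpow_le_rpow_sub_one hp (by linarith : 1 ≤ 1 + d / y) hκ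
  have h0 : 0 ≤ 1 - (1 + d / y) ^ p := sub_nonneg.2
    (Real.rpow_le_one_of_one_le_of_nonpos (by linarith) hp')
  rw [e, Real.mul_rpow hy.le (by linarith), Real.mul_rpow hy.le (by linarith)]
  have e2 : y ^ (2 * p - κ - l) = y ^ p * y ^ p / y ^ κ / y ^ l := by
    rw [Real.rpow_sub hy, Real.rpow_sub hy, two_mul, Real.rpow_add hy]
  rw [Real.div_rpow hd hy.le] at h1
  have hk := Real.rpow_pos_of_pos hy κ
  have hyl := Real.rpow_pos_of_pos hy l
  calc (y ^ p - y ^ p * (1 + d / y) ^ p) ^ 2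
      = (y ^ p) ^ 2 * ((1 - (1 + d / y) ^ p) * (1 - (1 + d / y) ^ p)) := by ring
    _ ≤ (y ^ p) ^ 2 * (d ^ l / y ^ l * (1 / κ * ((1 + d / y) ^ κ - 1))) := by
        gcongr
    _ = _ := by rw [e2]; field_simp

/-- Cauchy-Schwarz for `√χ` and `√(φ g²)`. The pointwise hypotheses are restricted to the open
interval, where the kernel is given by its power law. -/
theorem abs_integral_mul_le_sqrt {a b : ℝ} (hab : a ≤ b) {D g χ φ : ℝ → ℝ}
    (hχ : IntervalIntegrable χ volume a b)
    (hφ : IntervalIntegrable (fun r => φ r * g r ^ 2) volume a b)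
    (hχ0 : ∀ r ∈ Ioo a b, 0 ≤ χ r) (hφ0 : ∀ r ∈ Ioo a b, 0 ≤ φ r)
    (hD : ∀ r ∈ Ioo a b, D r ^ 2 ≤ χ r * φ r) :
    |∫ r in a..b, D r * g r| ≤ √(∫ r in a..b, χ r) * √(∫ r in a..b, φ r * g r ^ 2) := by
  rw [intervalIntegral.integral_of_le hab, intervalIntegral.integral_of_le hab,
    intervalIntegral.integral_of_le hab, integral_Ioc_eq_integral_Ioo,
    integral_Ioc_eq_integral_Ioo, integral_Ioc_eq_integral_Ioo]
  rw [intervalIntegrable_iff_integrableOn_Ioo_of_le hab] at hχ hφ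
  have key : ∀ {F : ℝ → ℝ}, IntegrableOn F (Ioo a b) → (∀ r ∈ Ioo a b, 0 ≤ F r) →
      MemLp (fun r => √(F r)) (ENNReal.ofReal 2) (volume.restrict (Ioo a b)) ∧
      ∫ r in Ioo a b, √(F r) ^ (2 : ℝ) = ∫ r in Ioo a b, F r := by
    intro F hF hF0
    have hae : ∀ᵐ r ∂(volume.restrict (Ioo a b)), √(F r) ^ 2 = F r :=
      (ae_restrict_iff' measurableSet_Ioo).2 (Filter.Eventually.of_forall fun r hr =>
        Real.sq_sqrt (hF0 r hr))
    refine ⟨?_, integral_congr_ae (hae.mono fun r hr => by simpa using hr)⟩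
    rw [ENNReal.ofReal_ofNat, memLp_two_iff_integrable_sq
      (Real.continuous_sqrt.comp_aestronglyMeasurable hF.aestronglyMeasurable)]
    exact (integrable_congr hae).2 hF
  have hφg0 : ∀ r ∈ Ioo a b, 0 ≤ φ r * g r ^ 2 := fun r hr => mul_nonneg (hφ0 r hr) (sq_nonneg _)
  obtain ⟨m1, i1⟩ := key hχ hχ0
  obtain ⟨m2, i2⟩ := key hφ hφg0
  have hCS := integral_mul_le_Lp_mul_Lq_of_nonneg Real.HolderConjugate.two_two
    (Filter.Eventually.of_forall fun r => Real.sqrt_nonneg (χ r))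
    (Filter.Eventually.of_forall fun r => Real.sqrt_nonneg (φ r * g r ^ 2)) m1 m2
  rw [i1, i2, ← Real.sqrt_eq_rpow, ← Real.sqrt_eq_rpow] at hCS
  refine le_trans ?_ hCS
  rw [← Real.norm_eq_abs]
  rw [ENNReal.ofReal_ofNat] at m1 m2
  refine norm_integral_le_of_norm_le (m1.integrable_mul m2)
    ((ae_restrict_iff' measurableSet_Ioo).2 (Filter.Eventually.of_forall fun r hr => ?_))
  rw [Real.norm_eq_abs]
  rw [← Real.sqrt_mul (hχ0 r hr)]
  refine Real.abs_le_sqrt ?_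
  rw [mul_pow, ← mul_assoc]
  exact mul_le_mul_of_nonneg_right (hD r hr) (sq_nonneg _)

namespace CMSpace

theorem integrable_sq (h : CMSpace) (i : Fin 2) :
    IntegrableOn (fun r => h i r ^ 2) (Icc (0 : ℝ) 1) :=
  (Lp.memLp (h i)).integrable_sq

theorem integrableOn (h : CMSpace) (i : Fin 2) : IntegrableOn (fun r => h i r) (Icc (0 : ℝ) 1) :=
  (Lp.memLp (h i)).integrable (by norm_num)

theorem intervalIntegrable_sq (h : CMSpace) (i : Fin 2) {a b : ℝ} (ha : 0 ≤ a) (hab : a ≤ b)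
    (hb : b ≤ 1) : IntervalIntegrable (fun r => h i r ^ 2) volume a b :=
  (intervalIntegrable_iff_integrableOn_Icc_of_le hab).2
    ((h.integrable_sq i).mono_set (Icc_subset_Icc ha hb))

theorem intervalIntegrable (h : CMSpace) (i : Fin 2) {a b : ℝ} (ha : 0 ≤ a) (hab : a ≤ b)
    (hb : b ≤ 1) : IntervalIntegrable (fun r => h i r) volume a b :=
  (intervalIntegrable_iff_integrableOn_Icc_of_le hab).2
    ((h.integrableOn i).mono_set (Icc_subset_Icc ha hb))

theorem integral_sq_le (h : CMSpace) (i : Fin 2) {a b : ℝ} (ha : 0 ≤ a) (hab : a ≤ b)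
    (hb : b ≤ 1) : ∫ r in a..b, h i r ^ 2 ≤ ‖h‖ ^ 2 := by
  calc ∫ r in a..b, h i r ^ 2 = ∫ r in Icc a b, h i r ^ 2 := by
        rw [intervalIntegral.integral_of_le hab, integral_Icc_eq_integral_Ioc]
    _ ≤ ∫ r in Icc (0 : ℝ) 1, h i r ^ 2 :=
        setIntegral_mono_set (h.integrable_sq i)
          (Filter.Eventually.of_forall fun _ => sq_nonneg _) (Icc_subset_Icc ha hb).eventuallyLE
    _ = ‖h i‖ ^ 2 := by
        rw [← real_inner_self_eq_norm_sq, L2.inner_def]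
        exact integral_congr_ae (Filter.Eventually.of_forall fun r => by simp [sq])
    _ ≤ ‖h‖ ^ 2 := by
        gcongr
        exact PiLp.norm_apply_le h i

/-- The drift estimate. -/
theorem abs_integral_mul_le (h : CMSpace) (i : Fin 2) {F : ℝ → ℝ} {K a b : ℝ} (ha : 0 ≤ a)
    (hab : a ≤ b) (hb : b ≤ 1) (hF : ∀ r ∈ Ioo a b, |F r| ≤ K) (hK : 0 ≤ K) :
    |∫ r in a..b, F r * h i r| ≤ K * (b - a) ^ (1 / 2 : ℝ) * ‖h‖ := by
  have h1 := abs_integral_mul_le_sqrt hab (D := F) (g := fun r => h i r) (χ := fun _ => K ^ 2)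
    (φ := fun _ => 1) intervalIntegrable_const
    (by simpa using h.intervalIntegrable_sq i ha hab hb) (fun _ _ => sq_nonneg _)
    (fun _ _ => zero_le_one) (fun r hr => by
      rw [mul_one, ← sq_abs]; exact pow_le_pow_left₀ (abs_nonneg _) (hF r hr) 2)
  refine h1.trans ?_
  rw [intervalIntegral.integral_const, smul_eq_mul, Real.sqrt_mul (sub_nonneg.2 hab),
    Real.sqrt_sq hK, ← Real.sqrt_eq_rpow, mul_comm K]
  have h2 : √(∫ r in a..b, 1 * h i r ^ 2) ≤ ‖h‖ := by
    refine Real.sqrt_le_iff.2 ⟨norm_nonneg _, ?_⟩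
    simpa using h.integral_sq_le i ha hab hb
  gcongr

/-- A nondecreasing function that controls the increments of `ĥ`. -/
def control (κ : ℝ) (h : CMSpace) (t : ℝ) : ℝ :=
  2 / κ ^ 2 * ∫ r in (0 : ℝ)..t, ((t - r) ^ κ + 1) * h 0 r ^ 2

theorem continuous_weight {κ : ℝ} (hκ : 0 < κ) (t : ℝ) :
    Continuous fun r : ℝ => (t - r) ^ κ + 1 :=
  ((continuous_const.sub continuous_id).rpow_const fun _ => Or.inr hκ.le).add continuous_const

theorem intervalIntegrable_weight (h : CMSpace) {κ : ℝ} (hκ : 0 < κ) (t : ℝ) {a b : ℝ}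
    (ha : 0 ≤ a) (hab : a ≤ b) (hb : b ≤ 1) :
    IntervalIntegrable (fun r => ((t - r) ^ κ + 1) * h 0 r ^ 2) volume a b :=
  (h.intervalIntegrable_sq 0 ha hab hb).continuousOn_mul (continuous_weight hκ t).continuousOn

/-- The weight `(t-r)^κ + 1` grows with `t`, and this growth charges the past `[0,u]`; the summand 1
charges the new piece `[u,v]`. These are the two parts needed for the increment of `ĥ`. -/
theorem control_sub (h : CMSpace) {κ : ℝ} (hκ : 0 < κ) {u v : ℝ} (hu : 0 ≤ u) (huv : u ≤ v)
    (hv : v ≤ 1) :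
    2 / κ ^ 2 * ((∫ r in (0 : ℝ)..u, ((v - r) ^ κ - (u - r) ^ κ) * h 0 r ^ 2) +
      ∫ r in u..v, 1 * h 0 r ^ 2) ≤ control κ h v - control κ h u := by
  have hu1 := huv.trans hv
  rw [control, control, ← mul_sub]
  gcongr
  rw [← intervalIntegral.integral_add_adjacent_intervals
    (h.intervalIntegrable_weight hκ v le_rfl hu hu1) (h.intervalIntegrable_weight hκ v hu huv hv),
    add_sub_right_comm, ← intervalIntegral.integral_sub
    (h.intervalIntegrable_weight hκ v le_rfl hu hu1)
    (h.intervalIntegrable_weight hκ u le_rfl hu hu1)]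
  refine add_le_add (le_of_eq ?_) ?_
  · congr 1; ext r; ring
  · refine intervalIntegral.integral_mono_on huv
      (by simpa using h.intervalIntegrable_sq 0 hu huv hv)
      (h.intervalIntegrable_weight hκ v hu huv hv) fun r hr => ?_
    have := Real.rpow_nonneg (sub_nonneg.2 hr.2) κ
    gcongr
    linarith

theorem integral_weight_nonneg (h : CMSpace) {κ : ℝ} (hκ : 0 < κ) {u v : ℝ} (hu : 0 ≤ u)
    (huv : u ≤ v) : 0 ≤ ∫ r in (0 : ℝ)..u, ((v - r) ^ κ - (u - r) ^ κ) * h 0 r ^ 2 :=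
  intervalIntegral.integral_nonneg hu fun r hr => mul_nonneg
    (sub_nonneg.2 (Real.rpow_le_rpow (by linarith [hr.2]) (by linarith) hκ.le)) (sq_nonneg _)

theorem control_mono (h : CMSpace) {κ : ℝ} (hκ : 0 < κ) (u v : ℝ) (hu : 0 ≤ u) (huv : u ≤ v)
    (hv : v ≤ 1) : control κ h u ≤ control κ h v := by
  have h1 := h.control_sub hκ hu huv hv
  have h2 := h.integral_weight_nonneg hκ hu huv
  have h3 : 0 ≤ ∫ r in u..v, 1 * h 0 r ^ 2 := intervalIntegral.integral_nonneg huv fun r _ => by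
    positivity
  have : 0 ≤ 2 / κ ^ 2 * ((∫ r in (0 : ℝ)..u, ((v - r) ^ κ - (u - r) ^ κ) * h 0 r ^ 2) +
      ∫ r in u..v, 1 * h 0 r ^ 2) := by positivity
  linarith

theorem sqrt_control_sub_le (h : CMSpace) {κ : ℝ} (hκ : 0 < κ) {u v : ℝ} (hu : 0 ≤ u)
    (huv : u ≤ v) (hv : v ≤ 1) : √(control κ h v - control κ h u) ≤ 2 / κ * ‖h‖ := by
  refine Real.sqrt_le_iff.2 ⟨by positivity, ?_⟩
  have h0 : control κ h 0 = 0 := by simp [control]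
  have h1 := h.control_mono hκ 0 u le_rfl hu (huv.trans hv)
  have h2 := h.control_mono hκ v 1 (hu.trans huv) hv le_rfl
  have h3 : control κ h 1 ≤ 2 / κ ^ 2 * (2 * ‖h‖ ^ 2) := by
    rw [control]
    gcongr
    calc _ ≤ ∫ r in (0 : ℝ)..1, 2 * h 0 r ^ 2 := by
          refine intervalIntegral.integral_mono_on zero_le_one
            (h.intervalIntegrable_weight hκ 1 le_rfl zero_le_one le_rfl)
            ((h.intervalIntegrable_sq 0 le_rfl zero_le_one le_rfl).const_mul 2) fun r hr => ?_
          have := Real.rpow_le_one (sub_nonneg.2 hr.2) (by linarith [hr.1]) hκ.le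
          gcongr
          linarith
      _ ≤ _ := by
          rw [intervalIntegral.integral_const_mul]
          gcongr
          exact h.integral_sq_le 0 le_rfl zero_le_one le_rfl
  have : (2 / κ * ‖h‖) ^ 2 = 2 / κ ^ 2 * (2 * ‖h‖ ^ 2) := by field_simp
  linarith

end CMSpace

/-! ### The Volterra kernel and the increments of `ĥ` -/

theorem kernel_of_lt {H s t : ℝ} (hs : 0 < s) (hst : s < t) :
    kernel H s t = √(2 * H) * (t - s) ^ (H - 1 / 2) := if_pos ⟨hs, hst⟩

theorem kernel_of_le {H s t : ℝ} (hst : t ≤ s) : kernel H s t = 0 :=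
  if_neg fun h => hst.not_gt h.2

theorem intervalIntegrable_sub_rpow {p : ℝ} (hp : -1 < p) (t a b : ℝ) :
    IntervalIntegrable (fun r => (t - r) ^ p) volume a b := by
  have := (intervalIntegral.intervalIntegrable_rpow' hp (a := t - a) (b := t - b)).comp_sub_left t
  simpa using this

theorem integral_sub_rpow {p : ℝ} (hp : -1 < p) (a t : ℝ) :
    ∫ r in a..t, (t - r) ^ p = (t - a) ^ (p + 1) / (p + 1) := by
  rw [intervalIntegral.integral_comp_sub_left (fun x => x ^ p), integral_rpow (Or.inl hp), sub_self,
    Real.zero_rpow (by linarith), sub_zero]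

theorem kernel_sq {H s t : ℝ} (hH : 0 < H) (hs : 0 < s) (hst : s < t) :
    kernel H s t ^ 2 = 2 * H * (t - s) ^ (2 * H - 1) := by
  rw [kernel_of_lt hs hst, mul_pow, Real.sq_sqrt (by linarith), ← Real.rpow_natCast,
    ← Real.rpow_mul (by linarith)]
  congr 2; push_cast; ring

theorem measurable_kernel (H : ℝ) : Measurable fun x : ℝ × ℝ => kernel H x.1 x.2 := by
  unfold kernel
  refine Measurable.ite ((measurableSet_lt measurable_const measurable_fst).inter
    (measurableSet_lt measurable_fst measurable_snd)) ?_ measurable_const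
  exact measurable_const.mul ((measurable_snd.sub measurable_fst).pow_const _)

theorem intervalIntegrable_kernel_mul {H : ℝ} (hH : 0 < H) (h : CMSpace) (t : ℝ) {v : ℝ}
    (hv : 0 ≤ v) (hv' : v ≤ 1) :
    IntervalIntegrable (fun s => kernel H s t * h 0 s) volume 0 v := by
  rw [intervalIntegrable_iff_integrableOn_Ioo_of_le hv]
  have hsub : Ioo 0 v ⊆ Icc (0 : ℝ) 1 := Ioo_subset_Icc_self.trans (Icc_subset_Icc_right hv')
  have m1 : MemLp (fun s => h 0 s) 2 (volume.restrict (Ioo 0 v)) :=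
    (Lp.memLp (h 0)).mono_measure (Measure.restrict_mono hsub le_rfl)
  have hm : Measurable fun s => kernel H s t := (measurable_kernel H).comp measurable_prodMk_right
  have m2 : MemLp (fun s => kernel H s t) 2 (volume.restrict (Ioo 0 v)) := by
    rw [memLp_two_iff_integrable_sq hm.aestronglyMeasurable]
    have h1 := (intervalIntegrable_sub_rpow (by linarith : -1 < 2 * H - 1) t 0 v).const_mul (2 * H)
    rw [intervalIntegrable_iff_integrableOn_Ioo_of_le hv] at h1
    refine Integrable.mono (f := fun s => kernel H s t ^ 2) h1 (hm.pow_const 2).aestronglyMeasurable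
      ((ae_restrict_iff' measurableSet_Ioo).2 (Filter.Eventually.of_forall fun r hr => ?_))
    rcases lt_or_ge r t with hrt | hrt
    · rw [kernel_sq hH hr.1 hrt]
    · rw [kernel_of_le hrt]; simp; positivity
  exact m2.integrable_mul m1

/-- The Volterra path `ĥ` is controlled by `h.control`. -/
theorem CMSpace.abs_vol_sub_le (h : CMSpace) {H κ : ℝ} (hκ : 0 < κ) (hκH : κ ≤ H)
    (hH' : H ≤ 1 / 2) {u v : ℝ} (hu : 0 ≤ u) (huv : u ≤ v) (hv : v ≤ 1) :
    |h.vol H v - h.vol H u| ≤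
      (v - u) ^ (H - κ) * √(CMSpace.control κ h v - CMSpace.control κ h u) := by
  have hH : 0 < H := by linarith
  have hv0 := hu.trans huv
  have hu1 := huv.trans hv
  have hd : 0 ≤ v - u := sub_nonneg.2 huv
  have i1 := intervalIntegrable_kernel_mul hH h v hu hu1
  have i1' := intervalIntegrable_kernel_mul hH h v hv0 hv
  have i2 := intervalIntegrable_kernel_mul hH h u hu hu1
  have i3 : IntervalIntegrable (fun s => kernel H s v * h 0 s) volume u v :=
    i1'.mono_set (by rw [uIcc_of_le huv, uIcc_of_le hv0]; exact Icc_subset_Icc_left hu)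
  have e : h.vol H v - h.vol H u =
      (∫ s in (0 : ℝ)..u, (kernel H s v - kernel H s u) * h 0 s) +
        ∫ s in u..v, kernel H s v * h 0 s := by
    simp only [sub_mul]
    rw [CMSpace.vol, CMSpace.vol, ← intervalIntegral.integral_add_adjacent_intervals i1 i3,
      intervalIntegral.integral_sub i1 i2]
    ring
  have hw := h.control_sub hκ hu huv hv
  set w1 := ∫ r in (0 : ℝ)..u, ((v - r) ^ κ - (u - r) ^ κ) * h 0 r ^ 2 with hw1
  set w2 := ∫ r in u..v, 1 * h 0 r ^ 2 with hw2
  have hw10 : 0 ≤ w1 := h.integral_weight_nonneg hκ hu huv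
  have hw20 : 0 ≤ w2 := intervalIntegral.integral_nonneg huv fun r _ => by positivity
  -- The past. With `p = H - 1/2` and `l = 2(H-κ)` the remaining power of `u - r` is `κ - 1`, which
  -- is integrable with integral `u^κ/κ ≤ 1/κ`; the prefactor `2H ≤ 1` is dropped.
  have b1 : |∫ s in (0 : ℝ)..u, (kernel H s v - kernel H s u) * h 0 s| ≤
      1 / κ * (v - u) ^ (H - κ) * √w1 := by
    have h1 := abs_integral_mul_le_sqrt hu (D := fun s => kernel H s v - kernel H s u)
      (g := fun s => h 0 s)
      (χ := fun r => 1 / κ * (v - u) ^ (2 * (H - κ)) * (u - r) ^ (κ - 1))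
      (φ := fun r => (v - r) ^ κ - (u - r) ^ κ)
      ((intervalIntegrable_sub_rpow (by linarith) u 0 u).const_mul _)
      (by
        have := (h.intervalIntegrable_weight hκ v le_rfl hu hu1).sub
          (h.intervalIntegrable_weight hκ u le_rfl hu hu1)
        refine this.congr fun r _ => ?_
        simp only
        ring)
      (fun r hr => by
        have : 0 ≤ u - r := by linarith [hr.2]
        positivity)
      (fun r hr => sub_nonneg.2 (Real.rpow_le_rpow (by linarith [hr.2]) (by linarith) hκ.le))
      (fun r hr => by
        have hur : 0 < u - r := by linarith [hr.2]
        rw [kernel_of_lt hr.1 hr.2, kernel_of_lt hr.1 (hr.2.trans_le huv), ← mul_sub, mul_pow,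
          Real.sq_sqrt (by linarith)]
        have h2 := rpow_sub_rpow_sq_le (p := H - 1 / 2) (l := 2 * (H - κ)) (by linarith)
          (by linarith) hκ (by linarith) (by linarith) hur hd
        have e1 : u - r + (v - u) = v - r := by ring
        have e2 : 2 * (H - 1 / 2) - κ - 2 * (H - κ) = κ - 1 := by ring
        rw [e1, e2] at h2
        rw [← neg_sq, neg_sub]
        refine le_trans ?_ h2
        have : 0 ≤ ((u - r) ^ (H - 1 / 2) - (v - r) ^ (H - 1 / 2)) ^ 2 := sq_nonneg _
        nlinarith)
    refine h1.trans ?_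
    gcongr
    refine Real.sqrt_le_iff.2 ⟨by positivity, ?_⟩
    rw [intervalIntegral.integral_const_mul, integral_sub_rpow (by linarith), sub_zero,
      sub_add_cancel, mul_pow, ← Real.rpow_natCast ((v - u) ^ (H - κ)), ← Real.rpow_mul hd]
    have : u ^ κ ≤ 1 := Real.rpow_le_one hu hu1 hκ.le
    have e3 : (H - κ) * ((2 : ℕ) : ℝ) = 2 * (H - κ) := by push_cast; ring
    rw [e3]
    calc 1 / κ * (v - u) ^ (2 * (H - κ)) * (u ^ κ / κ)
        ≤ 1 / κ * (v - u) ^ (2 * (H - κ)) * (1 / κ) := by gcongr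
      _ = _ := by ring
  -- The new piece. Here the squared kernel integrates to `(v-u)^(2H)`, and `1 ≤ (1/κ)²` because `κ
  -- ≤ H ≤ 1/2`.
  have b2 : |∫ s in u..v, kernel H s v * h 0 s| ≤ 1 / κ * (v - u) ^ (H - κ) * √w2 := by
    have h1 := abs_integral_mul_le_sqrt huv (D := fun s => kernel H s v)
      (g := fun s => h 0 s) (χ := fun r => 2 * H * (v - r) ^ (2 * H - 1)) (φ := fun _ => 1)
      ((intervalIntegrable_sub_rpow (by linarith) v u v).const_mul _)
      (by simpa using h.intervalIntegrable_sq 0 hu huv hv)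
      (fun r hr => by
        have : 0 ≤ v - r := by linarith [hr.2]
        positivity)
      (fun _ _ => zero_le_one)
      (fun r hr => by rw [kernel_sq hH (hu.trans_lt hr.1) hr.2, mul_one])
    refine h1.trans ?_
    gcongr
    refine Real.sqrt_le_iff.2 ⟨by positivity, ?_⟩
    rw [intervalIntegral.integral_const_mul, integral_sub_rpow (by linarith), sub_add_cancel,
      mul_pow, ← Real.rpow_natCast ((v - u) ^ (H - κ)), ← Real.rpow_mul hd,
      mul_div_cancel₀ _ (by linarith : 2 * H ≠ 0)]
    have h3 : (v - u) ^ (2 * H) ≤ (v - u) ^ ((H - κ) * ((2 : ℕ) : ℝ)) := by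
      rcases hd.eq_or_lt with h0 | h0
      · rw [← h0, Real.zero_rpow (by linarith)]
        positivity
      · exact Real.rpow_le_rpow_of_exponent_ge h0 (by linarith) (by push_cast; linarith)
    have h4 : 1 ≤ (1 / κ) ^ 2 := one_le_pow₀ (by rw [le_div_iff₀ hκ]; linarith)
    have h5 : 0 ≤ (v - u) ^ ((H - κ) * ((2 : ℕ) : ℝ)) := by positivity
    exact h3.trans (le_mul_of_one_le_left h5 h4)
  rw [e]
  refine (abs_add_le _ _).trans ((add_le_add b1 b2).trans ?_)
  have hs := sqrt_add_sqrt_le hw10 hw20 le_rfl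
  calc _ = (v - u) ^ (H - κ) * (1 / κ * (√w1 + √w2)) := by ring
    _ ≤ (v - u) ^ (H - κ) * √(CMSpace.control κ h v - CMSpace.control κ h u) := by
        gcongr
        refine (mul_le_mul_of_nonneg_left hs (by positivity)).trans ?_
        -- The normalisation `2/κ²` of the control absorbs `1/κ` from both parts and `√2` from
        -- adding the square roots.
        have : 1 / κ * (√2 * √(w1 + w2)) = √(2 / κ ^ 2 * (w1 + w2)) := by
          rw [Real.sqrt_mul (by positivity), Real.sqrt_div (by norm_num), Real.sqrt_sq hκ.le]
          ring
        rw [this]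
        exact Real.sqrt_le_sqrt hw

/-- `M = 0` is excluded since `H ≤ 1/2`, so minimality of `M ≥ 1` says `M H ≤ 1/2`. Subtracting this
from the condition on κ leaves `H > (M+2) κ`. -/
theorem two_mul_lt_of_order {H κ : ℝ} (hH' : H ≤ 1 / 2) (hκ : 0 < κ)
    (hκ' : 0 < ((order H : ℝ) + 1) * (H - κ) - 1 / 2 - κ) : 2 * κ < H := by
  have h0 : order H ≠ 0 := fun h => by rw [h] at hκ'; push_cast at hκ'; linarith
  have h1 : order H - 1 ∉ {M : ℕ | 0 < ((M : ℝ) + 1) * H - 1 / 2} :=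
    Nat.notMem_of_lt_sInf (by change _ < order H; omega)
  have h2 : (1 : ℝ) ≤ order H := by exact_mod_cast Nat.one_le_iff_ne_zero.2 h0
  rw [mem_ofPred_eq, not_lt, Nat.cast_sub (Nat.one_le_iff_ne_zero.2 h0)] at h1
  push_cast at h1
  nlinarith

namespace CMSpace

theorem neg_ae (h : CMSpace) (i : Fin 2) :
    ∀ᵐ r, r ∈ Icc (0 : ℝ) 1 → (-h) i r = -(h i r) := by
  have := Lp.coeFn_neg (h i)
  rw [Filter.EventuallyEq, ae_restrict_iff' measurableSet_Icc] at this
  exact this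

theorem integral_mul_neg (h : CMSpace) (i : Fin 2) (F : ℝ → ℝ) {a b : ℝ} (ha : 0 ≤ a)
    (hab : a ≤ b) (hb : b ≤ 1) :
    ∫ r in a..b, F r * (-h) i r = -∫ r in a..b, F r * h i r := by
  rw [← intervalIntegral.integral_neg]
  refine intervalIntegral.integral_congr_ae ((h.neg_ae i).mono fun r hr hrab => ?_)
  rw [uIoc_of_le hab] at hrab
  rw [hr ⟨ha.trans hrab.1.le, hrab.2.trans hb⟩, mul_neg]

theorem path_neg (h : CMSpace) (i : Fin 2) {t : ℝ} (ht : 0 ≤ t) (ht' : t ≤ 1) :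
    (-h).path i t = -h.path i t := by
  simpa [path] using h.integral_mul_neg i (fun _ => 1) le_rfl ht ht'

theorem vol_neg (h : CMSpace) (H : ℝ) {t : ℝ} (ht : 0 ≤ t) (ht' : t ≤ 1) :
    (-h).vol H t = -h.vol H t :=
  h.integral_mul_neg 0 (fun s => kernel H s t) le_rfl ht ht'

theorem path_zero_right (h : CMSpace) (i : Fin 2) : h.path i 0 = 0 :=
  intervalIntegral.integral_same

theorem path_sub (h : CMSpace) (i : Fin 2) {u v : ℝ} (hu : 0 ≤ u) (huv : u ≤ v) (hv : v ≤ 1) :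
    h.path i v - h.path i u = ∫ r in u..v, h i r := by
  rw [path, path, sub_eq_iff_eq_add', intervalIntegral.integral_add_adjacent_intervals
    (h.intervalIntegrable i le_rfl hu (huv.trans hv)) (h.intervalIntegrable i hu huv hv)]

end CMSpace

/-! ### Integrals of the kernel and the distributional identity for `ĥ` -/

theorem kernel_nonneg (H s t : ℝ) : 0 ≤ kernel H s t := by
  unfold kernel
  split_ifs with h
  · exact mul_nonneg (Real.sqrt_nonneg _) (Real.rpow_nonneg (by linarith [h.2]) _)
  · exact le_rfl

theorem intervalIntegrable_kernel_right {H s t : ℝ} (hH : 0 < H) (hs : 0 < s) (hst : s ≤ t) :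
    IntervalIntegrable (fun r => kernel H s r) volume 0 s ∧
      IntervalIntegrable (fun r => kernel H s r) volume s t := by
  refine ⟨(intervalIntegrable_const (c := (0 : ℝ))).congr fun r hr => ?_, ?_⟩
  · rw [uIoc_of_le hs.le] at hr
    exact (kernel_of_le hr.2).symm
  · have := (intervalIntegral.intervalIntegrable_rpow' (by linarith : -1 < H - 1 / 2)
      (a := 0) (b := t - s)).comp_sub_right s
    rw [zero_add, sub_add_cancel] at this
    refine (this.const_mul (√(2 * H))).congr fun r hr => ?_
    rw [uIoc_of_le hst] at hr
    exact (kernel_of_lt hs hr.1).symm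

/-- For positive times the kernel depends only on the time difference, so this value is also that of
`integral_kernel_left` with `u = s`. Their equality is why convolution with the kernel commutes with
integration in time. -/
theorem integral_kernel_right {H s t : ℝ} (hH : 0 < H) (hs : 0 < s) (hst : s ≤ t) :
    ∫ r in (0 : ℝ)..t, kernel H s r =
      √(2 * H) * ((t - s) ^ (H + 1 / 2) / (H + 1 / 2)) := by
  have h0 : ∀ r ∈ uIcc 0 s, kernel H s r = (fun _ => (0 : ℝ)) r := fun r hr => by
    rw [uIcc_of_le hs.le] at hr
    exact kernel_of_le hr.2
  have h1 : ∀ᵐ r : ℝ, r ∈ uIoc s t → √(2 * H) * (r - s) ^ (H - 1 / 2) = kernel H s r :=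
    Filter.Eventually.of_forall fun r hr => by
      rw [uIoc_of_le hst] at hr
      exact (kernel_of_lt hs hr.1).symm
  obtain ⟨i0, i1⟩ := intervalIntegrable_kernel_right hH hs hst
  rw [← intervalIntegral.integral_add_adjacent_intervals i0 i1,
    intervalIntegral.integral_congr h0, ← intervalIntegral.integral_congr_ae h1,
    intervalIntegral.integral_const_mul,
    intervalIntegral.integral_comp_sub_right (fun x => x ^ (H - 1 / 2)),
    integral_rpow (Or.inl (by linarith))]
  have : H - 1 / 2 + 1 = H + 1 / 2 := by ring
  rw [this, sub_self, Real.zero_rpow (by linarith)]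
  simp

theorem integral_kernel_left {H u t : ℝ} (hH : 0 < H) (hu : 0 ≤ u) (hut : u ≤ t) :
    ∫ s in u..t, kernel H s t = √(2 * H) * ((t - u) ^ (H + 1 / 2) / (H + 1 / 2)) := by
  rw [intervalIntegral.integral_of_le hut, integral_Ioc_eq_integral_Ioo,
    setIntegral_congr_fun measurableSet_Ioo (g := fun s => √(2 * H) * (t - s) ^ (H - 1 / 2))
      fun s hs => kernel_of_lt (hu.trans_lt hs.1) hs.2,
    ← integral_Ioc_eq_integral_Ioo, ← intervalIntegral.integral_of_le hut,
    intervalIntegral.integral_const_mul, integral_sub_rpow (by linarith)]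
  have : H - 1 / 2 + 1 = H + 1 / 2 := by ring
  rw [this]

theorem intervalIntegrable_kernel {H t : ℝ} (hH : 0 < H) (ht : 0 ≤ t) :
    IntervalIntegrable (fun s => kernel H s t) volume 0 t := by
  rw [intervalIntegrable_iff_integrableOn_Ioo_of_le ht]
  have h1 := (intervalIntegrable_sub_rpow (by linarith : -1 < H - 1 / 2) t 0 t).const_mul (√(2 * H))
  rw [intervalIntegrable_iff_integrableOn_Ioo_of_le ht] at h1
  exact h1.congr_fun (fun s hs => (kernel_of_lt hs.1 hs.2).symm) measurableSet_Ioo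

/-- `ĥ` is the distributional derivative of `K^H * h`. -/
theorem CMSpace.integral_vol {H : ℝ} (hH : 0 < H) (h : CMSpace) {t : ℝ} (ht : 0 ≤ t)
    (ht' : t ≤ 1) :
    ∫ r in (0 : ℝ)..t, h.vol H r = ∫ s in (0 : ℝ)..t, kernel H s t * h.path 0 s := by
  have hg : IntegrableOn (fun r => h 0 r) (Ioc 0 t) :=
    (h.integrableOn 0).mono_set (Ioc_subset_Icc_self.trans (Icc_subset_Icc_right ht'))
  have hk : IntegrableOn (fun s => kernel H s t) (Ioc 0 t) :=
    (intervalIntegrable_iff_integrableOn_Ioc_of_le ht).1 (intervalIntegrable_kernel hH ht)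
  have l1 : ∫ r in (0 : ℝ)..t, h.vol H r =
      ∫ r in Ioc 0 t, ∫ s in Ioc 0 t, kernel H s r * h 0 s := by
    rw [intervalIntegral.integral_of_le ht]
    refine setIntegral_congr_fun measurableSet_Ioc fun r hr => ?_
    simp only
    rw [CMSpace.vol, intervalIntegral.integral_of_le hr.1.le]
    refine (setIntegral_eq_of_subset_of_forall_sdiff_eq_zero measurableSet_Ioc
      (Ioc_subset_Ioc_right hr.2) fun s hs => ?_).symm
    rw [kernel_of_le, zero_mul]
    by_contra hlt
    exact hs.2 ⟨hs.1.1, (not_le.1 hlt).le⟩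
  have r1 : ∫ s in (0 : ℝ)..t, kernel H s t * h.path 0 s =
      ∫ s in Ioc 0 t, ∫ u in Ioc 0 t, (if u < s then kernel H s t * h 0 u else 0) := by
    rw [intervalIntegral.integral_of_le ht]
    refine setIntegral_congr_fun measurableSet_Ioc fun s hs => ?_
    simp only
    rw [CMSpace.path, intervalIntegral.integral_of_le hs.1.le, ← integral_const_mul,
      integral_Ioc_eq_integral_Ioo,
      setIntegral_eq_of_subset_of_forall_sdiff_eq_zero (s := Ioo 0 s) (t := Ioc 0 t)
        (f := fun u => if u < s then kernel H s t * h 0 u else 0) measurableSet_Ioc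
      (fun u hu => ⟨hu.1, hu.2.le.trans hs.2⟩)]
    · exact setIntegral_congr_fun measurableSet_Ioo fun u hu => (if_pos hu.2).symm
    · exact fun u hu => if_neg fun hlt => hu.2 ⟨hu.1.1, hlt⟩
  have m1 : Integrable (fun x : ℝ × ℝ => kernel H x.2 x.1 * h 0 x.2)
      ((volume.restrict (Ioc 0 t)).prod (volume.restrict (Ioc 0 t))) := by
    have hmeas : AEStronglyMeasurable (fun x : ℝ × ℝ => kernel H x.2 x.1 * h 0 x.2)
        ((volume.restrict (Ioc 0 t)).prod (volume.restrict (Ioc 0 t))) :=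
      ((measurable_kernel H).comp measurable_swap).aestronglyMeasurable.mul
        hg.aestronglyMeasurable.comp_snd
    rw [integrable_prod_iff' hmeas]
    refine ⟨(ae_restrict_iff' measurableSet_Ioc).2 (Filter.Eventually.of_forall fun s hs => ?_), ?_⟩
    · obtain ⟨i0, i1⟩ := intervalIntegrable_kernel_right hH hs.1 hs.2
      have hi := (intervalIntegrable_iff_integrableOn_Ioc_of_le ht).1 (i0.trans i1)
      exact Integrable.mul_const (f := fun r => kernel H s r) hi (h 0 s)
    · have hc : Continuous fun s : ℝ => √(2 * H) * ((t - s) ^ (H + 1 / 2) / (H + 1 / 2)) :=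
        continuous_const.mul (((continuous_const.sub continuous_id).rpow_const
          fun _ => Or.inr (by linarith)).div_const _)
      have := (((intervalIntegrable_iff_integrableOn_Ioc_of_le ht).2 hg.norm).continuousOn_mul
        hc.continuousOn)
      rw [intervalIntegrable_iff_integrableOn_Ioc_of_le ht] at this
      refine this.congr_fun (fun s hs => ?_) measurableSet_Ioc
      simp only [norm_mul, Real.norm_of_nonneg (kernel_nonneg H _ _)]
      rw [integral_mul_const, ← intervalIntegral.integral_of_le ht,
        integral_kernel_right hH hs.1 hs.2]
  have m2 : Integrable (fun x : ℝ × ℝ => if x.2 < x.1 then kernel H x.1 t * h 0 x.2 else 0)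
      ((volume.restrict (Ioc 0 t)).prod (volume.restrict (Ioc 0 t))) :=
    (hk.mul_prod hg).indicator (s := {x : ℝ × ℝ | x.2 < x.1})
      (measurableSet_lt measurable_snd measurable_fst)
  -- Both sides are double integrals over the square `(0,t]²`, extended by zero. After Fubini the
  -- factor multiplying `h 0 s` is `∫ K(s,r) dr` on one side and `∫_s^t K(r,t) dr` on the other.
  rw [l1, r1, integral_integral_swap (f := fun r s => kernel H s r * h 0 s) m1,
    integral_integral_swap (f := fun s u => if u < s then kernel H s t * h 0 u else 0) m2]
  refine setIntegral_congr_fun measurableSet_Ioc fun s hs => ?_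
  simp only
  rw [integral_mul_const, ← intervalIntegral.integral_of_le ht, integral_kernel_right hH hs.1 hs.2,
    ← integral_kernel_left hH hs.1.le hs.2, intervalIntegral.integral_of_le hs.2,
    ← integral_mul_const,
    setIntegral_eq_of_subset_of_forall_sdiff_eq_zero (s := Ioc s t) (t := Ioc 0 t)
      (f := fun r => if s < r then kernel H r t * h 0 s else 0) measurableSet_Ioc
      (Ioc_subset_Ioc_left hs.1.le)]
  · exact setIntegral_congr_fun measurableSet_Ioc fun r hr => (if_pos hr.1).symm
  · exact fun r hr => if_neg fun hlt => hr.2 ⟨hlt, hr.1.2⟩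

/-! ### Hölder bounds -/

/-- The inequalities between the parameters that are used below. -/
structure Admissible (H κ : ℝ) : Prop where
  pos : 0 < κ
  two_mul_lt : 2 * κ < H
  le_half : H ≤ 1 / 2

namespace Admissible

variable {H κ : ℝ}

theorem holder_pos (hp : Admissible H κ) : 0 < H - κ := by linarith [hp.pos, hp.two_mul_lt]

theorem noise_pos (hp : Admissible H κ) : 0 < 1 / 2 - κ := by
  linarith [hp.pos, hp.two_mul_lt, hp.le_half]

/-- The Young condition: the remaining 1/2 is supplied by the square root of the control. -/
theorem half_lt (hp : Admissible H κ) : 1 / 2 < H - κ + (1 / 2 - κ) := by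
  linarith [hp.two_mul_lt]

theorem level_pos (hp : Admissible H κ) (m : ℕ) : 0 < m * (H - κ) + 1 / 2 - κ := by
  have := mul_nonneg (Nat.cast_nonneg (α := ℝ) m) hp.holder_pos.le
  linarith [hp.noise_pos]

theorem rpow_level (hp : Admissible H κ) (m : ℕ) {x : ℝ} (hx : 0 ≤ x) :
    x ^ (m * (H - κ) + 1 / 2 - κ) = (x ^ (H - κ)) ^ m * x ^ (1 / 2 - κ) := by
  rw [add_sub_assoc, Real.rpow_add_of_nonneg hx
    (mul_nonneg (Nat.cast_nonneg m) hp.holder_pos.le) hp.noise_pos.le, mul_comm (m : ℝ),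
    Real.rpow_mul hx, Real.rpow_natCast]

end Admissible

theorem holderNorm_le_iff {a C : ℝ} (hC : 0 ≤ C) {A : ℝ → ℝ → ℝ} :
    holderNorm a A ≤ ENNReal.ofReal C ↔
      ∀ s t, 0 ≤ s → s < t → t ≤ 1 → |A s t| ≤ C * (t - s) ^ a := by
  simp only [holderNorm, iSup_le_iff, ENNReal.ofReal_le_ofReal_iff hC]
  refine forall₂_congr fun s t => ⟨fun h h1 h2 h3 => ?_, fun h hst => ?_⟩
  · have := h ⟨h1, h2, h3⟩
    rwa [div_le_iff₀ (Real.rpow_pos_of_pos (sub_pos.2 h2) a)] at this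
  · rw [div_le_iff₀ (Real.rpow_pos_of_pos (sub_pos.2 hst.2.1) a)]
    exact h hst.1 hst.2.1 hst.2.2

/-- Real-valued form of the bounds on all components of a family. -/
structure HolderBound (H κ c : ℝ) (e : ℕ → ℝ) (A : ModelData) : Prop where
  vol : ∀ s t, 0 ≤ s → s < t → t ≤ 1 → |A.vol t - A.vol s| ≤ c * (t - s) ^ (H - κ)
  iter : ∀ i m s t, m ≤ order H → 0 ≤ s → s < t → t ≤ 1 →
    |A.iter i m s t| ≤ e m * (t - s) ^ (m * (H - κ) + 1 / 2 - κ)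

theorem holderBound_of_modelNorm_le {H κ δ : ℝ} (hδ : 0 ≤ δ) {A : ModelData}
    (h : modelNorm H κ A ≤ ENNReal.ofReal δ) : HolderBound H κ δ (fun _ => δ) A := by
  refine ⟨(holderNorm_le_iff hδ).1 (le_trans le_self_add h), fun i m s t hm => ?_⟩
  refine (holderNorm_le_iff hδ).1 (le_trans ?_ h) s t
  refine le_trans ?_ le_add_self
  refine le_trans ?_ (Finset.single_le_sum (f := fun i => ∑ m ∈ Finset.range (order H + 1),
      holderNorm (m * (H - κ) + 1 / 2 - κ) (A.iter i m)) (fun _ _ => zero_le) (Finset.mem_univ i))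
  exact Finset.single_le_sum (f := fun m : ℕ => holderNorm (m * (H - κ) + 1 / 2 - κ) (A.iter i m))
    (fun _ _ => zero_le) (Finset.mem_range.2 (Nat.lt_succ_of_le hm))

theorem HolderBound.modelNorm_le {H κ c : ℝ} {e : ℕ → ℝ} {A : ModelData} (hc : 0 ≤ c)
    (he : ∀ m, 0 ≤ e m) (h : HolderBound H κ c e A) :
    modelNorm H κ A ≤ ENNReal.ofReal (c + 2 * ∑ m ∈ Finset.range (order H + 1), e m) := by
  have h0 : 0 ≤ ∑ m ∈ Finset.range (order H + 1), e m := Finset.sum_nonneg fun m _ => he m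
  rw [ENNReal.ofReal_add hc (by positivity), ENNReal.ofReal_mul (by norm_num),
    ENNReal.ofReal_sum_of_nonneg fun m _ => he m]
  refine add_le_add ((holderNorm_le_iff hc).2 h.vol) ?_
  have : ENNReal.ofReal 2 * ∑ m ∈ Finset.range (order H + 1), ENNReal.ofReal (e m) =
      ∑ _i : Fin 2, ∑ m ∈ Finset.range (order H + 1), ENNReal.ofReal (e m) := by
    simp
  rw [this]
  refine Finset.sum_le_sum fun i _ => Finset.sum_le_sum fun m hm => ?_
  exact (holderNorm_le_iff (he m)).2 fun s t =>
    h.iter i m s t (Nat.le_of_lt_succ (Finset.mem_range.1 hm))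

theorem ennreal_rpow_inv_succ_le_iff {x : ℝ≥0∞} {δ : ℝ} (hδ : 0 ≤ δ) (m : ℕ) :
    x ^ (1 / ((m : ℝ) + 1)) ≤ ENNReal.ofReal δ ↔ x ≤ ENNReal.ofReal (δ ^ (m + 1)) := by
  have : (0 : ℝ) < (m : ℝ) + 1 := by positivity
  rw [one_div, ENNReal.rpow_inv_le_iff this, ENNReal.ofReal_rpow_of_nonneg hδ this.le]
  norm_cast

theorem holderBound_of_homNorm_le {H κ δ : ℝ} (hδ : 0 ≤ δ) {A : ModelData}
    (h : homNorm H κ A ≤ ENNReal.ofReal δ) : HolderBound H κ δ (fun m => δ ^ (m + 1)) A := by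
  refine ⟨(holderNorm_le_iff hδ).1 (le_trans le_self_add h), fun i m s t hm => ?_⟩
  refine (holderNorm_le_iff (pow_nonneg hδ _)).1 ?_ s t
  rw [← ennreal_rpow_inv_succ_le_iff hδ]
  refine le_trans ?_ h
  refine le_trans ?_ le_add_self
  refine le_trans ?_ (Finset.single_le_sum (f := fun i => ∑ m ∈ Finset.range (order H + 1),
      holderNorm (m * (H - κ) + 1 / 2 - κ) (A.iter i m) ^ (1 / ((m : ℝ) + 1)))
      (fun _ _ => zero_le) (Finset.mem_univ i))
  exact Finset.single_le_sum (f := fun m : ℕ =>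
    holderNorm (m * (H - κ) + 1 / 2 - κ) (A.iter i m) ^ (1 / ((m : ℝ) + 1)))
    (fun _ _ => zero_le) (Finset.mem_range.2 (Nat.lt_succ_of_le hm))

theorem HolderBound.homNorm_le {H κ c d : ℝ} {e : ℕ → ℝ} {A : ModelData} (hc : 0 ≤ c)
    (hd : 0 ≤ d) (he : ∀ m ≤ order H, e m ≤ d ^ (m + 1)) (h : HolderBound H κ c e A) :
    homNorm H κ A ≤ ENNReal.ofReal (c + 2 * (order H + 1) * d) := by
  rw [ENNReal.ofReal_add hc (by positivity), mul_assoc, ENNReal.ofReal_mul (by norm_num)]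
  refine add_le_add ((holderNorm_le_iff hc).2 h.vol) ?_
  have : ENNReal.ofReal 2 * ENNReal.ofReal ((order H + 1) * d) =
      ∑ _i : Fin 2, ∑ _m ∈ Finset.range (order H + 1), ENNReal.ofReal d := by
    rw [ENNReal.ofReal_mul (by positivity)]
    simp only [Finset.sum_const, Finset.card_univ, Fintype.card_fin, Finset.card_range,
      nsmul_eq_mul, ENNReal.ofReal_ofNat]
    congr 2
    rw [← Nat.cast_succ, ENNReal.ofReal_natCast]
  rw [this]
  refine Finset.sum_le_sum fun i _ => Finset.sum_le_sum fun m hm => ?_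
  rw [ennreal_rpow_inv_succ_le_iff hd]
  have hm := Nat.le_of_lt_succ (Finset.mem_range.1 hm)
  refine (holderNorm_le_iff (pow_nonneg hd _)).2 fun s t hs hst ht => ?_
  refine (h.iter i m s t hm hs hst ht).trans ?_
  have : 0 ≤ (t - s) ^ (m * (H - κ) + 1 / 2 - κ) := Real.rpow_nonneg (sub_nonneg.2 hst.le) _
  exact mul_le_mul_of_nonneg_right (he m hm) this

theorem continuousOn_of_holder {f : ℝ → ℝ} {a c : ℝ} (ha : 0 < a)
    (h : ∀ s t, 0 ≤ s → s < t → t ≤ 1 → |f t - f s| ≤ c * (t - s) ^ a) :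
    ContinuousOn f (Icc 0 1) := by
  intro x hx
  rw [ContinuousWithinAt, tendsto_iff_dist_tendsto_zero]
  have hb : ∀ y ∈ Icc (0 : ℝ) 1, dist (f y) (f x) ≤ c * |y - x| ^ a := by
    intro y hy
    rw [Real.dist_eq]
    rcases lt_trichotomy y x with hyx | rfl | hyx
    · rw [abs_sub_comm, abs_sub_comm y, abs_of_pos (sub_pos.2 hyx)]
      exact h y x hy.1 hyx hx.2
    · simp [Real.zero_rpow ha.ne']
    · rw [abs_of_pos (sub_pos.2 hyx)]
      exact h x y hx.1 hyx hy.2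
  refine squeeze_zero' (Filter.Eventually.of_forall fun _ => dist_nonneg)
    (Filter.eventually_of_mem self_mem_nhdsWithin hb) ?_
  have hcont : Continuous fun y : ℝ => c * |y - x| ^ a :=
    continuous_const.mul (((continuous_id.sub continuous_const).abs).rpow_const
      fun _ => Or.inr ha.le)
  have := hcont.tendsto x
  simp only [sub_self, abs_zero, Real.zero_rpow ha.ne', mul_zero] at this
  exact this.mono_left nhdsWithin_le_nhds

/-! ### Regularity in time of the components of a model -/

namespace IsRVModel

variable {H κ : ℝ} {A : ModelData}

theorem exists_holderBound (hA : IsRVModel H κ A) : ∃ N, 0 ≤ N ∧ HolderBound H κ N (fun _ => N) A :=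
  ⟨(modelNorm H κ A).toReal, ENNReal.toReal_nonneg, holderBound_of_modelNorm_le
    ENNReal.toReal_nonneg (by rw [ENNReal.ofReal_toReal hA.bound.ne])⟩

theorem continuousOn_vol (hA : IsRVModel H κ A) (hp : Admissible H κ) :
    ContinuousOn A.vol (Icc 0 1) :=
  let ⟨_, _, h⟩ := hA.exists_holderBound
  continuousOn_of_holder hp.holder_pos h.vol

theorem continuousOn_noise (hA : IsRVModel H κ A) (hp : Admissible H κ) (i : Fin 2) :
    ContinuousOn (A.noise i) (Icc 0 1) := by
  obtain ⟨N, _, h⟩ := hA.exists_holderBound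
  refine continuousOn_of_holder (hp.level_pos 0) (c := N) fun s t hs hst ht => ?_
  rw [← hA.iter_zero i s t hs hst.le ht]
  exact h.iter i 0 s t (Nat.zero_le _) hs hst ht

/-- Chen's relation at `s = u = t` leaves only the term `j = m` and reads `x = x + x`. -/
theorem iter_self (hA : IsRVModel H κ A) (i : Fin 2) (m : ℕ) {s : ℝ} (hs : 0 ≤ s) (hs' : s ≤ 1) :
    A.iter i m s s = 0 := by
  by_cases hm : m ≤ order H
  · have h := hA.chen i m s s s hm hs le_rfl le_rfl hs'
    rw [Finset.sum_range_succ, Finset.sum_eq_zero] at h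
    · simpa using h
    · intro j hj
      have := Finset.mem_range.1 hj
      rw [sub_self, zero_pow (by omega), mul_zero, zero_mul]
  · exact hA.iter_support i m s s fun h => hm h.1

theorem iter_sub (hA : IsRVModel H κ A) (i : Fin 2) {m : ℕ} (hm : m ≤ order H) {s u t : ℝ}
    (hs : 0 ≤ s) (hsu : s ≤ u) (hut : u ≤ t) (ht : t ≤ 1) :
    A.iter i m s t - A.iter i m s u = ∑ j ∈ Finset.range (m + 1),
        (m.choose j : ℝ) * (A.vol u - A.vol s) ^ (m - j) * A.iter i j u t := by
  rw [hA.chen i m s u t hm hs hsu hut ht, add_sub_cancel_left]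

end IsRVModel

/-- Bounds of the form `|a_j| ≤ α_j (u-s)^((m-j)(H-κ))`, `|b_j| ≤ β_j (v-u)^(j(H-κ)+1/2-κ)` turn
a sum as in Chen's relation into a Hölder bound of order `1/2-κ`. -/
theorem Admissible.abs_sum_choose_le {H κ : ℝ} (hp : Admissible H κ) {m : ℕ} {a b α β : ℕ → ℝ}
    {s u v t : ℝ} (hsu : s ≤ u) (huv : u ≤ v) (hvt : v ≤ t)
    (ha : ∀ j ≤ m, |a j| ≤ α j * ((u - s) ^ (H - κ)) ^ (m - j))
    (hb : ∀ j ≤ m, |b j| ≤ β j * (v - u) ^ (j * (H - κ) + 1 / 2 - κ))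
    (hα : ∀ j, 0 ≤ α j) (hβ : ∀ j, 0 ≤ β j) :
    |∑ j ∈ Finset.range (m + 1), (m.choose j : ℝ) * a j * b j| ≤
      (∑ j ∈ Finset.range (m + 1), (m.choose j : ℝ) * (α j * β j)) *
        ((t - s) ^ (H - κ)) ^ m * (v - u) ^ (1 / 2 - κ) := by
  refine (Finset.abs_sum_le_sum_abs _ _).trans ?_
  rw [Finset.sum_mul, Finset.sum_mul]
  refine Finset.sum_le_sum fun j hj => ?_
  have hj := Nat.le_of_lt_succ (Finset.mem_range.1 hj)
  have h1 := ha j hj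
  have h2 := hb j hj
  rw [hp.rpow_level j (sub_nonneg.2 huv)] at h2
  have hus := sub_nonneg.2 hsu
  have hvu := sub_nonneg.2 huv
  have h3 : (u - s) ^ (H - κ) ≤ (t - s) ^ (H - κ) :=
    Real.rpow_le_rpow hus (by linarith) hp.holder_pos.le
  have h4 : (v - u) ^ (H - κ) ≤ (t - s) ^ (H - κ) :=
    Real.rpow_le_rpow hvu (by linarith) hp.holder_pos.le
  have h5 : 0 ≤ (u - s) ^ (H - κ) := by positivity
  have h6 : 0 ≤ (v - u) ^ (H - κ) := by positivity
  have h7 : 0 ≤ (v - u) ^ (1 / 2 - κ) := by positivity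
  have h8 : 0 ≤ (t - s) ^ (H - κ) := h5.trans h3
  have := hα j
  have := hβ j
  rw [abs_mul, abs_mul, Nat.abs_cast]
  calc (m.choose j : ℝ) * |a j| * |b j|
      ≤ (m.choose j : ℝ) * (α j * ((t - s) ^ (H - κ)) ^ (m - j)) *
        (β j * (((t - s) ^ (H - κ)) ^ j * (v - u) ^ (1 / 2 - κ))) := by
        refine mul_le_mul (mul_le_mul_of_nonneg_left (h1.trans ?_) (Nat.cast_nonneg _))
          (h2.trans ?_) (abs_nonneg _) (by positivity)
        · gcongr
        · gcongr
    _ = (m.choose j : ℝ) * (α j * β j) * (((t - s) ^ (H - κ)) ^ (m - j) * ((t - s) ^ (H - κ)) ^ j) *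
        (v - u) ^ (1 / 2 - κ) := by ring
    _ = _ := by rw [← pow_add, Nat.sub_add_cancel hj]

theorem abs_pow_sub_pow_le_of_abs_le {x y K : ℝ} (n : ℕ) (hx : |x| ≤ K) (hy : |y| ≤ K) :
    |x ^ n - y ^ n| ≤ n * K ^ (n - 1) * |x - y| := by
  refine (abs_pow_sub_pow_le x y n).trans ?_
  have : max |x| |y| ^ (n - 1) ≤ K ^ (n - 1) :=
    pow_le_pow_left₀ (le_max_of_le_left (abs_nonneg _)) (max_le hx hy) _
  calc |x - y| * n * max |x| |y| ^ (n - 1) ≤ |x - y| * n * K ^ (n - 1) := by gcongr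
    _ = _ := by ring

namespace IsRVModel

variable {H κ : ℝ} {A B : ModelData}

/-- For fixed base point `s`, Chen's relation expands the increment over `[u,v]`. The factor
`(v-u)^(1/2-κ)` common to all terms is kept and the other powers are bounded by powers of `t-s`,
which makes Young integration on `[s,t]` possible without losing homogeneity. -/
theorem abs_iter_sub_le (hA : IsRVModel H κ A) (hp : Admissible H κ) {c : ℝ} {e : ℕ → ℝ}
    (hc : 0 ≤ c) (he : ∀ m, 0 ≤ e m) (hb : HolderBound H κ c e A) (i : Fin 2) {m : ℕ}
    (hm : m ≤ order H) {s u v t : ℝ} (hs : 0 ≤ s) (hsu : s ≤ u) (huv : u ≤ v) (hvt : v ≤ t)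
    (ht : t ≤ 1) :
    |A.iter i m s v - A.iter i m s u| ≤
      (∑ j ∈ Finset.range (m + 1), (m.choose j : ℝ) * (c ^ (m - j) * e j)) *
        ((t - s) ^ (H - κ)) ^ m * (v - u) ^ (1 / 2 - κ) := by
  rw [hA.iter_sub i hm hs hsu huv (hvt.trans ht)]
  refine hp.abs_sum_choose_le hsu huv hvt (fun j _ => ?_) (fun j hj => ?_)
    (fun j => pow_nonneg hc _) he
  · rw [abs_pow, ← mul_pow]
    refine pow_le_pow_left₀ (abs_nonneg _) ?_ _
    rcases hsu.eq_or_lt with rfl | hlt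
    · simp [Real.zero_rpow hp.holder_pos.ne']
    · exact hb.vol s u hs hlt (huv.trans (hvt.trans ht))
  · rcases huv.eq_or_lt with rfl | hlt
    · rw [hA.iter_self i j (hs.trans hsu) (hvt.trans ht), sub_self,
        Real.zero_rpow (hp.level_pos j).ne']
      simp
    · exact hb.iter i j u v (hj.trans hm) (hs.trans hsu) hlt (hvt.trans ht)

/-- Increments of the difference of two models, one of which is fixed. -/
theorem abs_iter_sub_sub_le (hA : IsRVModel H κ A) (hB : IsRVModel H κ B) (hp : Admissible H κ)
    {K δ : ℝ} (hK : 1 ≤ K) (hδ : 0 ≤ δ) (hb : HolderBound H κ K (fun _ => K) B)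
    (hd : HolderBound H κ δ (fun m => δ * (1 + δ) ^ m) (A - B)) (i : Fin 2) {m : ℕ}
    (hm : m ≤ order H) {s u v t : ℝ} (hs : 0 ≤ s) (hsu : s ≤ u) (huv : u ≤ v) (hvt : v ≤ t)
    (ht : t ≤ 1) :
    |(A - B).iter i m s v - (A - B).iter i m s u| ≤
      2 ^ m * ((m + 1) * K ^ (m + 1)) * (δ * (1 + δ) ^ m) *
        ((t - s) ^ (H - κ)) ^ m * (v - u) ^ (1 / 2 - κ) := by
  have hv1 := hvt.trans ht
  have hu0 := hs.trans hsu
  have hK0 : 0 ≤ K := zero_le_one.trans hK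
  set y := (u - s) ^ (H - κ) with hy
  have hy0 : 0 ≤ y := Real.rpow_nonneg (sub_nonneg.2 hsu) _
  have hXB : |B.vol u - B.vol s| ≤ K * y := by
    rcases hsu.eq_or_lt with rfl | hlt
    · simp [hy, Real.zero_rpow hp.holder_pos.ne']
    · exact hb.vol s u hs hlt (huv.trans hv1)
  have hD : |(A.vol u - A.vol s) - (B.vol u - B.vol s)| ≤ δ * y := by
    have e : (A.vol u - A.vol s) - (B.vol u - B.vol s) = (A - B).vol u - (A - B).vol s := by
      change _ = (A.vol u - B.vol u) - (A.vol s - B.vol s); ring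
    rw [e]
    rcases hsu.eq_or_lt with rfl | hlt
    · simp [hy, Real.zero_rpow hp.holder_pos.ne']
    · exact hd.vol s u hs hlt (huv.trans hv1)
  -- Because `K ≥ 1`, increments of both volatility paths are bounded by `K (1+δ)`: the dependence
  -- on δ is through powers of `1+δ` only.
  have hKδ : K + δ ≤ K * (1 + δ) := by nlinarith
  have hXA : |A.vol u - A.vol s| ≤ K * (1 + δ) * y := by
    have := abs_add_le ((A.vol u - A.vol s) - (B.vol u - B.vol s)) (B.vol u - B.vol s)
    rw [sub_add_cancel] at this
    nlinarith
  have hIB : ∀ j ≤ m, |B.iter i j u v| ≤ K * (v - u) ^ (j * (H - κ) + 1 / 2 - κ) := fun j hj => by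
    rcases huv.eq_or_lt with rfl | hlt
    · rw [hB.iter_self i j hu0 hv1, sub_self, Real.zero_rpow (hp.level_pos j).ne']; simp
    · exact hb.iter i j u v (hj.trans hm) hu0 hlt hv1
  have hID : ∀ j ≤ m, |(A - B).iter i j u v| ≤
      δ * (1 + δ) ^ j * (v - u) ^ (j * (H - κ) + 1 / 2 - κ) := fun j hj => by
    rcases huv.eq_or_lt with rfl | hlt
    · change |A.iter i j u u - B.iter i j u u| ≤ _
      rw [hA.iter_self i j hu0 hv1, hB.iter_self i j hu0 hv1, sub_self u,
        Real.zero_rpow (hp.level_pos j).ne']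
      simp
    · exact hd.iter i j u v (hj.trans hm) hu0 hlt hv1
  have e : (A - B).iter i m s v - (A - B).iter i m s u =
      (∑ j ∈ Finset.range (m + 1), (m.choose j : ℝ) *
        ((A.vol u - A.vol s) ^ (m - j) - (B.vol u - B.vol s) ^ (m - j)) * B.iter i j u v) +
      ∑ j ∈ Finset.range (m + 1), (m.choose j : ℝ) * (A.vol u - A.vol s) ^ (m - j) *
        (A - B).iter i j u v := by
    change (A.iter i m s v - B.iter i m s v) - (A.iter i m s u - B.iter i m s u) = _
    rw [sub_sub_sub_comm, hA.iter_sub i hm hs hsu huv hv1, hB.iter_sub i hm hs hsu huv hv1,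
      ← Finset.sum_sub_distrib, ← Finset.sum_add_distrib]
    refine Finset.sum_congr rfl fun j _ => ?_
    change _ = _ + _ * (A.iter i j u v - B.iter i j u v)
    ring
  have h1δ : 1 ≤ 1 + δ := by linarith
  have h1 := hp.abs_sum_choose_le hsu huv hvt (m := m)
    (a := fun j => (A.vol u - A.vol s) ^ (m - j) - (B.vol u - B.vol s) ^ (m - j))
    (b := fun j => B.iter i j u v) (α := fun _ => m * K ^ m * (δ * (1 + δ) ^ m)) (β := fun _ => K)
    (fun j _ => by
      have hXB' : |B.vol u - B.vol s| ≤ K * (1 + δ) * y := 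
        hXB.trans (by nlinarith [mul_nonneg (mul_nonneg hK0 hδ) hy0])
      refine (abs_pow_sub_pow_le_of_abs_le (m - j) hXA hXB').trans ?_
      -- For `j = m` the two powers are equal and the truncated exponent `m - j - 1` would be
      -- misleading.
      rcases Nat.eq_zero_or_pos (m - j) with h0 | h0
      · rw [h0]; simp; positivity
      calc ((m - j : ℕ) : ℝ) * (K * (1 + δ) * y) ^ (m - j - 1) *
            |(A.vol u - A.vol s) - (B.vol u - B.vol s)|
          ≤ ((m - j : ℕ) : ℝ) * (K * (1 + δ) * y) ^ (m - j - 1) * (δ * y) := by gcongr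
        _ = ((m - j : ℕ) : ℝ) * K ^ (m - j - 1) * (δ * (1 + δ) ^ (m - j - 1)) *
            y ^ (m - j - 1 + 1) := by rw [mul_pow, mul_pow]; ring
        _ ≤ m * K ^ m * (δ * (1 + δ) ^ m) * y ^ (m - j) := by
            rw [Nat.sub_add_cancel h0]
            have e1 : ((m - j : ℕ) : ℝ) ≤ m := by exact_mod_cast Nat.sub_le _ _
            have e2 : K ^ (m - j - 1) ≤ K ^ m := pow_le_pow_right₀ hK (by omega)
            have e3 : (1 + δ) ^ (m - j - 1) ≤ (1 + δ) ^ m := pow_le_pow_right₀ h1δ (by omega)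
            gcongr)
    hIB (fun _ => by positivity) (fun _ => hK0)
  have h2 := hp.abs_sum_choose_le hsu huv hvt (m := m)
    (a := fun j => (A.vol u - A.vol s) ^ (m - j))
    (b := fun j => (A - B).iter i j u v) (α := fun j => (K * (1 + δ)) ^ (m - j))
    (β := fun j => δ * (1 + δ) ^ j)
    (fun j _ => by
      rw [abs_pow, ← mul_pow]
      exact pow_le_pow_left₀ (abs_nonneg _) hXA _)
    hID (fun _ => by positivity) (fun _ => by positivity)
  have hT : 0 ≤ ((t - s) ^ (H - κ)) ^ m * (v - u) ^ (1 / 2 - κ) :=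
    mul_nonneg (pow_nonneg (Real.rpow_nonneg (by linarith) _) _)
      (Real.rpow_nonneg (by linarith) _)
  have hch : ∑ j ∈ Finset.range (m + 1), (m.choose j : ℝ) = 2 ^ m := by
    exact_mod_cast Nat.sum_range_choose m
  have h3 : ∑ j ∈ Finset.range (m + 1), (m.choose j : ℝ) *
      ((K * (1 + δ)) ^ (m - j) * (δ * (1 + δ) ^ j)) ≤
      2 ^ m * (K ^ (m + 1) * (δ * (1 + δ) ^ m)) := by
    rw [← hch, Finset.sum_mul]
    refine Finset.sum_le_sum fun j hj => ?_
    have hj := Nat.le_of_lt_succ (Finset.mem_range.1 hj)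
    have : (K * (1 + δ)) ^ (m - j) * (δ * (1 + δ) ^ j) = K ^ (m - j) * (δ * (1 + δ) ^ m) := by
      rw [mul_pow, ← Nat.sub_add_cancel hj, Nat.add_sub_cancel, pow_add]; ring
    rw [this]
    have e2 : K ^ (m - j) ≤ K ^ (m + 1) := pow_le_pow_right₀ hK (by omega)
    gcongr
  rw [e]
  refine (abs_add_le _ _).trans ((add_le_add h1 h2).trans ?_)
  rw [← Finset.sum_mul, hch]
  calc _ ≤ 2 ^ m * (m * K ^ m * (δ * (1 + δ) ^ m) * K) * ((t - s) ^ (H - κ)) ^ m *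
          (v - u) ^ (1 / 2 - κ) + 2 ^ m * (K ^ (m + 1) * (δ * (1 + δ) ^ m)) *
          ((t - s) ^ (H - κ)) ^ m * (v - u) ^ (1 / 2 - κ) := by
        rw [mul_assoc (_ * _ : ℝ) (_ ^ m : ℝ), mul_assoc (_ * _ : ℝ) (_ ^ m : ℝ),
          mul_assoc (∑ j ∈ _, _ : ℝ)]
        gcongr
    _ = _ := by ring

end IsRVModel

/-! ### Young integrals of powers of Volterra paths -/

section VolPow

variable {H κ : ℝ}

theorem Admissible.continuousOn_vol (hp : Admissible H κ) (h : CMSpace) :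
    ContinuousOn (h.vol H) (Icc 0 1) := by
  refine continuousOn_of_holder hp.holder_pos (c := 2 / κ * ‖h‖) fun s t hs hst ht => ?_
  have h1 := h.abs_vol_sub_le hp.pos (by linarith [hp.pos, hp.two_mul_lt]) hp.le_half hs hst.le ht
  rw [mul_comm]
  refine h1.trans ?_
  have h2 := h.sqrt_control_sub_le hp.pos hs hst.le ht
  have h3 : 0 ≤ (t - s) ^ (H - κ) := Real.rpow_nonneg (sub_nonneg.2 hst.le) _
  gcongr

theorem Admissible.abs_vol_sub_le (hp : Admissible H κ) (h : CMSpace) {s t : ℝ} (hs : 0 ≤ s)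
    (hst : s ≤ t) (ht : t ≤ 1) : |h.vol H t - h.vol H s| ≤ 2 / κ * ‖h‖ * (t - s) ^ (H - κ) := by
  have h1 := h.abs_vol_sub_le hp.pos (by linarith [hp.pos, hp.two_mul_lt]) hp.le_half hs hst ht
  rw [mul_comm]
  refine h1.trans ?_
  have h2 := h.sqrt_control_sub_le hp.pos hs hst ht
  have h3 : 0 ≤ (t - s) ^ (H - κ) := Real.rpow_nonneg (sub_nonneg.2 hst) _
  gcongr

theorem Admissible.abs_vol_sub_le_of_le (hp : Admissible H κ) (h : CMSpace) {s r t : ℝ}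
    (hs : 0 ≤ s) (hsr : s ≤ r) (hrt : r ≤ t) (ht : t ≤ 1) :
    |h.vol H r - h.vol H s| ≤ 2 / κ * ‖h‖ * (t - s) ^ (H - κ) := by
  refine (hp.abs_vol_sub_le h hs hsr (hrt.trans ht)).trans ?_
  have := hp.pos
  have := Real.rpow_le_rpow (sub_nonneg.2 hsr) (sub_le_sub_right hrt s) hp.holder_pos.le
  gcongr

/-- Difference of powers: `p-1` factors are bounded on `[s,t]`, and one increment keeps the control
needed for Young integration. -/
theorem Admissible.abs_vol_pow_sub_le (hp : Admissible H κ) (h : CMSpace) (p : ℕ) {s t u v : ℝ}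
    (hs : 0 ≤ s) (ht : t ≤ 1) (hsu : s ≤ u) (huv : u ≤ v) (hvt : v ≤ t) :
    |(h.vol H v - h.vol H s) ^ p - (h.vol H u - h.vol H s) ^ p| ≤
      p * (2 / κ * ‖h‖ * (t - s) ^ (H - κ)) ^ (p - 1) * (v - u) ^ (H - κ) *
        √(h.control κ v - h.control κ u) := by
  have h1 := abs_pow_sub_pow_le_of_abs_le p (hp.abs_vol_sub_le_of_le h hs (hsu.trans huv) hvt ht)
    (hp.abs_vol_sub_le_of_le h hs hsu (huv.trans hvt) ht)
  rw [sub_sub_sub_cancel_right] at h1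
  have h2 := h.abs_vol_sub_le hp.pos (by linarith [hp.pos, hp.two_mul_lt]) hp.le_half (hs.trans hsu)
    huv (hvt.trans ht)
  refine h1.trans ?_
  rw [mul_assoc _ ((v - u) ^ (H - κ))]
  have := hp.pos
  have : 0 ≤ (t - s) ^ (H - κ) := Real.rpow_nonneg (by linarith) _
  gcongr

theorem Admissible.exists_primitive (hp : Admissible H κ) (h : CMSpace) (p : ℕ) {s t B : ℝ}
    (hs : 0 ≤ s) (hst : s ≤ t) (ht : t ≤ 1) (hB : 0 ≤ B) {g : ℝ → ℝ}
    (hg : ∀ u v, s ≤ u → u ≤ v → v ≤ t → |g v - g u| ≤ B * (v - u) ^ (1 / 2 - κ)) :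
    ∃ J, IsYoungPrimitive (H - κ + (1 / 2 - κ)) (h.control κ) s t
      ((youngConst (H - κ + (1 / 2 - κ)) + 1) *
        (p * (2 / κ * ‖h‖ * (t - s) ^ (H - κ)) ^ (p - 1) * B))
      (fun r => (h.vol H r - h.vol H s) ^ p) g J := by
  have := hp.pos
  have : 0 ≤ (t - s) ^ (H - κ) := Real.rpow_nonneg (by linarith) _
  exact exists_isYoungPrimitive hp.holder_pos.le hp.noise_pos.le hp.half_lt hst (by positivity) hB
    (fun u v hu huv hv => h.control_mono hp.pos u v (hs.trans hu) huv (hv.trans ht))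
    (fun u v hu huv hv => hp.abs_vol_pow_sub_le h p hs ht hu huv hv) hg

theorem Admissible.rsIntegral_eq_primitive (hp : Admissible H κ) {h : CMSpace} {s b C : ℝ}
    (hs : 0 ≤ s) (hb : b ≤ 1) {f g J : ℝ → ℝ}
    (hJ : IsYoungPrimitive (H - κ + (1 / 2 - κ)) (h.control κ) s b C f g J) {u v : ℝ} (hu : s ≤ u)
    (huv : u ≤ v) (hv : v ≤ b) :
    HasRSIntegral f g u v (J v - J u) ∧ rsIntegral f g u v = J v - J u := by
  have := hJ.hasRSIntegral hp.half_lt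
    (fun u v hu huv hv => h.control_mono hp.pos u v (hs.trans hu) huv (hv.trans hb)) hu hv
  exact ⟨this, this.rsIntegral_eq huv⟩

theorem Admissible.hasRSIntegral_vol_pow_sub (hp : Admissible H κ) (h : CMSpace) (p : ℕ)
    {s u v b B : ℝ} (hs : 0 ≤ s) (hsu : s ≤ u) (huv : u ≤ v) (hv : v ≤ b) (hb : b ≤ 1) (hB : 0 ≤ B)
    {g : ℝ → ℝ} (hg : ∀ u v, s ≤ u → u ≤ v → v ≤ b → |g v - g u| ≤ B * (v - u) ^ (1 / 2 - κ)) :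
    HasRSIntegral (fun r => (h.vol H r - h.vol H s) ^ p) g u v
      (rsIntegral (fun r => (h.vol H r - h.vol H s) ^ p) g s v -
        rsIntegral (fun r => (h.vol H r - h.vol H s) ^ p) g s u) := by
  obtain ⟨J, hJ⟩ := hp.exists_primitive h p hs (hsu.trans (huv.trans hv)) hb hB hg
  have h1 := hp.rsIntegral_eq_primitive hs hb hJ hsu huv hv
  rw [(hp.rsIntegral_eq_primitive hs hb hJ le_rfl (hsu.trans huv) hv).2,
    (hp.rsIntegral_eq_primitive hs hb hJ le_rfl hsu (huv.trans hv)).2, sub_sub_sub_cancel_right]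
  exact h1.1

theorem Admissible.hasRSIntegral_vol_pow (hp : Admissible H κ) (h : CMSpace) (p : ℕ)
    {s t B : ℝ} (hs : 0 ≤ s) (hst : s ≤ t) (ht : t ≤ 1) (hB : 0 ≤ B)
    {g : ℝ → ℝ} (hg : ∀ u v, s ≤ u → u ≤ v → v ≤ t → |g v - g u| ≤ B * (v - u) ^ (1 / 2 - κ)) :
    HasRSIntegral (fun r => (h.vol H r - h.vol H s) ^ p) g s t
      (rsIntegral (fun r => (h.vol H r - h.vol H s) ^ p) g s t) := by
  obtain ⟨J, hJ⟩ := hp.exists_primitive h p hs hst ht hB hg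
  have h1 := hp.rsIntegral_eq_primitive hs ht hJ le_rfl hst le_rfl
  rw [h1.2]
  exact h1.1

/-- The constant in the bound for `∫ ĥ^p dg`. -/
def volPowConst (H κ : ℝ) (p : ℕ) : ℝ := (youngConst (H - κ + (1 / 2 - κ)) + 1) * p + 1

theorem Admissible.volPowConst_nonneg (hp : Admissible H κ) (p : ℕ) : 0 ≤ volPowConst H κ p := by
  have := youngConst_pos hp.half_lt
  unfold volPowConst
  positivity

theorem Admissible.abs_rsIntegral_vol_pow_le (hp : Admissible H κ) (h : CMSpace) (p : ℕ)
    {s t B : ℝ} (hs : 0 ≤ s) (hst : s ≤ t) (ht : t ≤ 1) (hB : 0 ≤ B) {g : ℝ → ℝ}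
    (hg : ∀ u v, s ≤ u → u ≤ v → v ≤ t → |g v - g u| ≤ B * (v - u) ^ (1 / 2 - κ)) :
    |rsIntegral (fun r => (h.vol H r - h.vol H s) ^ p) g s t| ≤
      volPowConst H κ p * (2 / κ * ‖h‖) ^ p * B *
        (((t - s) ^ (H - κ)) ^ p * (t - s) ^ (1 / 2 - κ)) := by
  have hd := sub_nonneg.2 hst
  have hκ := hp.pos
  have hT : 0 ≤ (t - s) ^ (H - κ) := Real.rpow_nonneg hd _
  have hT' : 0 ≤ (t - s) ^ (1 / 2 - κ) := Real.rpow_nonneg hd _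
  have hy := youngConst_pos hp.half_lt
  -- For `p = 0` the integrand is 1 and does not vanish at `s`; this case accounts for the `+ 1` in
  -- `volPowConst`.
  rcases Nat.eq_zero_or_pos p with rfl | hp0
  · simp only [pow_zero]
    rw [(hasRSIntegral_one g s t).rsIntegral_eq hst]
    simpa [volPowConst] using hg s t le_rfl hst le_rfl
  obtain ⟨J, hJ⟩ := hp.exists_primitive h p hs hst ht hB hg
  rw [(hp.rsIntegral_eq_primitive hs ht hJ le_rfl hst le_rfl).2]
  -- For `p > 0` the integrand vanishes at `s`, so the Young estimate with tag `s` bounds the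
  -- integral itself. The control then supplies the missing factor `2/κ ‖h‖`.
  have h1 := hJ s s t le_rfl le_rfl hst le_rfl
  simp only [sub_self, zero_pow hp0.ne', zero_mul, zero_sub, abs_neg] at h1
  refine h1.trans ?_
  have h2 := h.sqrt_control_sub_le hp.pos hs hst ht
  rw [Real.rpow_add_of_nonneg hd hp.holder_pos.le hp.noise_pos.le]
  calc _ ≤ (youngConst (H - κ + (1 / 2 - κ)) + 1) *
        (p * (2 / κ * ‖h‖ * (t - s) ^ (H - κ)) ^ (p - 1) * B) *
        ((t - s) ^ (H - κ) * (t - s) ^ (1 / 2 - κ)) * (2 / κ * ‖h‖) := by gcongr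
    _ = (youngConst (H - κ + (1 / 2 - κ)) + 1) * p * (2 / κ * ‖h‖) ^ (p - 1 + 1) * B *
        (((t - s) ^ (H - κ)) ^ (p - 1 + 1) * (t - s) ^ (1 / 2 - κ)) := by
        rw [mul_pow (2 / κ * ‖h‖)]; ring
    _ ≤ _ := by
        rw [Nat.sub_add_cancel hp0, volPowConst]
        gcongr
        linarith

/-- Integrating `ĥ^q` against `∫ ĥ^p dg` is integrating `ĥ^(q+p)` against `g`. This is what lets
successive translations be composed. -/
theorem Admissible.hasRSIntegral_vol_pow_assoc (hp : Admissible H κ) (h : CMSpace) (p q : ℕ)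
    {s t B : ℝ} (hs : 0 ≤ s) (hst : s ≤ t) (ht : t ≤ 1) (hB : 0 ≤ B) {g : ℝ → ℝ}
    (hg : ∀ u v, s ≤ u → u ≤ v → v ≤ t → |g v - g u| ≤ B * (v - u) ^ (1 / 2 - κ)) :
    HasRSIntegral (fun r => (h.vol H r - h.vol H s) ^ q)
      (fun r => rsIntegral (fun r => (h.vol H r - h.vol H s) ^ p) g s r) s t
      (rsIntegral (fun r => (h.vol H r - h.vol H s) ^ (q + p)) g s t) := by
  have := hp.pos
  have : 0 ≤ (t - s) ^ (H - κ) := Real.rpow_nonneg (by linarith) _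
  obtain ⟨G, hG⟩ := hp.exists_primitive h p hs hst ht hB hg
  obtain ⟨J, hJ⟩ := hp.exists_primitive h (q + p) hs hst ht hB hg
  simp only [pow_add] at hJ
  have hb : ∀ (n : ℕ) (u : ℝ), s ≤ u → u ≤ t →
      |(h.vol H u - h.vol H s) ^ n| ≤ (2 / κ * ‖h‖ * (t - s) ^ (H - κ)) ^ n := fun n u hu hut => by
    rw [abs_pow]
    exact pow_le_pow_left₀ (abs_nonneg _) (hp.abs_vol_sub_le_of_le h hs hu hut ht) _
  have hFG := IsYoungPrimitive.assoc hp.holder_pos.le hp.noise_pos.le (A := q *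
      (2 / κ * ‖h‖ * (t - s) ^ (H - κ)) ^ (q - 1)) (by positivity) hB
    (fun u v hu huv hv => h.control_mono hp.pos u v (hs.trans hu) huv (hv.trans ht))
    (fun u v hu huv hv => hp.abs_vol_pow_sub_le h q hs ht hu huv hv) hg (hb q) (hb p) hG hJ
  simp only [pow_add]
  rw [(hp.rsIntegral_eq_primitive hs ht hJ le_rfl hst le_rfl).2]
  have h1 := (hp.rsIntegral_eq_primitive hs ht hFG le_rfl hst le_rfl).1.add_right
    (hasRSIntegral_const_right _ (-G s) s t)
  rw [add_zero] at h1
  refine h1.congr (fun _ _ _ => rfl) fun r hr hrt => ?_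
  rw [(hp.rsIntegral_eq_primitive hs ht hG le_rfl hr hrt).2, sub_eq_add_neg]

theorem CMSpace.intervalIntegrable_mul (h : CMSpace) (i : Fin 2) {F : ℝ → ℝ}
    (hF : ContinuousOn F (Icc 0 1)) {a b : ℝ} (ha : 0 ≤ a) (hab : a ≤ b) (hb : b ≤ 1) :
    IntervalIntegrable (fun r => F r * h i r) volume a b :=
  (h.intervalIntegrable i ha hab hb).continuousOn_mul
    (hF.mono (by rw [uIcc_of_le hab]; exact Icc_subset_Icc ha hb))

/-- Young integration against `∫ F ḣ` is integration against `F ḣ dr`. -/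
theorem Admissible.hasRSIntegral_vol_pow_integral (hp : Admissible H κ) (h k : CMSpace) (i : Fin 2)
    (q : ℕ) {F : ℝ → ℝ} (hF : ContinuousOn F (Icc 0 1)) {s t : ℝ} (hs : 0 ≤ s) (hst : s ≤ t)
    (ht : t ≤ 1) :
    HasRSIntegral (fun r => (h.vol H r - h.vol H s) ^ q) (fun r => ∫ x in s..r, F x * k i x) s t
      (∫ r in s..t, (h.vol H r - h.vol H s) ^ q * F r * k i r) := by
  have hκ := hp.pos
  have hTn : 0 ≤ (t - s) ^ (H - κ) := Real.rpow_nonneg (by linarith) _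
  obtain ⟨K, hK⟩ := isCompact_Icc.exists_bound_of_continuousOn hF
  have hK0 : 0 ≤ K := (norm_nonneg _).trans (hK 0 ⟨le_rfl, zero_le_one⟩)
  have hFF : ContinuousOn (fun r => (h.vol H r - h.vol H s) ^ q * F r) (Icc 0 1) :=
    (((hp.continuousOn_vol h).sub continuousOn_const).pow q).mul hF
  -- The ordinary integral is checked directly to be a Young primitive: on `[u,v]` the oscillation
  -- of `ĥ^q` gives `(v-u)^(H-κ)` and the control, and Cauchy-Schwarz gives `(v-u)^(1/2) ≤
  -- (v-u)^(1/2-κ)`.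
  have hP : IsYoungPrimitive (H - κ + (1 / 2 - κ)) (h.control κ) s t
      (q * (2 / κ * ‖h‖ * (t - s) ^ (H - κ)) ^ (q - 1) * K * ‖k‖)
      (fun r => (h.vol H r - h.vol H s) ^ q) (fun r => ∫ x in s..r, F x * k i x)
      (fun r => ∫ x in s..r, (h.vol H x - h.vol H s) ^ q * F x * k i x) := by
    intro u ξ v hu huξ hξv hv
    have huv := huξ.trans hξv
    have hu0 := hs.trans hu
    have hv1 := hv.trans ht
    have hd := sub_nonneg.2 huv
    beta_reduce
    rw [← intervalIntegral.integral_add_adjacent_intervals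
      (k.intervalIntegrable_mul i hF hs hu (huv.trans hv1))
      (k.intervalIntegrable_mul i hF hu0 huv hv1),
      ← intervalIntegral.integral_add_adjacent_intervals
      (k.intervalIntegrable_mul i hFF hs hu (huv.trans hv1))
      (k.intervalIntegrable_mul i hFF hu0 huv hv1), add_sub_cancel_left, add_sub_cancel_left,
      ← intervalIntegral.integral_const_mul, ← intervalIntegral.integral_sub
      ((k.intervalIntegrable_mul i hF hu0 huv hv1).const_mul _)
      (k.intervalIntegrable_mul i hFF hu0 huv hv1)]
    have e : ∀ r, (h.vol H ξ - h.vol H s) ^ q * (F r * k i r) -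
        (h.vol H r - h.vol H s) ^ q * F r * k i r =
        (((h.vol H ξ - h.vol H s) ^ q - (h.vol H r - h.vol H s) ^ q) * F r) * k i r := fun r => by
      ring
    simp only [e]
    have hw : ∀ a b, u ≤ a → a ≤ b → b ≤ v →
        |(h.vol H b - h.vol H s) ^ q - (h.vol H a - h.vol H s) ^ q| ≤
        q * (2 / κ * ‖h‖ * (t - s) ^ (H - κ)) ^ (q - 1) * (v - u) ^ (H - κ) *
        √(h.control κ v - h.control κ u) := fun a b ha hab hb => by
      refine (hp.abs_vol_pow_sub_le h q hs ht (hu.trans ha) hab (hb.trans hv)).trans ?_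
      have h1 : (b - a) ^ (H - κ) ≤ (v - u) ^ (H - κ) :=
        Real.rpow_le_rpow (sub_nonneg.2 hab) (by linarith) hp.holder_pos.le
      have h2 : √(h.control κ b - h.control κ a) ≤ √(h.control κ v - h.control κ u) :=
        Real.sqrt_le_sqrt (sub_le_sub
          (h.control_mono hp.pos b v (hu0.trans (ha.trans hab)) hb hv1)
          (h.control_mono hp.pos u a hu0 ha (hab.trans (hb.trans hv1))))
      have := Real.rpow_nonneg (sub_nonneg.2 hab) (H - κ)
      gcongr
    have h0 : 0 ≤ (v - u) ^ (H - κ) := Real.rpow_nonneg hd _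
    have h1 := k.abs_integral_mul_le i (F := fun r =>
      ((h.vol H ξ - h.vol H s) ^ q - (h.vol H r - h.vol H s) ^ q) * F r)
      (K := q * (2 / κ * ‖h‖ * (t - s) ^ (H - κ)) ^ (q - 1) * (v - u) ^ (H - κ) *
        √(h.control κ v - h.control κ u) * K) hu0 huv hv1 (fun r hr => by
        rw [abs_mul]
        refine mul_le_mul ?_ (hK r ⟨hu0.trans hr.1.le, hr.2.le.trans hv1⟩) (abs_nonneg _)
          (by positivity)
        rcases le_total r ξ with hrξ | hrξ
        · exact hw r ξ hr.1.le hrξ hξv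
        · rw [abs_sub_comm]
          exact hw ξ r huξ hrξ hr.2.le) (by positivity)
    refine h1.trans ?_
    have h2 : (v - u) ^ (1 / 2 : ℝ) ≤ (v - u) ^ (1 / 2 - κ) :=
      Real.rpow_le_rpow_of_exponent_ge' hd (by linarith) hp.noise_pos.le (by linarith)
    rw [Real.rpow_add_of_nonneg hd hp.holder_pos.le hp.noise_pos.le]
    calc _ ≤ q * (2 / κ * ‖h‖ * (t - s) ^ (H - κ)) ^ (q - 1) * (v - u) ^ (H - κ) *
        √(h.control κ v - h.control κ u) * K * (v - u) ^ (1 / 2 - κ) * ‖k‖ := by gcongr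
      _ = _ := by ring
  have := (hp.rsIntegral_eq_primitive hs ht hP le_rfl hst le_rfl).1
  simpa using this

end VolPow

/-! ### The algebra of translations -/

open MvPolynomial in
/-- The linear functional on polynomials in two variables with `X₀^p X₁^l ↦ J p l`. -/
def monomialFunctional (J : ℕ → ℕ → ℝ) : MvPolynomial (Fin 2) ℝ →ₗ[ℝ] ℝ :=
  (basisMonomials (Fin 2) ℝ).constr ℝ fun d => J (d 0) (d 1)

section Functional

open MvPolynomial

theorem monomialFunctional_apply (J : ℕ → ℕ → ℝ) (p l : ℕ) :
    monomialFunctional J (X 0 ^ p * X 1 ^ l) = J p l := by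
  have : (X 0 ^ p * X 1 ^ l : MvPolynomial (Fin 2) ℝ) =
      basisMonomials (Fin 2) ℝ (Finsupp.single 0 p + Finsupp.single 1 l) := by
    rw [coe_basisMonomials, X_pow_eq_monomial, X_pow_eq_monomial, monomial_mul, one_mul]
  rw [this, monomialFunctional, Module.Basis.constr_basis]
  simp

theorem monomialFunctional_C_mul (J : ℕ → ℕ → ℝ) (c : ℝ) (P : MvPolynomial (Fin 2) ℝ) :
    monomialFunctional J (C c * P) = c * monomialFunctional J P := by
  rw [C_mul', map_smul, smul_eq_mul]

theorem monomialFunctional_mul_C (J : ℕ → ℕ → ℝ) (c : ℝ) (P : MvPolynomial (Fin 2) ℝ) :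
    monomialFunctional J (P * C c) = c * monomialFunctional J P := by
  rw [mul_comm, monomialFunctional_C_mul]

theorem monomialFunctional_add_pow (J : ℕ → ℕ → ℝ) (m : ℕ) :
    monomialFunctional J ((X 1 + X 0) ^ m) =
      ∑ j ∈ Finset.range (m + 1), (m.choose j : ℝ) * J (m - j) j := by
  rw [add_pow, map_sum]
  refine Finset.sum_congr rfl fun j _ => ?_
  rw [← map_natCast (C : ℝ →+* MvPolynomial (Fin 2) ℝ), monomialFunctional_mul_C,
    mul_comm (X 1 ^ j), monomialFunctional_apply]

/-- The substitution `X₀ + b`, `X₁ + a` encodes a change of base point, with `b` and `a` the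
increments of `ĥ` and of `Ŵ` between the two base points. -/
theorem monomialFunctional_shift (J : ℕ → ℕ → ℝ) (a b : ℝ) (p l : ℕ) :
    monomialFunctional J ((X 0 + C b) ^ p * (X 1 + C a) ^ l) =
      ∑ q ∈ Finset.range (p + 1), ((p.choose q : ℝ) * b ^ (p - q)) *
        ∑ j ∈ Finset.range (l + 1), ((l.choose j : ℝ) * a ^ (l - j)) * J q j := by
  rw [add_pow, add_pow, Finset.sum_mul_sum, map_sum]
  refine Finset.sum_congr rfl fun q _ => ?_
  rw [map_sum, Finset.mul_sum]
  refine Finset.sum_congr rfl fun j _ => ?_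
  have : (X 0 ^ q * C b ^ (p - q) * (p.choose q : MvPolynomial (Fin 2) ℝ) *
      (X 1 ^ j * C a ^ (l - j) * (l.choose j : MvPolynomial (Fin 2) ℝ))) =
      C (((p.choose q : ℝ) * b ^ (p - q)) * ((l.choose j : ℝ) * a ^ (l - j))) *
        (X 0 ^ q * X 1 ^ j) := by
    simp only [map_mul, map_pow, map_natCast]
    ring
  rw [this, monomialFunctional_C_mul, monomialFunctional_apply, mul_assoc]

/-- The algebraic identity behind Chen's relation for the translated model. -/
theorem sum_monomialFunctional_shift (J : ℕ → ℕ → ℝ) (a b : ℝ) (m : ℕ) :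
    ∑ j ∈ Finset.range (m + 1), (m.choose j : ℝ) *
        monomialFunctional J ((X 0 + C b) ^ (m - j) * (X 1 + C a) ^ j) =
      ∑ n ∈ Finset.range (m + 1), (m.choose n : ℝ) * (a + b) ^ (m - n) *
        ∑ j ∈ Finset.range (n + 1), (n.choose j : ℝ) * J (n - j) j := by
  -- Both sides are the value at `((X₁ + a) + (X₀ + b))^m = ((X₁ + X₀) + (a + b))^m`, expanded in
  -- two ways.
  have e1 : monomialFunctional J (((X 1 + C a) + (X 0 + C b)) ^ m) =
      ∑ j ∈ Finset.range (m + 1), (m.choose j : ℝ) *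
        monomialFunctional J ((X 0 + C b) ^ (m - j) * (X 1 + C a) ^ j) := by
    rw [add_pow, map_sum]
    refine Finset.sum_congr rfl fun j _ => ?_
    rw [← map_natCast (C : ℝ →+* MvPolynomial (Fin 2) ℝ), monomialFunctional_mul_C,
      mul_comm ((X 1 + C a) ^ j)]
  have e2 : ((X 1 + C a) + (X 0 + C b) : MvPolynomial (Fin 2) ℝ) = (X 1 + X 0) + C (a + b) := by
    rw [map_add]; ring
  rw [← e1, e2, add_pow, map_sum]
  refine Finset.sum_congr rfl fun n _ => ?_
  rw [← monomialFunctional_add_pow, ← map_natCast (C : ℝ →+* MvPolynomial (Fin 2) ℝ), ← map_pow,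
    monomialFunctional_mul_C, monomialFunctional_mul_C]
  ring

/-- The algebraic identity behind `T_{-h} T_h = 1`. -/
theorem sum_sum_neg_one_pow (J : ℕ → ℕ → ℝ) (m : ℕ) :
    ∑ j ∈ Finset.range (m + 1), (m.choose j : ℝ) * ((-1) ^ (m - j) *
      ∑ l ∈ Finset.range (j + 1), (j.choose l : ℝ) * J ((m - j) + (j - l)) l) = J 0 m := by
  -- Translating by `h` and then by `-h` corresponds to `(X₁ + X₀) - X₀ = X₁`.
  have e1 : monomialFunctional J (((X 1 + X 0) + -X 0) ^ m) = J 0 m := by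
    rw [add_neg_cancel_right, ← monomialFunctional_apply J 0 m, pow_zero, one_mul]
  rw [← e1, add_pow, map_sum]
  refine Finset.sum_congr rfl fun j _ => ?_
  rw [← map_natCast (C : ℝ →+* MvPolynomial (Fin 2) ℝ), monomialFunctional_mul_C, add_pow,
    Finset.sum_mul, map_sum, Finset.mul_sum]
  congr 1
  refine Finset.sum_congr rfl fun l _ => ?_
  have : (X 1 ^ l * X 0 ^ (j - l) * (j.choose l : MvPolynomial (Fin 2) ℝ)) * (-X 0) ^ (m - j) =
      C ((-1) ^ (m - j) * (j.choose l : ℝ)) * (X 0 ^ (m - j + (j - l)) * X 1 ^ l) := by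
    rw [neg_pow, map_mul, map_pow, map_neg, map_one, map_natCast, pow_add]
    ring
  rw [this, monomialFunctional_C_mul, monomialFunctional_apply, mul_assoc]

end Functional

/-! ### The translation of a model -/

variable {H κ : ℝ} {A : ModelData}

theorem translate_iter (H : ℝ) (h : CMSpace) (A : ModelData) (i : Fin 2) {m : ℕ} {s t : ℝ}
    (hm : m ≤ order H) (hs : 0 ≤ s) (hst : s ≤ t) (ht : t ≤ 1) :
    (translate H h A).iter i m s t = (∑ j ∈ Finset.range (m + 1), (m.choose j : ℝ) *
        rsIntegral (fun r => (h.vol H r - h.vol H s) ^ (m - j)) (fun r => A.iter i j s r) s t) +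
      ∫ r in s..t, ((A.vol r - A.vol s) + (h.vol H r - h.vol H s)) ^ m * h i r :=
  if_pos ⟨hm, hs, hst, ht⟩

theorem translate_vol (H : ℝ) (h : CMSpace) (A : ModelData) {t : ℝ} (ht : 0 ≤ t) (ht' : t ≤ 1) :
    (translate H h A).vol t = A.vol t + h.vol H t := if_pos ⟨ht, ht'⟩

theorem translate_noise (H : ℝ) (h : CMSpace) (A : ModelData) (i : Fin 2) {t : ℝ} (ht : 0 ≤ t)
    (ht' : t ≤ 1) : (translate H h A).noise i t = A.noise i t + h.path i t := if_pos ⟨ht, ht'⟩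

namespace IsRVModel

theorem exists_iter_holder (hA : IsRVModel H κ A) (hp : Admissible H κ) (i : Fin 2) {j : ℕ}
    (hj : j ≤ order H) {s : ℝ} (hs : 0 ≤ s) :
    ∃ B, 0 ≤ B ∧ ∀ u v, s ≤ u → u ≤ v → v ≤ 1 →
      |A.iter i j s v - A.iter i j s u| ≤ B * (v - u) ^ (1 / 2 - κ) := by
  obtain ⟨N, hN, hb⟩ := hA.exists_holderBound
  by_cases hs1 : s ≤ 1
  · have : 0 ≤ (1 - s) ^ (H - κ) := Real.rpow_nonneg (by linarith) _
    exact ⟨_, by positivity, fun u v hu huv hv =>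
      hA.abs_iter_sub_le hp hN (fun _ => hN) hb i hj hs hu huv hv le_rfl⟩
  · exact ⟨0, le_rfl, fun u v hu huv hv => (hs1 (hu.trans (huv.trans hv))).elim⟩

theorem hasRSIntegral_iter (hA : IsRVModel H κ A) (hp : Admissible H κ) (h : CMSpace) (i : Fin 2)
    (p : ℕ) {j : ℕ} (hj : j ≤ order H) {s t : ℝ} (hs : 0 ≤ s) (hst : s ≤ t) (ht : t ≤ 1) :
    HasRSIntegral (fun r => (h.vol H r - h.vol H s) ^ p) (fun r => A.iter i j s r) s t
      (rsIntegral (fun r => (h.vol H r - h.vol H s) ^ p) (fun r => A.iter i j s r) s t) := by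
  obtain ⟨B, hB, hg⟩ := hA.exists_iter_holder hp i hj hs
  exact hp.hasRSIntegral_vol_pow h p hs hst ht hB fun u v hu huv hv => hg u v hu huv (hv.trans ht)

/-- Rebasing the Young integrals from `s` to `u`. -/
theorem rsIntegral_iter_sub (hA : IsRVModel H κ A) (hp : Admissible H κ) (h : CMSpace) (i : Fin 2)
    (p : ℕ) {j : ℕ} (hj : j ≤ order H) {s u t : ℝ} (hs : 0 ≤ s) (hsu : s ≤ u) (hut : u ≤ t)
    (ht : t ≤ 1) :
    rsIntegral (fun r => (h.vol H r - h.vol H s) ^ p) (fun r => A.iter i j s r) s t -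
      rsIntegral (fun r => (h.vol H r - h.vol H s) ^ p) (fun r => A.iter i j s r) s u =
      monomialFunctional (fun q l => rsIntegral (fun r => (h.vol H r - h.vol H u) ^ q)
          (fun r => A.iter i l u r) u t)
        ((MvPolynomial.X 0 + MvPolynomial.C (h.vol H u - h.vol H s)) ^ p *
          (MvPolynomial.X 1 + MvPolynomial.C (A.vol u - A.vol s)) ^ j) := by
  obtain ⟨B, hB, hg⟩ := hA.exists_iter_holder hp i hj hs
  have h1 := hp.hasRSIntegral_vol_pow_sub h p hs hsu hut ht le_rfl hB hg
  refine h1.unique hut ?_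
  rw [monomialFunctional_shift]
  -- On `[u,t]` the integrand is expanded by `ĥ_{s,r} = ĥ_{u,r} + ĥ_{s,u}` and the integrator by
  -- Chen's relation; the constant `A.iter i j s u` contributes nothing.
  have h2 : ∀ q ∈ Finset.range (p + 1), HasRSIntegral
      (fun r => ((p.choose q : ℝ) * (h.vol H u - h.vol H s) ^ (p - q)) *
        (h.vol H r - h.vol H u) ^ q)
      (fun r => (∑ l ∈ Finset.range (j + 1), ((j.choose l : ℝ) * (A.vol u - A.vol s) ^ (j - l)) *
        A.iter i l u r) + A.iter i j s u) u t
      (((p.choose q : ℝ) * (h.vol H u - h.vol H s) ^ (p - q)) *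
        ∑ l ∈ Finset.range (j + 1), ((j.choose l : ℝ) * (A.vol u - A.vol s) ^ (j - l)) *
          rsIntegral (fun r => (h.vol H r - h.vol H u) ^ q) (fun r => A.iter i l u r) u t) := by
    intro q _
    refine HasRSIntegral.const_mul_left _ ?_
    have h3 := (HasRSIntegral.sum_right (Finset.range (j + 1)) (fun l hl =>
      (hA.hasRSIntegral_iter hp h i q ((Nat.le_of_lt_succ (Finset.mem_range.1 hl)).trans hj)
        (hs.trans hsu) hut ht).const_mul_right
          ((j.choose l : ℝ) * (A.vol u - A.vol s) ^ (j - l)))).add_right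
      (hasRSIntegral_const_right _ (A.iter i j s u) u t)
    rwa [add_zero] at h3
  refine (HasRSIntegral.sum_left _ h2).congr (fun r _ _ => ?_) (fun r hr hrt => ?_)
  · rw [← sub_add_sub_cancel (h.vol H r) (h.vol H u), add_pow]
    exact Finset.sum_congr rfl fun q _ => by ring
  · rw [hA.chen i j s u r hj hs hsu hr (hrt.trans ht), add_comm]

theorem continuousOn_drift (hA : IsRVModel H κ A) (hp : Admissible H κ) (h : CMSpace) (s : ℝ)
    (m : ℕ) : ContinuousOn
      (fun r => ((A.vol r - A.vol s) + (h.vol H r - h.vol H s)) ^ m) (Icc 0 1) :=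
  (((hA.continuousOn_vol hp).sub continuousOn_const).add
    ((hp.continuousOn_vol h).sub continuousOn_const)).pow m

theorem integral_drift_sub (hA : IsRVModel H κ A) (hp : Admissible H κ) (h : CMSpace) (i : Fin 2)
    (m : ℕ) {s u t : ℝ} (hs : 0 ≤ s) (hsu : s ≤ u) (hut : u ≤ t) (ht : t ≤ 1) :
    (∫ r in s..t, ((A.vol r - A.vol s) + (h.vol H r - h.vol H s)) ^ m * h i r) -
      ∫ r in s..u, ((A.vol r - A.vol s) + (h.vol H r - h.vol H s)) ^ m * h i r =
    ∑ n ∈ Finset.range (m + 1), (m.choose n : ℝ) *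
      ((A.vol u - A.vol s) + (h.vol H u - h.vol H s)) ^ (m - n) *
      ∫ r in u..t, ((A.vol r - A.vol u) + (h.vol H r - h.vol H u)) ^ n * h i r := by
  have hu := hs.trans hsu
  rw [sub_eq_iff_eq_add', ← intervalIntegral.integral_add_adjacent_intervals
    (h.intervalIntegrable_mul i (hA.continuousOn_drift hp h s m) hs hsu (hut.trans ht))
    (h.intervalIntegrable_mul i (hA.continuousOn_drift hp h s m) hu hut ht)]
  congr 1
  simp only [← intervalIntegral.integral_const_mul]
  rw [← intervalIntegral.integral_finsetSum fun n _ =>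
    (h.intervalIntegrable_mul i (hA.continuousOn_drift hp h u n) hu hut ht).const_mul _]
  congr 1
  ext r
  have : (A.vol r - A.vol s) + (h.vol H r - h.vol H s) =
    ((A.vol r - A.vol u) + (h.vol H r - h.vol H u)) +
      ((A.vol u - A.vol s) + (h.vol H u - h.vol H s)) := by ring
  rw [this, add_pow, Finset.sum_mul]
  exact Finset.sum_congr rfl fun n _ => by ring

/-- The drift part and the Young part satisfy the relation separately: the former by the binomial
theorem under the integral, the latter by rebasing and the polynomial identity. -/
theorem translate_chen (hA : IsRVModel H κ A) (hp : Admissible H κ) (h : CMSpace) (i : Fin 2)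
    (m : ℕ) (s u t : ℝ) (hm : m ≤ order H) (hs : 0 ≤ s) (hsu : s ≤ u) (hut : u ≤ t) (ht : t ≤ 1) :
    (translate H h A).iter i m s t = (translate H h A).iter i m s u +
      ∑ j ∈ Finset.range (m + 1), (m.choose j : ℝ) *
        ((translate H h A).vol u - (translate H h A).vol s) ^ (m - j) *
        (translate H h A).iter i j u t := by
  have hu := hs.trans hsu
  have hu1 := hut.trans ht
  have hX : (translate H h A).vol u - (translate H h A).vol s =
      (A.vol u - A.vol s) + (h.vol H u - h.vol H s) := by
    rw [translate_vol H h A hu hu1, translate_vol H h A hs (hsu.trans hu1)]; ring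
  rw [← sub_eq_iff_eq_add', hX, translate_iter H h A i hm hs (hsu.trans hut) ht,
    translate_iter H h A i hm hs hsu hu1, add_sub_add_comm, ← Finset.sum_sub_distrib,
    hA.integral_drift_sub hp h i m hs hsu hut ht]
  have e : ∀ n ∈ Finset.range (m + 1), (m.choose n : ℝ) *
      ((A.vol u - A.vol s) + (h.vol H u - h.vol H s)) ^ (m - n) * (translate H h A).iter i n u t =
      (m.choose n : ℝ) * ((A.vol u - A.vol s) + (h.vol H u - h.vol H s)) ^ (m - n) *
        (∑ j ∈ Finset.range (n + 1), (n.choose j : ℝ) *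
          rsIntegral (fun r => (h.vol H r - h.vol H u) ^ (n - j)) (fun r => A.iter i j u r) u t) +
      (m.choose n : ℝ) * ((A.vol u - A.vol s) + (h.vol H u - h.vol H s)) ^ (m - n) *
        ∫ r in u..t, ((A.vol r - A.vol u) + (h.vol H r - h.vol H u)) ^ n * h i r := by
    intro n hn
    rw [translate_iter H h A i ((Nat.le_of_lt_succ (Finset.mem_range.1 hn)).trans hm) hu hut ht,
      mul_add]
  rw [Finset.sum_congr rfl e, Finset.sum_add_distrib]
  congr 1
  rw [← sum_monomialFunctional_shift (fun q l => rsIntegral (fun r => (h.vol H r - h.vol H u) ^ q)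
          (fun r => A.iter i l u r) u t)]
  refine Finset.sum_congr rfl fun j hj => ?_
  rw [← mul_sub, hA.rsIntegral_iter_sub hp h i (m - j)
    ((Nat.le_of_lt_succ (Finset.mem_range.1 hj)).trans hm) hs hsu hut ht]

/-- The translate of `∫ (Ŵ+ĥ)^j d(W+h)` back by `-ĥ`. -/
theorem hasRSIntegral_translate_iter (hA : IsRVModel H κ A) (hp : Admissible H κ) (h : CMSpace)
    (i : Fin 2) (q : ℕ) {j : ℕ} (hj : j ≤ order H) {s t : ℝ} (hs : 0 ≤ s) (hst : s ≤ t)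
    (ht : t ≤ 1) :
    HasRSIntegral (fun r => ((-h).vol H r - (-h).vol H s) ^ q)
      (fun r => (translate H h A).iter i j s r) s t
      ((-1) ^ q * ((∑ l ∈ Finset.range (j + 1), (j.choose l : ℝ) *
        rsIntegral (fun r => (h.vol H r - h.vol H s) ^ (q + (j - l)))
          (fun r => A.iter i l s r) s t) +
        ∫ r in s..t, (h.vol H r - h.vol H s) ^ q *
          ((A.vol r - A.vol s) + (h.vol H r - h.vol H s)) ^ j * h i r)) := by
  have h1 : ∀ l ∈ Finset.range (j + 1), HasRSIntegral (fun r => (h.vol H r - h.vol H s) ^ q)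
      (fun r => (j.choose l : ℝ) * rsIntegral (fun r => (h.vol H r - h.vol H s) ^ (j - l))
        (fun r => A.iter i l s r) s r) s t
      ((j.choose l : ℝ) * rsIntegral (fun r => (h.vol H r - h.vol H s) ^ (q + (j - l)))
          (fun r => A.iter i l s r) s t) := fun l hl => by
    obtain ⟨B, hB, hg⟩ := hA.exists_iter_holder hp i
      ((Nat.le_of_lt_succ (Finset.mem_range.1 hl)).trans hj) hs
    exact (hp.hasRSIntegral_vol_pow_assoc h (j - l) q hs hst ht hB
      fun u v hu huv hv => hg u v hu huv (hv.trans ht)).const_mul_right _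
  refine (((HasRSIntegral.sum_right _ h1).add_right (hp.hasRSIntegral_vol_pow_integral h h i q
    (hA.continuousOn_drift hp h s j) hs hst ht)).const_mul_left ((-1) ^ q)).congr
    (fun r hr hrt => ?_) (fun r hr hrt => ?_)
  · rw [h.vol_neg H (hs.trans hr) (hrt.trans ht), h.vol_neg H hs (hst.trans ht), ← mul_pow]
    congr 1; ring
  · exact translate_iter H h A i hj hs hr (hrt.trans ht)

/-- The Young parts collapse to the original component by `sum_sum_neg_one_pow`. The drifts cancel
because `∑ (m choose j) (-ĥ)^(m-j) (Ŵ+ĥ)^j = Ŵ^m`, while the translation by `-h` contributes `-∫ Ŵ^m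
ḣ`. -/
theorem translate_neg_translate (hA : IsRVModel H κ A) (hp : Admissible H κ) (h : CMSpace) :
    translate H (-h) (translate H h A) = A := by
  ext i
  · rename_i t
    by_cases ht : 0 ≤ t ∧ t ≤ 1
    · rw [translate_noise _ _ _ _ ht.1 ht.2, translate_noise _ _ _ _ ht.1 ht.2,
        h.path_neg i ht.1 ht.2, add_neg_cancel_right]
    · rw [hA.noise_support i t ht]
      exact if_neg ht
  · by_cases ht : 0 ≤ i ∧ i ≤ 1
    · rw [translate_vol _ _ _ ht.1 ht.2, translate_vol _ _ _ ht.1 ht.2, h.vol_neg H ht.1 ht.2,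
        add_neg_cancel_right]
    · rw [hA.vol_support i ht]
      exact if_neg ht
  · rename_i m s t
    by_cases hmst : m ≤ order H ∧ 0 ≤ s ∧ s ≤ t ∧ t ≤ 1
    swap
    · rw [hA.iter_support i m s t hmst]
      exact if_neg hmst
    obtain ⟨hm, hs, hst, ht⟩ := hmst
    rw [translate_iter _ _ _ _ hm hs hst ht]
    have hX : ∀ r ∈ Icc s t,
        ((translate H h A).vol r - (translate H h A).vol s) + ((-h).vol H r - (-h).vol H s) =
          A.vol r - A.vol s := fun r hr => by
      have hr0 := hs.trans hr.1
      have hr1 := hr.2.trans ht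
      rw [translate_vol _ _ _ hr0 hr1, translate_vol _ _ _ hs (hst.trans ht), h.vol_neg H hr0 hr1,
        h.vol_neg H hs (hst.trans ht)]
      ring
    have e1 : ∫ r in s..t, (((translate H h A).vol r - (translate H h A).vol s) +
        ((-h).vol H r - (-h).vol H s)) ^ m * (-h) i r =
        -∫ r in s..t, (A.vol r - A.vol s) ^ m * h i r := by
      rw [← h.integral_mul_neg i _ hs hst ht]
      refine intervalIntegral.integral_congr fun r hr => ?_
      rw [uIcc_of_le hst] at hr
      simp only [hX r hr]
    have e2 : ∀ j ∈ Finset.range (m + 1), (m.choose j : ℝ) *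
        rsIntegral (fun r => ((-h).vol H r - (-h).vol H s) ^ (m - j))
          (fun r => (translate H h A).iter i j s r) s t =
        (m.choose j : ℝ) * ((-1) ^ (m - j) * ∑ l ∈ Finset.range (j + 1), (j.choose l : ℝ) *
          rsIntegral (fun r => (h.vol H r - h.vol H s) ^ ((m - j) + (j - l)))
            (fun r => A.iter i l s r) s t) +
        ∫ r in s..t, ((m.choose j : ℝ) * ((-1) ^ (m - j) * ((h.vol H r - h.vol H s) ^ (m - j) *
          ((A.vol r - A.vol s) + (h.vol H r - h.vol H s)) ^ j))) * h i r := fun j hj => by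
      have hj := Nat.le_of_lt_succ (Finset.mem_range.1 hj)
      rw [(hA.hasRSIntegral_translate_iter hp h i (m - j) (hj.trans hm) hs hst
        ht).rsIntegral_eq hst, mul_add, mul_add]
      congr 1
      rw [← intervalIntegral.integral_const_mul, ← intervalIntegral.integral_const_mul]
      congr 1; ext r; ring
    have hc : ∀ j, ContinuousOn (fun r => (m.choose j : ℝ) * ((-1) ^ (m - j) *
        ((h.vol H r - h.vol H s) ^ (m - j) *
          ((A.vol r - A.vol s) + (h.vol H r - h.vol H s)) ^ j))) (Icc 0 1) := fun j =>
      continuousOn_const.mul (continuousOn_const.mul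
        ((((hp.continuousOn_vol h).sub continuousOn_const).pow _).mul
          (hA.continuousOn_drift hp h s j)))
    rw [e1, Finset.sum_congr rfl e2, Finset.sum_add_distrib,
      sum_sum_neg_one_pow (fun q l => rsIntegral (fun r => (h.vol H r - h.vol H s) ^ q)
          (fun r => A.iter i l s r) s t),
      ← intervalIntegral.integral_finsetSum fun j _ => h.intervalIntegrable_mul i (hc j) hs hst ht]
    have e3 : ∀ r, ∑ j ∈ Finset.range (m + 1), ((m.choose j : ℝ) * ((-1) ^ (m - j) *
        ((h.vol H r - h.vol H s) ^ (m - j) *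
          ((A.vol r - A.vol s) + (h.vol H r - h.vol H s)) ^ j))) * h i r =
        (A.vol r - A.vol s) ^ m * h i r := fun r => by
      rw [← add_neg_cancel_right (A.vol r - A.vol s) (h.vol H r - h.vol H s), add_pow,
        Finset.sum_mul, add_neg_cancel_right]
      refine Finset.sum_congr rfl fun j _ => ?_
      rw [neg_pow (h.vol H r - h.vol H s)]
      ring
    simp only [e3, pow_zero]
    rw [(hasRSIntegral_one _ s t).rsIntegral_eq hst, hA.iter_self i m hs (hst.trans ht)]
    ring

theorem zero : IsRVModel H κ ⟨fun _ _ => 0, fun _ => 0, fun _ _ _ _ => 0⟩ where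
  noise_zero _ := rfl
  vol_eq _ _ _ := by simp
  iter_zero _ _ _ _ _ _ := by simp
  chen _ _ _ _ _ _ _ _ _ _ := by simp
  bound := by simp [modelNorm, holderNorm]
  noise_support _ _ _ := rfl
  vol_support _ _ := rfl
  iter_support _ _ _ _ _ := rfl

end IsRVModel

/-- With the zero model as base point, comparison with the lift becomes comparison of two
translates. -/
theorem translate_zero (H : ℝ) (h : CMSpace) :
    translate H h ⟨fun _ _ => 0, fun _ => 0, fun _ _ _ _ => 0⟩ = lift H h := by
  ext i
  · simp [translate, lift]
  · simp [translate, lift]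
  · rename_i m s t
    unfold translate lift
    simp only
    split_ifs with hc
    · rw [Finset.sum_eq_zero]
      · simp
      · intro j _
        rw [(hasRSIntegral_const_right _ 0 s t).rsIntegral_eq hc.2.2.1, mul_zero]
    · rfl

/-! ### Estimates for translations -/

theorem HolderBound.mono {H κ c c' : ℝ} {e e' : ℕ → ℝ} {A : ModelData} (h : HolderBound H κ c e A)
    (hc : c ≤ c') (he : ∀ m ≤ order H, e m ≤ e' m) : HolderBound H κ c' e' A := by
  refine ⟨fun s t hs hst ht => (h.vol s t hs hst ht).trans ?_,
    fun i m s t hm hs hst ht => (h.iter i m s t hm hs hst ht).trans ?_⟩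
  · exact mul_le_mul_of_nonneg_right hc (Real.rpow_nonneg (sub_nonneg.2 hst.le) _)
  · exact mul_le_mul_of_nonneg_right (he m hm) (Real.rpow_nonneg (sub_nonneg.2 hst.le) _)

namespace Admissible

variable {H κ : ℝ}

theorem abs_sum_rsIntegral_le (hp : Admissible H κ) (h : CMSpace) {m : ℕ} {s t : ℝ} (hs : 0 ≤ s)
    (hst : s ≤ t) (ht : t ≤ 1) {g : ℕ → ℝ → ℝ} {b : ℕ → ℝ} (hb : ∀ j, 0 ≤ b j)
    (hg : ∀ j ≤ m, ∀ u v, s ≤ u → u ≤ v → v ≤ t →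
      |g j v - g j u| ≤ b j * ((t - s) ^ (H - κ)) ^ j * (v - u) ^ (1 / 2 - κ)) :
    |∑ j ∈ Finset.range (m + 1), (m.choose j : ℝ) *
        rsIntegral (fun r => (h.vol H r - h.vol H s) ^ (m - j)) (g j) s t| ≤
      (∑ j ∈ Finset.range (m + 1), (m.choose j : ℝ) *
        (volPowConst H κ (m - j) * (2 / κ * ‖h‖) ^ (m - j) * b j)) *
          (t - s) ^ (m * (H - κ) + 1 / 2 - κ) := by
  have hT : 0 ≤ (t - s) ^ (H - κ) := Real.rpow_nonneg (sub_nonneg.2 hst) _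
  refine (Finset.abs_sum_le_sum_abs _ _).trans ?_
  rw [Finset.sum_mul]
  refine Finset.sum_le_sum fun j hj => ?_
  have hj := Nat.le_of_lt_succ (Finset.mem_range.1 hj)
  have h1 := hp.abs_rsIntegral_vol_pow_le h (m - j) hs hst ht
    (mul_nonneg (hb j) (pow_nonneg hT j)) (hg j hj)
  rw [abs_mul, Nat.abs_cast, mul_assoc]
  refine mul_le_mul_of_nonneg_left (h1.trans_eq ?_) (Nat.cast_nonneg _)
  rw [hp.rpow_level m (sub_nonneg.2 hst)]
  calc _ = volPowConst H κ (m - j) * (2 / κ * ‖h‖) ^ (m - j) * b j *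
        (((t - s) ^ (H - κ)) ^ (m - j + j) * (t - s) ^ (1 / 2 - κ)) := by rw [pow_add]; ring
    _ = _ := by rw [Nat.sub_add_cancel hj]

theorem abs_integral_drift_le (hp : Admissible H κ) (h : CMSpace) (i : Fin 2) {m : ℕ} {F : ℝ → ℝ}
    {K s t : ℝ} (hs : 0 ≤ s) (hst : s ≤ t) (ht : t ≤ 1) (hK : 0 ≤ K)
    (hF : ∀ r ∈ Ioo s t, |F r| ≤ K * ((t - s) ^ (H - κ)) ^ m) :
    |∫ r in s..t, F r * h i r| ≤ K * ‖h‖ * (t - s) ^ (m * (H - κ) + 1 / 2 - κ) := by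
  have hd := sub_nonneg.2 hst
  have hT : 0 ≤ (t - s) ^ (H - κ) := Real.rpow_nonneg hd _
  refine (h.abs_integral_mul_le i hs hst ht hF (by positivity)).trans ?_
  rw [hp.rpow_level m hd]
  have h2 : (t - s) ^ (1 / 2 : ℝ) ≤ (t - s) ^ (1 / 2 - κ) :=
    Real.rpow_le_rpow_of_exponent_ge' hd (by linarith) hp.noise_pos.le (by linarith [hp.pos])
  calc _ ≤ K * ((t - s) ^ (H - κ)) ^ m * (t - s) ^ (1 / 2 - κ) * ‖h‖ := by gcongr
    _ = _ := by ring

end Admissible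

namespace IsRVModel

variable {H κ : ℝ} {A B : ModelData}

/-- The constants are kept explicit to preserve homogeneity: if `e m = c^(m+1)`, every term at level
`m` has degree `m+1` in `(c, ‖h‖)`. -/
theorem translate_holderBound (hA : IsRVModel H κ A) (hp : Admissible H κ) (h : CMSpace) {c : ℝ}
    {e : ℕ → ℝ} (hc : 0 ≤ c) (he : ∀ m, 0 ≤ e m) (hb : HolderBound H κ c e A) :
    HolderBound H κ (c + 2 / κ * ‖h‖) (fun m =>
      (∑ j ∈ Finset.range (m + 1), (m.choose j : ℝ) *
        (volPowConst H κ (m - j) * (2 / κ * ‖h‖) ^ (m - j) *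
          ∑ l ∈ Finset.range (j + 1), (j.choose l : ℝ) * (c ^ (j - l) * e l))) +
      (c + 2 / κ * ‖h‖) ^ m * ‖h‖) (translate H h A) := by
  have hκ := hp.pos
  have hX : ∀ s r t, 0 ≤ s → s < r → r ≤ t → t ≤ 1 →
      |(A.vol r - A.vol s) + (h.vol H r - h.vol H s)| ≤
        (c + 2 / κ * ‖h‖) * (t - s) ^ (H - κ) := by
    intro s r t hs hsr hrt ht
    have h1 := hb.vol s r hs hsr (hrt.trans ht)
    have h2 := hp.abs_vol_sub_le_of_le h hs hsr.le hrt ht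
    have h3 := Real.rpow_le_rpow (sub_nonneg.2 hsr.le) (sub_le_sub_right hrt s) hp.holder_pos.le
    have h4 := mul_le_mul_of_nonneg_left h3 hc
    refine (abs_add_le _ _).trans ?_
    rw [add_mul]
    linarith
  refine ⟨fun s t hs hst ht => ?_, fun i m s t hm hs hst ht => ?_⟩
  · rw [translate_vol H h A (hs.trans hst.le) ht, translate_vol H h A hs (hst.le.trans ht),
      add_sub_add_comm]
    exact hX s t t hs hst le_rfl ht
  · rw [translate_iter H h A i hm hs hst.le ht, add_mul]
    refine (abs_add_le _ _).trans (add_le_add ?_ ?_)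
    · exact hp.abs_sum_rsIntegral_le h hs hst.le ht
        (fun j => Finset.sum_nonneg fun l _ => by have := he l; positivity)
        (fun j hj u v hu huv hv => hA.abs_iter_sub_le hp hc he hb i (hj.trans hm) hs hu huv hv ht)
    · refine hp.abs_integral_drift_le h i hs hst.le ht (by positivity) fun r hr => ?_
      rw [abs_pow, ← mul_pow]
      exact pow_le_pow_left₀ (abs_nonneg _) (hX s r t hs hr.1 hr.2.le ht) _

theorem translate (hA : IsRVModel H κ A) (hp : Admissible H κ) (h : CMSpace) :
    IsRVModel H κ (translate H h A) where
  noise_zero i := by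
    rw [translate_noise H h A i le_rfl zero_le_one, hA.noise_zero, h.path_zero_right, add_zero]
  vol_eq t ht ht' := by
    have hH : 0 < H := by linarith [hp.pos, hp.two_mul_lt]
    have hsub : uIcc 0 t ⊆ Icc (0 : ℝ) 1 := by rw [uIcc_of_le ht]; exact Icc_subset_Icc_right ht'
    have e1 : ∫ s in (0 : ℝ)..t, (RoughVol.translate H h A).vol s =
        ∫ s in (0 : ℝ)..t, (A.vol s + h.vol H s) :=
      intervalIntegral.integral_congr fun s hs => translate_vol H h A (hsub hs).1 (hsub hs).2
    have e2 : ∫ s in (0 : ℝ)..t, kernel H s t * (RoughVol.translate H h A).noise 0 s =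
        ∫ s in (0 : ℝ)..t, (kernel H s t * A.noise 0 s + kernel H s t * h.path 0 s) :=
      intervalIntegral.integral_congr fun s hs => by
        simp only [translate_noise H h A 0 (hsub hs).1 (hsub hs).2, mul_add]
    have hk := intervalIntegrable_kernel (t := t) hH ht
    have hpath : ContinuousOn (h.path 0) (Icc 0 1) :=
      continuousOn_of_holder (a := 1 / 2) (c := ‖h‖) (by norm_num) fun u v hu huv hv => by
        rw [h.path_sub 0 hu huv.le hv, mul_comm]
        simpa using h.abs_integral_mul_le 0 (F := fun _ => 1) (K := 1) hu huv.le hv (by simp)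
          zero_le_one
    rw [e1, e2, intervalIntegral.integral_add
      ((hA.continuousOn_vol hp).mono hsub).intervalIntegrable
      ((hp.continuousOn_vol h).mono hsub).intervalIntegrable,
      intervalIntegral.integral_add
      (hk.mul_continuousOn ((hA.continuousOn_noise hp 0).mono hsub))
      (hk.mul_continuousOn (hpath.mono hsub)), hA.vol_eq t ht ht', h.integral_vol hH ht ht']
  iter_zero i s t hs hst ht := by
    have ht0 := hs.trans hst
    have hs1 := hst.trans ht
    rw [translate_iter H h A i (Nat.zero_le _) hs hst ht, translate_noise H h A i ht0 ht,
      translate_noise H h A i hs hs1]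
    simp only [zero_add, Finset.range_one, Finset.sum_singleton, Nat.choose_self, Nat.cast_one,
      one_mul, Nat.sub_self, pow_zero]
    rw [(hasRSIntegral_one _ s t).rsIntegral_eq hst, hA.iter_self i 0 hs hs1, sub_zero,
      hA.iter_zero i s t hs hst ht, ← h.path_sub i hs hst ht]
    ring
  chen := hA.translate_chen hp h
  bound := by
    obtain ⟨N, hN, hb⟩ := hA.exists_holderBound
    have hκ := hp.pos
    refine ((hA.translate_holderBound hp h hN (fun _ => hN) hb).modelNorm_le (by positivity)
      fun m => ?_).trans_lt ENNReal.ofReal_lt_top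
    refine add_nonneg (Finset.sum_nonneg fun j _ => ?_) (by positivity)
    have := hp.volPowConst_nonneg (m - j)
    positivity
  noise_support i t ht := if_neg ht
  vol_support t ht := if_neg ht
  iter_support i m s t h := if_neg h

theorem homNorm_lt_top (hA : IsRVModel H κ A) : homNorm H κ A < ∞ := by
  obtain ⟨N, hN, hb⟩ := hA.exists_holderBound
  refine (hb.homNorm_le (d := 1 + N) hN (by positivity) fun m _ => ?_).trans_lt
    ENNReal.ofReal_lt_top
  have : (1 + N) ^ 1 ≤ (1 + N) ^ (m + 1) := pow_le_pow_right₀ (by linarith) (by omega)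
  linarith

end IsRVModel

theorem Admissible.exists_homNorm_translate_le {H κ : ℝ} (hp : Admissible H κ) :
    ∃ C : ℝ≥0, ∀ (h : CMSpace) (A : ModelData), IsRVModel H κ A →
      homNorm H κ (translate H h A) ≤ C * (homNorm H κ A + ENNReal.ofReal ‖h‖) := by
  have hκ := hp.pos
  have hV := fun p => hp.volPowConst_nonneg p
  set a : ℝ := 2 / κ with ha
  have ha1 : 1 ≤ a := by
    rw [ha, le_div_iff₀ hκ]; linarith [hp.two_mul_lt, hp.le_half]
  set D : ℕ → ℝ := fun m => (∑ j ∈ Finset.range (m + 1), (m.choose j : ℝ) *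
    (volPowConst H κ (m - j) * a ^ m * 2 ^ j)) + a ^ m with hD
  have hD0 : ∀ m, 0 ≤ D m := fun m =>
    add_nonneg (Finset.sum_nonneg fun j _ => by have := hV (m - j); positivity) (by positivity)
  -- `E ≥ 1` is needed to pass from `D m ≤ E` to `E^(m+1)`, as the root `1/(m+1)` requires.
  set E : ℝ := 1 + ∑ m ∈ Finset.range (order H + 1), D m with hE
  have hE1 : 1 ≤ E := le_add_of_nonneg_right (Finset.sum_nonneg fun m _ => hD0 m)
  refine ⟨(a + 2 * (order H + 1) * E).toNNReal, fun h A hA => ?_⟩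
  set N := (homNorm H κ A).toReal with hN
  have hN0 : 0 ≤ N := ENNReal.toReal_nonneg
  have hNe : ENNReal.ofReal N = homNorm H κ A := ENNReal.ofReal_toReal hA.homNorm_lt_top.ne
  have hb := hA.translate_holderBound hp h hN0 (fun m => pow_nonneg hN0 (m + 1))
    (holderBound_of_homNorm_le hN0 hNe.ge)
  set x := N + ‖h‖ with hx
  have hx0 : 0 ≤ x := by positivity
  have hhx : ‖h‖ ≤ x := by linarith
  have hNx : N ≤ x := by linarith [norm_nonneg h]
  have hcx : N + 2 / κ * ‖h‖ ≤ a * x := by rw [← ha, hx]; nlinarith [norm_nonneg h]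
  have h1 := hb.homNorm_le (d := E * x) (by positivity) (by positivity) (fun m hm => by
    have hDE : D m ≤ E := by
      have := Finset.single_le_sum (f := D) (fun m _ => hD0 m)
        (Finset.mem_range.2 (Nat.lt_succ_of_le hm))
      linarith
    have hEE : E ≤ E ^ (m + 1) := le_self_pow₀ hE1 (by omega)
    rw [mul_pow]
    calc _ ≤ D m * x ^ (m + 1) := by
          rw [hD, add_mul, Finset.sum_mul]
          refine add_le_add (Finset.sum_le_sum fun j hj => ?_) ?_
          · have hj := Nat.le_of_lt_succ (Finset.mem_range.1 hj)
            -- Degree count: `N^(j-l) N^(l+1) = N^(j+1)`, which together with `‖h‖^(m-j)` gives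
            -- degree `m+1`.
            have hs : ∑ l ∈ Finset.range (j + 1), (j.choose l : ℝ) * (N ^ (j - l) * N ^ (l + 1)) =
                2 ^ j * N ^ (j + 1) := by
              have : ((2 : ℝ)) ^ j = ∑ l ∈ Finset.range (j + 1), (j.choose l : ℝ) := by
                exact_mod_cast (Nat.sum_range_choose j).symm
              rw [this, Finset.sum_mul]
              refine Finset.sum_congr rfl fun l hl => ?_
              have hl := Nat.le_of_lt_succ (Finset.mem_range.1 hl)
              rw [← pow_add, ← add_assoc, Nat.sub_add_cancel hl]
            rw [hs]
            have e1 : (2 / κ * ‖h‖) ^ (m - j) ≤ a ^ m * x ^ (m - j) := by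
              rw [← ha, mul_pow]
              have : a ^ (m - j) ≤ a ^ m := pow_le_pow_right₀ ha1 (Nat.sub_le _ _)
              gcongr
            have e2 : N ^ (j + 1) ≤ x ^ (j + 1) := by gcongr
            have := hV (m - j)
            calc _ ≤ (m.choose j : ℝ) * (volPowConst H κ (m - j) * (a ^ m * x ^ (m - j)) *
                  (2 ^ j * x ^ (j + 1))) := by gcongr
              _ = (m.choose j : ℝ) * (volPowConst H κ (m - j) * a ^ m * 2 ^ j) *
                  x ^ (m - j + j + 1) := by rw [add_assoc (m - j), pow_add x (m - j)]; ring
              _ = _ := by rw [Nat.sub_add_cancel hj]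
          · calc _ ≤ (a * x) ^ m * x := by gcongr
              _ = _ := by rw [mul_pow, pow_succ, mul_assoc]
      _ ≤ _ := by gcongr; exact hDE.trans hEE)
  refine h1.trans ?_
  rw [← hNe, ← ENNReal.ofReal_add hN0 (norm_nonneg h), ← ENNReal.ofReal.eq_1,
    ← ENNReal.ofReal_mul (by positivity)]
  refine ENNReal.ofReal_le_ofReal ?_
  linarith

/-- The translation by a fixed path is locally Lipschitz, with polynomial growth of the constants
that is compatible with the homogeneous norm. -/
theorem Admissible.exists_translate_sub_bound {H κ : ℝ} (hp : Admissible H κ) (h : CMSpace)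
    {B : ModelData} (hB : IsRVModel H κ B) :
    ∃ D : ℝ, 1 ≤ D ∧ ∀ (A : ModelData) (δ : ℝ), IsRVModel H κ A → 0 ≤ δ →
      HolderBound H κ δ (fun m => δ * (1 + δ) ^ m) (A - B) →
      HolderBound H κ δ (fun m => D * (δ * (1 + δ) ^ m)) (translate H h A - translate H h B) := by
  have hκ := hp.pos
  have hV := fun p => hp.volPowConst_nonneg p
  obtain ⟨N, hN, hbN⟩ := hB.exists_holderBound
  set K : ℝ := 1 + N with hK
  have hK1 : 1 ≤ K := by linarith
  have hb : HolderBound H κ K (fun _ => K) B := hbN.mono (by linarith) fun _ _ => by linarith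
  set L : ℝ := 2 / κ * ‖h‖ with hL
  set D : ℕ → ℝ := fun m => (∑ j ∈ Finset.range (m + 1), (m.choose j : ℝ) *
    (volPowConst H κ (m - j) * L ^ (m - j) * (2 ^ j * ((j + 1) * K ^ (j + 1))))) +
      m * (K + L) ^ (m - 1) * ‖h‖ with hD
  have hD0 : ∀ m, 0 ≤ D m := fun m =>
    add_nonneg (Finset.sum_nonneg fun j _ => by have := hV (m - j); positivity) (by positivity)
  refine ⟨1 + ∑ m ∈ Finset.range (order H + 1), D m,
    le_add_of_nonneg_right (Finset.sum_nonneg fun m _ => hD0 m), fun A δ hA hδ hd => ?_⟩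
  have hδ1 : 1 ≤ 1 + δ := by linarith
  suffices hs : HolderBound H κ δ (fun m => D m * (δ * (1 + δ) ^ m))
      (translate H h A - translate H h B) from hs.mono le_rfl fun m hm => by
    have := Finset.single_le_sum (f := D) (fun m _ => hD0 m)
      (Finset.mem_range.2 (Nat.lt_succ_of_le hm))
    exact mul_le_mul_of_nonneg_right (by linarith) (by positivity)
  refine ⟨fun s t hs hst ht => ?_, fun i m s t hm hs hst ht => ?_⟩
  · change |((translate H h A).vol t - (translate H h B).vol t) -
      ((translate H h A).vol s - (translate H h B).vol s)| ≤ _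
    have ht0 := hs.trans hst.le
    have hs1 := hst.le.trans ht
    rw [translate_vol H h A ht0 ht, translate_vol H h A hs hs1, translate_vol H h B ht0 ht,
      translate_vol H h B hs hs1, add_sub_add_right_eq_sub, add_sub_add_right_eq_sub]
    exact hd.vol s t hs hst ht
  · have hT : 0 ≤ (t - s) ^ (H - κ) := Real.rpow_nonneg (sub_nonneg.2 hst.le) _
    change |(translate H h A).iter i m s t - (translate H h B).iter i m s t| ≤ _
    rw [translate_iter H h A i hm hs hst.le ht, translate_iter H h B i hm hs hst.le ht,
      add_sub_add_comm, ← Finset.sum_sub_distrib, ← intervalIntegral.integral_sub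
      (h.intervalIntegrable_mul i (hA.continuousOn_drift hp h s m) hs hst.le ht)
      (h.intervalIntegrable_mul i (hB.continuousOn_drift hp h s m) hs hst.le ht)]
    -- Young integrals are linear in the integrator, although `A - B` is not a model.
    have e1 : ∀ j ∈ Finset.range (m + 1),
        (m.choose j : ℝ) * rsIntegral (fun r => (h.vol H r - h.vol H s) ^ (m - j))
          (fun r => A.iter i j s r) s t -
        (m.choose j : ℝ) * rsIntegral (fun r => (h.vol H r - h.vol H s) ^ (m - j))
          (fun r => B.iter i j s r) s t =
        (m.choose j : ℝ) * rsIntegral (fun r => (h.vol H r - h.vol H s) ^ (m - j))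
          (fun r => (A - B).iter i j s r) s t := fun j hj => by
      have hj := (Nat.le_of_lt_succ (Finset.mem_range.1 hj)).trans hm
      have h1 := (hA.hasRSIntegral_iter hp h i (m - j) hj hs hst.le ht).add_right
        ((hB.hasRSIntegral_iter hp h i (m - j) hj hs hst.le ht).const_mul_right (-1))
      have h2 := (h1.congr (g' := fun r => (A - B).iter i j s r) (fun _ _ _ => rfl)
        fun r _ _ => show A.iter i j s r - B.iter i j s r = _ by ring).rsIntegral_eq hst.le
      rw [h2]
      ring
    rw [Finset.sum_congr rfl e1]
    simp only [← sub_mul]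
    rw [hD]
    simp only
    have h1 := hp.abs_sum_rsIntegral_le h (m := m) hs hst.le ht
      (g := fun j r => (A - B).iter i j s r)
      (b := fun j => 2 ^ j * ((j + 1) * K ^ (j + 1)) * (δ * (1 + δ) ^ j))
      (fun j => by positivity) (fun j hj u v hu huv hv =>
        hA.abs_iter_sub_sub_le hB hp hK1 hδ hb hd i (hj.trans hm) hs hu huv hv ht)
    have h2 := hp.abs_integral_drift_le h i (m := m)
      (K := m * (K + L) ^ (m - 1) * (δ * (1 + δ) ^ m))
      (F := fun r => ((A.vol r - A.vol s) + (h.vol H r - h.vol H s)) ^ m -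
        ((B.vol r - B.vol s) + (h.vol H r - h.vol H s)) ^ m) hs hst.le ht (by positivity)
      (fun r hr => by
        have hr1 := hr.2.le.trans ht
        have hrT : (r - s) ^ (H - κ) ≤ (t - s) ^ (H - κ) := Real.rpow_le_rpow
          (sub_nonneg.2 hr.1.le) (sub_le_sub_right hr.2.le s) hp.holder_pos.le
        have b1 : |B.vol r - B.vol s| ≤ K * (t - s) ^ (H - κ) :=
          (hb.vol s r hs hr.1 hr1).trans (by gcongr)
        have b2 : |(A.vol r - A.vol s) - (B.vol r - B.vol s)| ≤ δ * (t - s) ^ (H - κ) := by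
          have e : (A.vol r - A.vol s) - (B.vol r - B.vol s) =
              (A - B).vol r - (A - B).vol s := by
            change _ = (A.vol r - B.vol r) - (A.vol s - B.vol s); ring
          rw [e]
          exact (hd.vol s r hs hr.1 hr1).trans (by gcongr)
        have b3 := hp.abs_vol_sub_le_of_le h hs hr.1.le hr.2.le ht
        rw [← hL] at b3
        have hL0 : 0 ≤ L := by positivity
        have g1 : |(B.vol r - B.vol s) + (h.vol H r - h.vol H s)| ≤
            (K + L) * (1 + δ) * (t - s) ^ (H - κ) := by
          refine (abs_add_le _ _).trans ((add_le_add b1 b3).trans ?_)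
          rw [← add_mul]
          exact mul_le_mul_of_nonneg_right (le_mul_of_one_le_right (by positivity) hδ1) hT
        have g2 : |(A.vol r - A.vol s) + (h.vol H r - h.vol H s)| ≤
            (K + L) * (1 + δ) * (t - s) ^ (H - κ) := by
          have e : (A.vol r - A.vol s) + (h.vol H r - h.vol H s) =
            ((A.vol r - A.vol s) - (B.vol r - B.vol s)) +
              ((B.vol r - B.vol s) + (h.vol H r - h.vol H s)) := by ring
          rw [e]
          refine (abs_add_le _ _).trans ((add_le_add b2
            ((abs_add_le _ _).trans (add_le_add b1 b3))).trans ?_)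
          rw [← add_mul, ← add_mul]
          refine mul_le_mul_of_nonneg_right ?_ hT
          nlinarith
        refine (abs_pow_sub_pow_le_of_abs_le m g2 g1).trans ?_
        rw [add_sub_add_right_eq_sub]
        rcases Nat.eq_zero_or_pos m with rfl | hm0
        · simp
        calc _ ≤ m * ((K + L) * (1 + δ) * (t - s) ^ (H - κ)) ^ (m - 1) *
              (δ * (t - s) ^ (H - κ)) := by gcongr
          _ = m * (K + L) ^ (m - 1) * (δ * (1 + δ) ^ (m - 1)) *
              ((t - s) ^ (H - κ)) ^ (m - 1 + 1) := by rw [mul_pow, mul_pow]; ring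
          _ ≤ _ := by
            rw [Nat.sub_add_cancel hm0]
            have : (1 + δ) ^ (m - 1) ≤ (1 + δ) ^ m := pow_le_pow_right₀ hδ1 (Nat.sub_le _ _)
            gcongr)
    refine (abs_add_le _ _).trans ((add_le_add h1 h2).trans ?_)
    rw [← add_mul]
    refine mul_le_mul_of_nonneg_right ?_ (Real.rpow_nonneg (sub_nonneg.2 hst.le) _)
    rw [add_mul, Finset.sum_mul]
    refine add_le_add (Finset.sum_le_sum fun j hj => ?_) (le_of_eq (by ring))
    have hj := Nat.le_of_lt_succ (Finset.mem_range.1 hj)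
    have e2 : (1 + δ) ^ j ≤ (1 + δ) ^ m := pow_le_pow_right₀ hδ1 hj
    have := hV (m - j)
    have hL0 : 0 ≤ L := by positivity
    calc _ ≤ (m.choose j : ℝ) * (volPowConst H κ (m - j) * L ^ (m - j) *
          (2 ^ j * ((j + 1) * K ^ (j + 1)) * (δ * (1 + δ) ^ m))) := by gcongr
      _ = _ := by ring

/-! ### Local Lipschitz bounds in the two norms -/

theorem Admissible.exists_modelNorm_translate_sub_le {H κ : ℝ} (hp : Admissible H κ) (h : CMSpace)
    {B : ModelData} (hB : IsRVModel H κ B) (R : ℝ) :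
    ∃ C : ℝ≥0, ∀ A : ModelData, IsRVModel H κ A → modelNorm H κ (A - B) ≤ ENNReal.ofReal R →
      modelNorm H κ (translate H h A - translate H h B) ≤ C * modelNorm H κ (A - B) := by
  obtain ⟨D, hD, hT⟩ := hp.exists_translate_sub_bound h hB
  refine ⟨(1 + 2 * ∑ m ∈ Finset.range (order H + 1), D * (1 + |R|) ^ m).toNNReal,
    fun A hA hR => ?_⟩
  set δ := (modelNorm H κ (A - B)).toReal with hδ
  have hδ0 : 0 ≤ δ := ENNReal.toReal_nonneg
  have hδe : ENNReal.ofReal δ = modelNorm H κ (A - B) :=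
    ENNReal.ofReal_toReal (hR.trans_lt ENNReal.ofReal_lt_top).ne
  have hδR : δ ≤ |R| := by
    refine (ENNReal.ofReal_le_ofReal_iff (abs_nonneg R)).1 ?_
    rw [hδe]
    exact hR.trans (ENNReal.ofReal_le_ofReal (le_abs_self R))
  -- The profile `δ (1+δ)^m` dominates δ, and for `δ ≤ |R|` it is at most a constant times δ.
  have h1 := hT A δ hA hδ0 ((holderBound_of_modelNorm_le hδ0 hδe.ge).mono le_rfl fun m _ =>
    le_mul_of_one_le_right hδ0 (one_le_pow₀ (by linarith)))
  refine (h1.modelNorm_le hδ0 fun m => by positivity).trans ?_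
  rw [← hδe, ← ENNReal.ofReal.eq_1, ← ENNReal.ofReal_mul (by positivity)]
  refine ENNReal.ofReal_le_ofReal ?_
  rw [add_mul, one_mul, mul_assoc, Finset.sum_mul]
  refine add_le_add le_rfl (mul_le_mul_of_nonneg_left (Finset.sum_le_sum fun m _ => ?_) two_pos.le)
  calc D * (δ * (1 + δ) ^ m) ≤ D * (δ * (1 + |R|) ^ m) := by gcongr
    _ = _ := by ring

/-- For `δ ≥ 1` both factors are compared with `2δ`. For `δ ≤ 1`, `δ = ω^(M+1) ≤ ω^(m+1)` with `ω =
δ^(1/(M+1))`; the top level `m = M` dictates the exponent. -/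
theorem mul_one_add_pow_le {δ : ℝ} (hδ : 0 < δ) {m M : ℕ} (hm : m ≤ M) :
    δ * (1 + δ) ^ m ≤ (2 * max δ (δ ^ (1 / ((M : ℝ) + 1)))) ^ (m + 1) := by
  rcases le_total 1 δ with h | h
  · calc δ * (1 + δ) ^ m ≤ (2 * δ) * (2 * δ) ^ m := by gcongr <;> linarith
      _ = (2 * δ) ^ (m + 1) := by ring
      _ ≤ _ := by gcongr; exact le_max_left _ _
  · set ω := δ ^ (1 / ((M : ℝ) + 1)) with hω
    have hω0 : 0 ≤ ω := Real.rpow_nonneg hδ.le _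
    have hω1 : ω ≤ 1 := Real.rpow_le_one hδ.le h (by positivity)
    have e : ω ^ (M + 1) = δ := by
      rw [hω, ← Real.rpow_natCast, ← Real.rpow_mul hδ.le]
      push_cast
      rw [one_div, inv_mul_cancel₀ (by positivity), Real.rpow_one]
    have h1 : δ ≤ ω ^ (m + 1) := by
      nth_rw 1 [← e]
      exact pow_le_pow_of_le_one hω0 hω1 (by omega)
    calc δ * (1 + δ) ^ m ≤ ω ^ (m + 1) * 2 ^ m := by gcongr; linarith
      _ ≤ ω ^ (m + 1) * 2 ^ (m + 1) := by
          gcongr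
          · norm_num
          · omega
      _ = (2 * ω) ^ (m + 1) := by ring
      _ ≤ _ := by gcongr; exact le_max_right _ _

theorem Admissible.exists_homNorm_translate_sub_le {H κ : ℝ} (hp : Admissible H κ) (h : CMSpace)
    {B : ModelData} (hB : IsRVModel H κ B) :
    ∃ C : ℝ≥0, ∀ (A : ModelData) (δ : ℝ), IsRVModel H κ A → 0 < δ →
      homNorm H κ (A - B) ≤ ENNReal.ofReal δ →
      homNorm H κ (translate H h A - translate H h B) ≤
        C * ENNReal.ofReal (max δ (δ ^ (1 / ((order H : ℝ) + 1)))) := by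
  obtain ⟨D, hD, hT⟩ := hp.exists_translate_sub_bound h hB
  refine ⟨(1 + 2 * (order H + 1) * (2 * D)).toNNReal, fun A δ hA hδ hle => ?_⟩
  -- The same profile also dominates the homogeneous bound, since `δ^(m+1) ≤ δ (1+δ)^m`.
  have h1 := hT A δ hA hδ.le ((holderBound_of_homNorm_le hδ.le hle).mono le_rfl fun m _ => by
    rw [pow_succ']
    gcongr
    linarith)
  set ω := max δ (δ ^ (1 / ((order H : ℝ) + 1))) with hω
  have hω0 : 0 ≤ ω := hδ.le.trans (le_max_left _ _)
  refine (h1.homNorm_le (d := 2 * D * ω) hδ.le (by positivity) fun m hm => ?_).trans ?_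
  · calc D * (δ * (1 + δ) ^ m) ≤ D ^ (m + 1) * (2 * ω) ^ (m + 1) := by
          gcongr
          · exact le_self_pow₀ hD (by omega)
          · exact mul_one_add_pow_le hδ hm
      _ = _ := by ring
  · rw [← ENNReal.ofReal.eq_1, ← ENNReal.ofReal_mul (by positivity)]
    refine ENNReal.ofReal_le_ofReal ?_
    have : δ ≤ ω := le_max_left _ _
    linarith

/-! ### The translation as a homeomorphism -/

/-- The translation on the space of models. -/
def RVModel.translate {H κ : ℝ} (hp : Admissible H κ) (h : CMSpace) (W : RVModel H κ) :
    RVModel H κ := ⟨RoughVol.translate H h W.1, W.2.translate hp h⟩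

/-- The Lipschitz constant depends on the base point `B`; it suffices to use it on the unit ball
around `B`. -/
theorem RVModel.continuous_translate {H κ : ℝ} (hp : Admissible H κ) (h : CMSpace) :
    Continuous (RVModel.translate hp h) := by
  refine continuous_iff_continuousAt.2 fun B => ?_
  obtain ⟨C, hC⟩ := hp.exists_modelNorm_translate_sub_le h B.2 1
  have hlim : Filter.Tendsto (fun A : RVModel H κ => edist A B) (nhds B) (nhds 0) :=
    tendsto_iff_edist_tendsto_0.1 Filter.tendsto_id
  refine tendsto_iff_edist_tendsto_0.2 ?_
  have h1 : Filter.Tendsto (fun A : RVModel H κ => (C : ℝ≥0∞) * edist A B) (nhds B) (nhds 0) := by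
    simpa using ENNReal.Tendsto.const_mul hlim (Or.inr ENNReal.coe_ne_top)
  refine tendsto_of_tendsto_of_tendsto_of_le_of_le' tendsto_const_nhds h1
    (Filter.Eventually.of_forall fun _ => zero_le) ?_
  filter_upwards [hlim.eventually (gt_mem_nhds zero_lt_one)] with A hA
  exact hC A.1 A.2 (by rw [ENNReal.ofReal_one]; exact hA.le)

theorem IsRVModel.translate_translate_neg {H κ : ℝ} {A : ModelData} (hA : IsRVModel H κ A)
    (hp : Admissible H κ) (h : CMSpace) :
    RoughVol.translate H h (RoughVol.translate H (-h) A) = A := by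
  simpa using hA.translate_neg_translate hp (-h)

/-- The translation as a homeomorphism of the space of models. -/
def RVModel.translateHomeomorph {H κ : ℝ} (hp : Admissible H κ) (h : CMSpace) :
    RVModel H κ ≃ₜ RVModel H κ where
  toFun := RVModel.translate hp h
  invFun := RVModel.translate hp (-h)
  left_inv W := Subtype.ext (W.2.translate_neg_translate hp h)
  right_inv W := Subtype.ext (W.2.translate_translate_neg hp h)
  continuous_toFun := RVModel.continuous_translate hp h
  continuous_invFun := RVModel.continuous_translate hp (-h)

theorem ModelData.sub_zero_model (A : ModelData) :
    A - ⟨fun _ _ => 0, fun _ => 0, fun _ _ _ _ => 0⟩ = A := by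
  cases A
  change ModelData.mk _ _ _ = _
  simp

theorem translate_neg_lift {H κ : ℝ} (hp : Admissible H κ) (h : CMSpace) :
    translate H (-h) (lift H h) = ⟨fun _ _ => 0, fun _ => 0, fun _ _ _ _ => 0⟩ := by
  rw [← translate_zero]
  exact (IsRVModel.zero (H := H) (κ := κ)).translate_neg_translate hp h

end RoughVol

end

theorem lemmaA2 (H κ : ℝ) (hH : 0 < H) (hH' : H ≤ 1 / 2) (hκ : 0 < κ)
    (hκ' : 0 < ((order H : ℝ) + 1) * (H - κ) - 1 / 2 - κ) :
    -- (i) the Young integrals in the translation exist, and the translation is a homeomorphism of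
    -- the space of models with inverse the translation by `-h`
    (∀ (h : CMSpace) (W : RVModel H κ) (i : Fin 2) (m j : ℕ) (s t : ℝ),
      m ≤ order H → j ≤ m → 0 ≤ s → s ≤ t → t ≤ 1 →
      ∃ I, HasRSIntegral (fun r => (h.vol H r - h.vol H s) ^ (m - j))
        (fun r => W.1.iter i j s r) s t I) ∧
    (∀ h : CMSpace, ∃ T : RVModel H κ ≃ₜ RVModel H κ,
      (∀ W, (T W).1 = translate H h W.1) ∧ (∀ W, (T.symm W).1 = translate H (-h) W.1)) ∧
    -- (ii) the estimate for the homogeneous norm, uniform in `h` and `W`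
    (∃ C : ℝ≥0, ∀ (h : CMSpace) (W : RVModel H κ),
      homNorm H κ (translate H h W.1) ≤ C * (homNorm H κ W.1 + ENNReal.ofReal ‖h‖)) ∧
    -- (iii) two-sided comparison of `T_{-h} W` and `W - h`, for the model norm
    (∀ (h : CMSpace) (R : ℝ), ∃ C : ℝ≥0, ∀ (W : RVModel H κ) (δ : ℝ), 0 < δ → δ ≤ R →
      (modelNorm H κ (translate H (-h) W.1) ≤ ENNReal.ofReal δ →
        modelNorm H κ (W.1 - lift H h) ≤ C * ENNReal.ofReal δ) ∧
      (modelNorm H κ (W.1 - lift H h) ≤ ENNReal.ofReal δ →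
        modelNorm H κ (translate H (-h) W.1) ≤ C * ENNReal.ofReal δ)) ∧
    -- and for the homogeneous norm
    (∀ h : CMSpace, ∃ C : ℝ≥0, ∀ (W : RVModel H κ) (δ : ℝ), 0 < δ →
      (homNorm H κ (translate H (-h) W.1) ≤ ENNReal.ofReal δ →
        homNorm H κ (W.1 - lift H h) ≤
          C * ENNReal.ofReal (max δ (δ ^ (1 / ((order H : ℝ) + 1))))) ∧
      (homNorm H κ (W.1 - lift H h) ≤ ENNReal.ofReal δ →
        homNorm H κ (translate H (-h) W.1) ≤
          C * ENNReal.ofReal (max δ (δ ^ (1 / ((order H : ℝ) + 1)))))) := by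
  have hp : Admissible H κ := ⟨hκ, two_mul_lt_of_order hH' hκ hκ', hH'⟩
  refine ⟨fun h W i m j s t hm hj hs hst ht =>
      ⟨_, W.2.hasRSIntegral_iter hp h i (m - j) (hj.trans hm) hs hst ht⟩,
    fun h => ⟨RVModel.translateHomeomorph hp h, fun _ => rfl, fun _ => rfl⟩, ?_, fun h R => ?_,
    fun h => ?_⟩
  · obtain ⟨C, hC⟩ := hp.exists_homNorm_translate_le
    exact ⟨C, fun h W => hC h W.1 W.2⟩
  · have hlift : IsRVModel H κ (lift H h) := translate_zero H h ▸ IsRVModel.zero.translate hp h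
    -- `C₁` compares `T_h` at `T_{-h} W` with `T_h` at the zero model; `C₂` compares `T_{-h}` at `W`
    -- with `T_{-h}` at the lift, whose image is zero.
    obtain ⟨C₁, h₁⟩ := hp.exists_modelNorm_translate_sub_le h IsRVModel.zero R
    obtain ⟨C₂, h₂⟩ := hp.exists_modelNorm_translate_sub_le (-h) hlift R
    refine ⟨max C₁ C₂, fun W δ hδ hδR => ⟨fun hle => ?_, fun hle => ?_⟩⟩
    · have h3 := h₁ _ (W.2.translate hp (-h))
      rw [ModelData.sub_zero_model, W.2.translate_translate_neg hp h, translate_zero] at h3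
      refine (h3 (hle.trans (ENNReal.ofReal_le_ofReal hδR))).trans ?_
      gcongr
      exact le_max_left _ _
    · have h3 := h₂ _ W.2 (hle.trans (ENNReal.ofReal_le_ofReal hδR))
      rw [translate_neg_lift hp, ModelData.sub_zero_model] at h3
      refine h3.trans ?_
      gcongr
      exact le_max_right _ _
  · have hlift : IsRVModel H κ (lift H h) := translate_zero H h ▸ IsRVModel.zero.translate hp h
    -- The same two base points as for the model norm, without a bound on δ because ω absorbs its
    -- growth.
    obtain ⟨C₁, h₁⟩ := hp.exists_homNorm_translate_sub_le h IsRVModel.zero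
    obtain ⟨C₂, h₂⟩ := hp.exists_homNorm_translate_sub_le (-h) hlift
    refine ⟨max C₁ C₂, fun W δ hδ => ⟨fun hle => ?_, fun hle => ?_⟩⟩
    · have h3 := h₁ _ δ (W.2.translate hp (-h)) hδ
      rw [ModelData.sub_zero_model, W.2.translate_translate_neg hp h, translate_zero] at h3
      refine (h3 hle).trans ?_
      gcongr
      exact le_max_left _ _
    · have h3 := h₂ _ δ W.2 hδ hle
      rw [translate_neg_lift hp, ModelData.sub_zero_model] at h3
      refine h3.trans ?_
      gcongr
      exact le_max_right _ _
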